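/- **Setting.** Let $n\ge 1$. Formal power series are in $(z,\bar z,u)$, $z\in\mathbb C^n$, $u\in\mathbb R$; a series is real if it equals its complex conjugate (conjugate the coefficients, exchange $z$ and $\bar z$). A formal power series map $L(z,\bar z,u)=(L^{\bar z},L^w)\colon\mathbb C^n_z\to\mathbb C^n_{\bar z}\times\mathbb C_w$ without constant terms defines the formal almost CR structure on $\mathbb C^n\times\mathbb R$ whose $(1,0)$-bundle $H^{1,0}$ is the graph of $L$, i.e. is spanned by $$X_j=\frac{\partial}{\partial z_j}+\sum_k L^{\bar z}_{kj}\frac{\partial}{\partial\bar z_k}+L^w_j\frac{\partial}{\partial u},\qquad j=1,\dots,n .$$ At $0$, let $\mathcal L$ be its Levi form, $c_{jk}=\mathcal L(\overline{\partial_{z_j}},\partial_{z_k})=\frac1{2i}$ times the $\partial_u$-component of $[\overline{X_j},X_k]$ at $0$, and let $\mathcal N^w$ be the $w$-component of the non-integrability tensor, $N_{jk}=\mathcal N^w(\partial_{z_j},\partial_{z_k})=$ the $\partial_u$-component of $[X_j,X_k]$ at $0$. Thus $\mathcal L(\bar\xi,\eta)=\sum c_{jk}\bar\xi_j\eta_k$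 and $\mathcal N^w(\xi,\eta)=\sum N_{jk}\xi_j\eta_k$. The structure is *strongly nondegenerate* if $\mathcal L$ is nondegenerate and $$6i\,\mathcal L(\bar\xi,\eta)+\mathcal N^w(\xi,\eta)=0\ \text{ for all }\eta\in\mathbb C^n\ \Longrightarrow\ \xi=0 .$$ Let $\mathbf{tr}=\sum_{j,k}c^{jk}\frac{\partial^2}{\partial\bar z_j\partial z_k}$, where $(c^{jk})$ is the inverse form, $\sum_k c_{jk}c^{lk}=\delta_{jl}$. For a series $h$, $h_{z^a\bar z^bu^c}$ denotes its derivative at $0$, regarded as a polynomial homogeneous of degrees $a,b,c$ in $z,\bar z,u$; it is $a!\,b!\,c!$ times the component of $h$ of these degrees. For real $\varphi$ without constant and linear terms, the hypersurface $M'=\{\mathrm{Im}\,w'=\varphi(z',\bar z',\mathrm{Re}\,w')\}\subset\mathbb C^{n+1}$ with intrinsic coordinates $z'$, $u'=\mathrm{Re}\,w'$ carries the induced CR structure $L_\varphi=(0,\ i(1-i\varphi_{u'})^{-1}\varphi_{z'})$. The structure $L$ admits a *quasi CR embedding* at $0$ as $M'$ via $(z,u)\mapsto(z+f(z,\bar z,u),u+g(z,\bar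 z,u))$ if the structure $L'$ into which this map transforms $L$ coincides with $L_\varphi$ along the Euler vector field $e=\sum_j z'_j\frac{\partial}{\partial z'_j}$, i.e. $L'(z',\bar z',u')\,e=L_\varphi(z',\bar z',u')\,e$. **Theorem.** For every $L$ as above, without constant terms and strongly nondegenerate, and every $r\in\mathbb R$, there exist unique formal power series $f(z,\bar z,u)\in\mathbb C^n$, $g(z,\bar z,u)\in\mathbb R$ and $\varphi(z',\bar z',u')\in\mathbb R$, all without constant and linear terms, such that $g_{u^2}(0)=r$ (the second partial derivative of $g$ in $u$), such that $\varphi$ satisfies the Chern–Moser normalization $$\varphi_{z'^a u'^c}=0,\qquad \varphi_{z'\bar z'u'^{c+1}}=0,\qquad \varphi_{z'^{a+2}\bar z'u'^c}=0,$$ $$\mathbf{tr}\,(\varphi_{z'^2\bar z'^2u'^c})=0,\qquad \mathbf{tr}^2(\varphi_{z'^3\bar z'^2u'^c})=0,\qquad \mathbf{tr}^3(\varphi_{z'^3\bar z'^3u'^c})=0\qquad\text{for all }a,c\ge0,$$ and such that $L$ admits a quasi CR embedding at $0$ as the hypersurface $\mathrm{Im}\,w'=\varphi(z',\bar z',\mathrm{Re}\,w')$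 via the map $(z,u)\mapsto(z+f,u+g)$. Furthermore, each partial derivative of $f$, $g$, $\varphi$ at $0$ is given by a universal polynomial (depending only on $n$ and on the derivative in question) in $r$, finitely many derivatives of $L$ at $0$ and their complex conjugates, and the inverses of the two determinants that are nonzero by strong nondegeneracy: $\det(c_{jk})$, and the determinant of the real-linear map $\xi\mapsto 6i\,\mathcal L(\bar\xi,\cdot)+\mathcal N^w(\xi,\cdot)$ written as the complex $2n\times2n$ matrix $\begin{pmatrix}N&-6i\,\bar c\\ 6i\,c&\bar N\end{pmatrix}$ acting on row vectors $(\xi,\bar\xi)$. -/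

import Mathlib

/-! Formal almost CR structures of hypersurface type on `ℂⁿ × ℝ`.

All objects live at the origin and are formal power series in the formally independent
variables `z₁, …, zₙ, z̄₁, …, z̄ₙ, u`. -/

namespace FormalCR

open MvPowerSeries

/-- The index set of the coordinates `z₁, …, zₙ`, `z̄₁, …, z̄ₙ`, `u`. -/
abbrev Coord (n : ℕ) : Type := Fin n ⊕ (Fin n ⊕ Unit)

namespace Coord

/-- The index of `z_j`. -/
abbrev z {n : ℕ} (j : Fin n) : Coord n := Sum.inl j

/-- The index of `z̄_j`. -/
abbrev zb {n : ℕ} (j : Fin n) : Coord n := Sum.inr (Sum.inl j)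

/-- The index of `u`. -/
abbrev u {n : ℕ} : Coord n := Sum.inr (Sum.inr ())

/-- Conjugation of the coordinates: `z_j ↔ z̄_j`, and `u` is fixed. -/
def bar {n : ℕ} : Coord n ≃ Coord n where
  toFun
    | Sum.inl j => zb j
    | Sum.inr (Sum.inl j) => z j
    | Sum.inr (Sum.inr _) => u
  invFun
    | Sum.inl j => zb j
    | Sum.inr (Sum.inl j) => z j
    | Sum.inr (Sum.inr _) => u
  left_inv := by rintro (j | j | _) <;> rfl
  right_inv := by rintro (j | j | _) <;> rfl

end Coord

/-- Complex-valued formal power series in `(z, z̄, u)`. -/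
abbrev Ser (n : ℕ) : Type := MvPowerSeries (Coord n) ℂ

/-- Multi-indices in the variables `(z, z̄, u)`. -/
abbrev MIdx (n : ℕ) : Type := Coord n →₀ ℕ

/-- The complex conjugate of a power series: conjugate the coefficients and swap `z` and `z̄`. -/
noncomputable def conj {n : ℕ} (p : Ser n) : Ser n :=
  fun m => star (coeff (Finsupp.equivMapDomain Coord.bar m) p)

/-- A power series is real (real-valued on `z̄ = conj z`, `u` real) if it equals its conjugate. -/
def IsReal {n : ℕ} (p : Ser n) : Prop := conj p = p

/-- `p` has no constant and no linear terms. -/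
def VanishesToSecondOrder {n : ℕ} (p : Ser n) : Prop :=
  ∀ m : MIdx n, m.degree ≤ 1 → coeff m p = 0

/-- The partial derivative at the origin, of multi-order `m`. -/
noncomputable def derivAtZero {n : ℕ} (m : MIdx n) (p : Ser n) : ℂ :=
  (m.prod fun _ k => (k.factorial : ℂ)) * coeff m p

/-- The derivative `p_{z^a z̄^b u^c}` at the origin, regarded as a polynomial homogeneous of degree
`a` in `z`, `b` in `z̄` and `c` in `u`, that is, the sum of
`∂_{z_{i_1}} ⋯ ∂_{z_{i_a}} ∂_{z̄_{j_1}} ⋯ ∂_{z̄_{j_b}} ∂_u^c p (0)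
  z_{i_1} ⋯ z_{i_a} z̄_{j_1} ⋯ z̄_{j_b} u^c` over all tuples of indices.
It is `a! b! c!` times the component of `p` of this multidegree. -/
noncomputable def multiDeriv {n : ℕ} (a b c : ℕ) (p : Ser n) : Ser n := fun m =>
  if (∑ j, m (Coord.z j)) = a ∧ (∑ j, m (Coord.zb j)) = b ∧ m Coord.u = c then
    (a.factorial * b.factorial * c.factorial : ℂ) * coeff m p
  else 0

/-! ### Formal complex vector fields -/

/-- A formal section `∑ᵢ Xᵢ ∂/∂xᵢ` of the complexified tangent bundle of `ℂⁿ × ℝ`, in the frame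
`∂/∂z_j`, `∂/∂z̄_j`, `∂/∂u`. -/
abbrev VField (n : ℕ) : Type := Coord n → Ser n

/-- The derivative `X p` of a power series along a vector field. -/
noncomputable def VField.apply {n : ℕ} (X : VField n) (p : Ser n) : Ser n :=
  ∑ i, X i * pderiv ℂ i p

/-- The Lie bracket `[X, Y]`. -/
noncomputable def VField.bracket {n : ℕ} (X Y : VField n) : VField n :=
  fun i => X.apply (Y i) - Y.apply (X i)

/-- The complex conjugate vector field. -/
noncomputable def VField.conj {n : ℕ} (X : VField n) : VField n :=
  fun i => FormalCR.conj (X (Coord.bar i))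

/-! ### Almost CR structures -/

/-- A formal power series map `L(z, z̄, u) : ℂⁿ_z → ℂⁿ_z̄ × ℂ_w`: its value at `∂/∂z_j` is
`∑_k L.zb k j ∂/∂z̄_k + L.w j ∂/∂u`. The `(1,0)`-bundle of the almost CR structure given by `L`
is the graph of `L`. -/
structure AlmostCR (n : ℕ) where
  zb : Fin n → Fin n → Ser n
  w : Fin n → Ser n

namespace AlmostCR

variable {n : ℕ} (L : AlmostCR n)

/-- `L` has no constant terms, i.e. the `(1,0)`-space at the origin is `ℂⁿ_z × {0}`. -/
def NoConstantTerms : Prop :=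
  (∀ k j, constantCoeff (L.zb k j) = 0) ∧ ∀ j, constantCoeff (L.w j) = 0

/-- The section `∂/∂z_j + L(∂/∂z_j)` of the `(1,0)`-bundle; these form a frame of the bundle. -/
noncomputable def frame (j : Fin n) : VField n
  | Sum.inl i => if i = j then 1 else 0
  | Sum.inr (Sum.inl k) => L.zb k j
  | Sum.inr (Sum.inr _) => L.w j

/-- The matrix `c_{jk} = 𝓛(∂/∂z_j, ∂/∂z_k)` of the Levi form at the origin (when `L` has no
constant terms), where `𝓛(X, Y) = (1 / 2i) [X̄, Y]` modulo `ℂH = {du = 0}`, a form that is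
conjugate-linear in the first argument and linear in the second one. -/
noncomputable def leviMatrix : Matrix (Fin n) (Fin n) ℂ := fun j k =>
  (1 / (2 * Complex.I)) *
    constantCoeff (((L.frame j).conj.bracket (L.frame k)) Coord.u)

/-- The matrix `𝓝ʷ(∂/∂z_j, ∂/∂z_k)` of the transversal (`w`-)component of the non-integrability
tensor `𝓝(X, Y) = [X, Y]` modulo the `(1,0)`-space, at the origin (when `L` has no constant
terms). -/
noncomputable def nonintMatrix : Matrix (Fin n) (Fin n) ℂ := fun j k =>
  constantCoeff (((L.frame j).bracket (L.frame k)) Coord.u)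

/-- The Levi form `𝓛(ξ̄, η)` at the origin. -/
noncomputable def levi (ξ η : Fin n → ℂ) : ℂ :=
  ∑ j, ∑ k, L.leviMatrix j k * star (ξ j) * η k

/-- The form `𝓝ʷ(ξ, η)` at the origin. -/
noncomputable def nonint (ξ η : Fin n → ℂ) : ℂ :=
  ∑ j, ∑ k, L.nonintMatrix j k * ξ j * η k

/-- Strong nondegeneracy: both `𝓛` and `6i𝓛 + 𝓝ʷ` are nondegenerate. -/
def StronglyNondegenerate : Prop :=
  (∀ ξ : Fin n → ℂ, (∀ η, L.levi ξ η = 0) → ξ = 0) ∧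
  (∀ ξ : Fin n → ℂ, (∀ η, 6 * Complex.I * L.levi ξ η + L.nonint ξ η = 0) → ξ = 0)

/-- The trace operator `tr = ∑ c^{jk} ∂²/∂z̄_j∂z_k` of the Levi form `∑ c_{jk} z̄_j z_k`, where
`(c^{jk})` is the inverse form, `∑_k c_{jk} c^{lk} = δ_{jl}`; so `tr (∑ c_{jk} z̄_j z_k) = n`. -/
noncomputable def tr (p : Ser n) : Ser n :=
  ∑ j, ∑ k, C (L.leviMatrix⁻¹ k j) * pderiv ℂ (Coord.zb j) (pderiv ℂ (Coord.z k) p)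

/-- The `z̄_k`-component of the evaluation of `L` along the Euler field `e = ∑ z_j ∂/∂z_j`. -/
noncomputable def radialZb (k : Fin n) : Ser n := ∑ j, X (Coord.z j) * L.zb k j

/-- The `w`-component of the evaluation of `L` along the Euler field `e = ∑ z_j ∂/∂z_j`. -/
noncomputable def radialW : Ser n := ∑ j, X (Coord.z j) * L.w j

/-- Two almost CR structures coincide along the Euler vector field. -/
def CoincideAlongEuler (L L' : AlmostCR n) : Prop :=
  (∀ k, L.radialZb k = L'.radialZb k) ∧ L.radialW = L'.radialW

/-- The components `(z', z̄', u')` of the map `z' = z + f`, `u' = u + g`. -/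
noncomputable def mapComponents (f : Fin n → Ser n) (g : Ser n) : Coord n → Ser n
  | Sum.inl j => X (Coord.z j) + f j
  | Sum.inr (Sum.inl j) => X (Coord.zb j) + FormalCR.conj (f j)
  | Sum.inr (Sum.inr _) => X Coord.u + g

/-- The map `h = id + (f, g)` transforms the structure `L` into `L'`: for every frame section `X`
of the `(1,0)`-bundle of `L`, the vector `dh(X)` with components `X z'_l`, `X z̄'_k`, `X u'` lies
in the graph of `L'` at the image point. -/
def TransformsInto (L : AlmostCR n) (f : Fin n → Ser n) (g : Ser n) (L' : AlmostCR n) : Prop :=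
  (∀ j k, (L.frame j).apply (mapComponents f g (Coord.zb k)) =
    ∑ l, subst (mapComponents f g) (L'.zb k l) *
      (L.frame j).apply (mapComponents f g (Coord.z l))) ∧
  (∀ j, (L.frame j).apply (mapComponents f g Coord.u) =
    ∑ l, subst (mapComponents f g) (L'.w l) *
      (L.frame j).apply (mapComponents f g (Coord.z l)))

end AlmostCR

/-- The CR structure induced on the real hypersurface `Im w = φ(z, z̄, Re w)` of `ℂⁿ⁺¹`, in the
intrinsic coordinates `z` and `u = Re w`: `L^z̄ = 0` and `L^w = i (1 - i φ_u)⁻¹ φ_z`. -/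
noncomputable def graphStructure {n : ℕ} (φ : Ser n) : AlmostCR n where
  zb := fun _ _ => 0
  w := fun j => C Complex.I * (1 - C Complex.I * pderiv ℂ Coord.u φ)⁻¹ * pderiv ℂ (Coord.z j) φ

/-- The frame of `graphStructure φ` annihilates the restrictions `z̄_k` and `w̄ = u - i φ` of the
antiholomorphic coordinates to the hypersurface. -/
theorem graphStructure_frame {n : ℕ} (φ : Ser n) (hφ : VanishesToSecondOrder φ) (j : Fin n) :
    (∀ k, ((graphStructure φ).frame j).apply (X (Coord.zb k)) = 0) ∧
    ((graphStructure φ).frame j).apply (X Coord.u - C Complex.I * φ) = 0 := by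
  classical
  have hu : constantCoeff (1 - C Complex.I * pderiv ℂ Coord.u φ : Ser n) ≠ 0 := by
    have h1 := hφ (Finsupp.single Coord.u 1) (by simp)
    have h2 : constantCoeff (pderiv ℂ (Coord.u (n := n)) φ) = 0 := by
      rw [← coeff_zero_eq_constantCoeff_apply, coeff_pderiv]
      simp [h1]
    simp [h2]
  have hinv := MvPowerSeries.inv_mul_cancel _ hu
  constructor
  · intro k
    simp [VField.apply, AlmostCR.frame, graphStructure, pderiv_X, Pi.single_apply]
  · have hC : ∀ i : Coord n, pderiv ℂ i (C Complex.I : Ser n) = 0 := fun i => by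
      rw [MvPowerSeries.pderiv_C]
    simp [VField.apply, AlmostCR.frame, graphStructure, pderiv_X, Pi.single_apply, hC]
    linear_combination (C Complex.I * pderiv ℂ (Coord.z j) φ) * hinv

/-- The almost CR structure `L` admits a quasi CR embedding at `0` as the hypersurface
`Im w' = φ(z', z̄', Re w')`, where `p = 0` and the tangent space at `0` is `ℂⁿ × ℝ`, via the map
`(z, u) ↦ (z + f, u + g)`: the transformed structure and the one induced by the embedding coincide
along the Euler vector field. -/
structure IsQuasiCREmbedding {n : ℕ} (L : AlmostCR n) (f : Fin n → Ser n) (g φ : Ser n) :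
    Prop where
  real_g : IsReal g
  real_φ : IsReal φ
  order_f : ∀ k, VanishesToSecondOrder (f k)
  order_g : VanishesToSecondOrder g
  order_φ : VanishesToSecondOrder φ
  radial : ∃ L' : AlmostCR n, L.TransformsInto f g L' ∧ L'.CoincideAlongEuler (graphStructure φ)

/-- The Chern-Moser normalization of `φ`, with respect to the trace operator of the Levi form
of `L` at the origin. -/
structure ChernMoserNormalized {n : ℕ} (L : AlmostCR n) (φ : Ser n) : Prop where
  pure : ∀ a c, multiDeriv a 0 c φ = 0
  deg11 : ∀ c, multiDeriv 1 1 (c + 1) φ = 0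
  degk1 : ∀ a c, multiDeriv (a + 2) 1 c φ = 0
  deg22 : ∀ c, L.tr (multiDeriv 2 2 c φ) = 0
  deg32 : ∀ c, L.tr (L.tr (multiDeriv 3 2 c φ)) = 0
  deg33 : ∀ c, L.tr (L.tr (L.tr (multiDeriv 3 3 c φ))) = 0

/-- `(f, g, φ)` puts `L` into extrinsic normal form, with `g_{u²}(0) = r`. -/
structure IsExtrinsicNormalForm {n : ℕ} (L : AlmostCR n) (r : ℝ)
    (f : Fin n → Ser n) (g φ : Ser n) : Prop where
  quasi : IsQuasiCREmbedding L f g φ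
  normalized : ChernMoserNormalized L φ
  g_uu : derivAtZero (Finsupp.single Coord.u 2) g = (r : ℂ)

/-! ### The quantities that the universal polynomials may involve -/

/-- The real-linear map `ξ ↦ (6i𝓛 + 𝓝ʷ)(ξ, ·)` as a complex `2n × 2n` matrix acting on the row
vector `(ξ, ξ̄)`. -/
noncomputable def AlmostCR.strongMatrix {n : ℕ} (L : AlmostCR n) :
    Matrix (Fin n ⊕ Fin n) (Fin n ⊕ Fin n) ℂ :=
  Matrix.fromBlocks L.nonintMatrix ((-6 * Complex.I) • L.leviMatrix.map star)
    ((6 * Complex.I) • L.leviMatrix) (L.nonintMatrix.map star)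

/-- The variables of the universal polynomials: `r`, the partial derivatives of the components of
`L` at `0` and their conjugates, and the inverses of the two nondegeneracy determinants. -/
inductive JetVar (n : ℕ) : Type
  | r : JetVar n
  | zb (k j : Fin n) (m : MIdx n) : JetVar n
  | w (j : Fin n) (m : MIdx n) : JetVar n
  | zbConj (k j : Fin n) (m : MIdx n) : JetVar n
  | wConj (j : Fin n) (m : MIdx n) : JetVar n
  | invLevi : JetVar n
  | invStrong : JetVar n

/-- The values of the variables for given `L` and `r`. -/
noncomputable def AlmostCR.jet {n : ℕ} (L : AlmostCR n) (r : ℝ) : JetVar n → ℂ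
  | .r => (r : ℂ)
  | .zb k j m => derivAtZero m (L.zb k j)
  | .w j m => derivAtZero m (L.w j)
  | .zbConj k j m => star (derivAtZero m (L.zb k j))
  | .wConj j m => star (derivAtZero m (L.w j))
  | .invLevi => (L.leviMatrix.det)⁻¹
  | .invStrong => (L.strongMatrix.det)⁻¹

end FormalCR

/-! Let $(z',u')\mapsto(z'+F,u'+G)$ be the inverse of the required map. The transformed structure
agrees with $L_\varphi$ along $e$ exactly when the field $(1-i\varphi_u)(e+L_\varphi e)$, called
`radial φ`, is carried by the inverse map into the graph of $L$. This eliminates $L'$ and leaves the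
equations `errB = 0` and `errW = 0` for $F,G,\varphi$ (`IsInv.exists_transformsInto_iff`). The
coefficients of $f,g$ need not be tracked: they are recovered by formal inversion.

Give $z,\bar z$ weight 1 and $u$ weight 2. In weight two the equations and the normalization force
$\varphi=Q+\dots$ with $Q=\mathcal L(\bar z,z)$, and fix the part of $G$ that does not depend on $u$
(`q2`). Hence `radial φ` is to leading order $T=e+iQ\,\partial_u$ (`eulH`), and the two errors are
to leading order $T\bar F$ and a linear expression `lam`. All remaining terms have higher weight
(`Adm.errB_sub`, `Adm.errW_sub`), so successive approximation reduces existence and uniqueness to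
the linear system.

In the linear system a shear of $G$ removes the symmetric part of the linear part of $L^w$. Then $G$
and $\varphi$ combine into one unknown $V=G+i\varphi-i\mathcal L(\bar z,F)-i\overline{\mathcal
L(\bar z,F)}-\frac12\mathcal N^w(z,F)$, and the homogeneous system becomes $T\bar F=0$, $TV+\mathcal
N^w(z,F)=0$ (`LinModel.lam_eq`). On bidegree $(a,b)$ in $(z,\bar z)$ the operator $T$ is
multiplication by $a$ plus a contribution from bidegree $(a-1,b-1)$. So the inhomogeneous system is
solvable whenever its right-hand side lies in the ideal generated by $z$, and homogeneous solutions
are parametrized freely by the components $F_{a,0}$ and $V_{0,b}$.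

The Chern–Moser conditions determine these components. Bidegree $(0,0)$ gives
$\mathrm{Im}\,V_{0,0}$; $(a,0)$ with $a\ge1$ gives $V_{0,a}$; $(a,1)$ with $a\ge2$ gives $F_{a,0}$;
$(1,1)$ gives the hermitian part of $\mathcal L(\bar z,F_{1,0})$. The other three are differential
equations in $u$: $(3,3)$ of third order for $\mathrm{Re}\,V_{0,0}$, $(2,2)$ of first order for the
skew part of $\mathcal L(\bar z,F_{1,0})$, and $(3,2)$ of second order for $F_{0,0}$. In the last
one the leading coefficient is $6i\mathcal L+\mathcal N^w$, which is where strong nondegeneracy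
enters. The traces are inverted through $[\mathbf{tr},Q]=n+e+\bar e$. Initial values come from the
weights, the absence of linear terms, and $r$. This is `Model.homog_unique` and
`Model.homog_exists`.

For the universal polynomials, all of this is done over a commutative star algebra over $\mathbb C$
in which the two matrices have given inverses. It is applied to the algebra of those functions of
$(L,r)$ that are universal polynomials in the jet. A single solution there specializes to a normal
form of every $(L,r)$, and uniqueness over $\mathbb C$ identifies it with any other. -/

namespace FormalCR

open MvPowerSeries

/-! ### Weighted order filtrations and contraction arguments -/

section Filtration

variable {σ R : Type*} [CommRing R] {w : σ → ℕ}

/-- The ideal of the power series all of whose monomials have weight at least `k`. -/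
def fil (w : σ → ℕ) (k : ℕ) : Ideal (MvPowerSeries σ R) where
  carrier := {p | ∀ m, Finsupp.weight w m < k → coeff m p = 0}
  add_mem' := fun hp hq m hm => by rw [map_add, hp m hm, hq m hm, add_zero]
  zero_mem' := fun m _ => map_zero _
  smul_mem' := fun c p hp m hm => by
    classical
    rw [smul_eq_mul, coeff_mul]
    refine Finset.sum_eq_zero fun x hx => ?_
    rw [hp x.2, mul_zero]
    rw [← Finset.HasAntidiagonal.mem_antidiagonal.mp hx, map_add] at hm
    omega

set_option linter.unusedSectionVars false

theorem fil_zero (p : MvPowerSeries σ R) : p ∈ fil w 0 := fun _ hm => absurd hm (Nat.not_lt_zero _)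

theorem fil_mono {k l : ℕ} (h : l ≤ k) {p : MvPowerSeries σ R} (hp : p ∈ fil w k) :
    p ∈ fil w l := fun m hm => hp m (lt_of_lt_of_le hm h)

theorem fil_mul {k l : ℕ} {p q : MvPowerSeries σ R} (hp : p ∈ fil w k) (hq : q ∈ fil w l) :
    p * q ∈ fil w (k + l) := by
  classical
  intro m hm
  rw [coeff_mul]
  refine Finset.sum_eq_zero fun x hx => ?_
  rw [← Finset.HasAntidiagonal.mem_antidiagonal.mp hx, map_add] at hm
  by_cases h : Finsupp.weight w x.1 < k
  · rw [hp _ h, zero_mul]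
  · rw [hq x.2 (by omega), mul_zero]

theorem fil_mul' {k l s : ℕ} {p q : MvPowerSeries σ R} (hp : p ∈ fil w k) (hq : q ∈ fil w l)
    (h : s ≤ k + l) : p * q ∈ fil w s := fil_mono h (fil_mul hp hq)

theorem eq_zero_of_forall_fil {p : MvPowerSeries σ R} (h : ∀ k, p ∈ fil w k) : p = 0 := by
  ext m
  exact h (Finsupp.weight w m + 1) m (Nat.lt_succ_self _)

theorem X_mem_fil (i : σ) : (X i : MvPowerSeries σ R) ∈ fil w (w i) := by
  classical
  intro m hm
  rw [coeff_X, if_neg]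
  rintro rfl
  rw [Finsupp.weight_single, one_smul] at hm
  exact lt_irrefl _ hm

theorem pderiv_mem_fil {k l : ℕ} {p : MvPowerSeries σ R} (hp : p ∈ fil w k) (i : σ)
    (h : l + w i ≤ k) : pderiv R i p ∈ fil w l := by
  intro m hm
  rw [coeff_pderiv, hp, zero_mul]
  rw [map_add, Finsupp.weight_single, one_smul]
  omega

theorem fil_pow {k : ℕ} {p : MvPowerSeries σ R} (hp : p ∈ fil w k) (d : ℕ) :
    p ^ d ∈ fil w (d * k) := by
  induction d with
  | zero => rw [zero_mul]; exact fil_zero _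
  | succ d ih => rw [pow_succ, Nat.succ_mul]; exact fil_mul ih hp

/-- A sequence that is Cauchy for the filtration converges. -/
theorem exists_fil_limit {ι : Type*} (w : σ → ℕ) (x : ℕ → ι → MvPowerSeries σ R)
    (hx : ∀ k i, x (k + 1) i - x k i ∈ fil w k) :
    ∃ y : ι → MvPowerSeries σ R, ∀ k i, y i - x k i ∈ fil w k := by
  have hmono : ∀ k l i, x (k + l) i - x k i ∈ fil w k := by
    intro k l i
    induction l with
    | zero => simp
    | succ l ih =>
      have := Ideal.add_mem _ (fil_mono (Nat.le_add_right k l) (hx (k + l) i)) ih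
      simpa [add_assoc] using this
  refine ⟨fun i => fun m => coeff m (x (Finsupp.weight w m + 1) i), fun k i m hm => ?_⟩
  obtain ⟨l, rfl⟩ : ∃ l, k = Finsupp.weight w m + 1 + l := ⟨k - (Finsupp.weight w m + 1), by omega⟩
  have := hmono (Finsupp.weight w m + 1) l i m (Nat.lt_succ_self _)
  rw [map_sub, sub_eq_zero] at this
  refine (map_sub _ _ _).trans (sub_eq_zero.mpr ?_)
  rw [this]
  rfl

/-- A map that is contracting for the filtration on a closed set has a fixed point. -/
theorem exists_fixedPoint {ι : Type*} (w : σ → ℕ) (S : Set (ι → MvPowerSeries σ R))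
    (Φ : (ι → MvPowerSeries σ R) → ι → MvPowerSeries σ R) (h0 : 0 ∈ S)
    (hS : ∀ x ∈ S, Φ x ∈ S)
    (hcl : ∀ y, (∀ k, ∃ x ∈ S, ∀ i, y i - x i ∈ fil w k) → y ∈ S)
    (hΦ : ∀ k, ∀ x ∈ S, ∀ y ∈ S, (∀ i, x i - y i ∈ fil w k) →
      ∀ i, Φ x i - Φ y i ∈ fil w (k + 1)) :
    ∃ x ∈ S, Φ x = x := by
  let x : ℕ → ι → MvPowerSeries σ R := fun k => Φ^[k] 0
  have hxS : ∀ k, x k ∈ S := by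
    intro k
    induction k with
    | zero => exact h0
    | succ k ih => simp only [x, Function.iterate_succ_apply']; exact hS _ ih
  have hx : ∀ k i, x (k + 1) i - x k i ∈ fil w k := by
    intro k
    induction k with
    | zero => exact fun i => fil_zero _
    | succ k ih =>
      have := hΦ k _ (hxS (k + 1)) _ (hxS k) ih
      simpa only [x, Function.iterate_succ_apply'] using this
  obtain ⟨y, hy⟩ := exists_fil_limit w x hx
  have hyS : y ∈ S := hcl y fun k => ⟨x k, hxS k, hy k⟩
  refine ⟨y, hyS, funext fun i => ?_⟩
  rw [← sub_eq_zero]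
  refine eq_zero_of_forall_fil (w := w) fun k => ?_
  have h1 := fil_mono (Nat.le_succ k) (hΦ k y hyS _ (hxS k) (hy k) i)
  have h2 := fil_mono (Nat.le_succ k) (hy (k + 1) i)
  have h3 : Φ (x k) = x (k + 1) := by simp only [x, Function.iterate_succ_apply']
  rw [h3] at h1
  have := Ideal.sub_mem _ h1 h2
  simpa using this

end Filtration

/-! ### Substitution, chain rule and formal inverse maps -/

section Subst

variable {σ R : Type*} [CommRing R] [Finite σ] {w : σ → ℕ}

omit [Finite σ] in
theorem prod_pow_mem_fil {a : σ → MvPowerSeries σ R} (ha : ∀ i, a i ∈ fil w (w i)) (d : σ →₀ ℕ) :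
    (d.prod fun i e => a i ^ e) ∈ fil w (Finsupp.weight w d) := by
  classical
  induction d using Finsupp.induction_linear with
  | zero => exact fil_zero _
  | add f g hf hg =>
    rw [Finsupp.prod_add_index' (by simp) (fun i => pow_add _), map_add]
    exact fil_mul hf hg
  | single i e =>
    rw [Finsupp.prod_single_index (h := fun i e => a i ^ e) (pow_zero _), Finsupp.weight_single]
    exact fil_pow (ha i) e

omit [Finite σ] in
theorem pow_sub_pow_mem_fil {k l : ℕ} {p q : MvPowerSeries σ R} (hp : p ∈ fil w k)
    (hq : q ∈ fil w k) (h : p - q ∈ fil w (k + l)) (d : ℕ) :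
    p ^ d - q ^ d ∈ fil w (d * k + l) := by
  induction d with
  | zero => simp
  | succ d ih =>
    have : p ^ (d + 1) - q ^ (d + 1) = (p ^ d - q ^ d) * p + q ^ d * (p - q) := by ring
    rw [this]
    refine Ideal.add_mem _ (fil_mul' ih hp ?_) (fil_mul' (fil_pow hq d) h ?_)
    · rw [Nat.succ_mul]; omega
    · rw [Nat.succ_mul]; omega

omit [Finite σ] in
theorem prod_pow_sub_mem_fil {k : ℕ} {a b : σ → MvPowerSeries σ R} (ha : ∀ i, a i ∈ fil w (w i))
    (hb : ∀ i, b i ∈ fil w (w i)) (h : ∀ i, a i - b i ∈ fil w (w i + k)) (d : σ →₀ ℕ) :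
    (d.prod fun i e => a i ^ e) - (d.prod fun i e => b i ^ e) ∈
      fil w (Finsupp.weight w d + k) := by
  classical
  induction d using Finsupp.induction_linear with
  | zero => simp
  | add f g hf hg =>
    rw [Finsupp.prod_add_index' (by simp) (fun i => pow_add _),
      Finsupp.prod_add_index' (by simp) (fun i => pow_add _), map_add]
    have : ∀ x y x' y' : MvPowerSeries σ R, x * y - x' * y' = (x - x') * y + x' * (y - y') := by
      intros; ring
    rw [this]
    exact Ideal.add_mem _ (fil_mul' hf (prod_pow_mem_fil ha g) (by omega))
      (fil_mul' (prod_pow_mem_fil hb f) hg (by omega))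
  | single i e =>
    rw [Finsupp.prod_single_index (h := fun i e => a i ^ e) (pow_zero _),
      Finsupp.prod_single_index (h := fun i e => b i ^ e) (pow_zero _),
      Finsupp.weight_single, smul_eq_mul]
    exact pow_sub_pow_mem_fil (ha i) (hb i) (h i) e

omit [Finite σ] in
theorem subst_mem_fil {k : ℕ} {a : σ → MvPowerSeries σ R} (hs : HasSubst a)
    (ha : ∀ i, a i ∈ fil w (w i)) {p : MvPowerSeries σ R} (hp : p ∈ fil w k) :
    subst a p ∈ fil w k := by
  intro m hm
  rw [coeff_subst hs, finsum_eq_zero_of_forall_eq_zero]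
  intro d
  by_cases hd : Finsupp.weight w d < k
  · rw [hp d hd, zero_smul]
  · rw [prod_pow_mem_fil ha d m (by omega), smul_zero]

omit [Finite σ] in
-- Substitution of a weight-respecting map does not lower weights, and in each monomial the product
-- rule shows that perturbing the map by relative weight `l` costs at least `l`. This Lipschitz
-- estimate is what makes the later iterations gain weight.
theorem subst_sub_subst_mem_fil {k l : ℕ} {a b : σ → MvPowerSeries σ R} (has : HasSubst a)
    (hbs : HasSubst b) (ha : ∀ i, a i ∈ fil w (w i))
    (hb : ∀ i, b i ∈ fil w (w i)) (h : ∀ i, a i - b i ∈ fil w (w i + l))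
    {p : MvPowerSeries σ R} (hp : p ∈ fil w k) :
    subst a p - subst b p ∈ fil w (k + l) := by
  intro m hm
  rw [map_sub, coeff_subst has, coeff_subst hbs,
    ← finsum_sub_distrib (coeff_subst_finite has p m) (coeff_subst_finite hbs p m),
    finsum_eq_zero_of_forall_eq_zero]
  intro d
  rw [← smul_sub, ← map_sub]
  by_cases hd : Finsupp.weight w d < k
  · rw [hp d hd, zero_smul]
  · rw [prod_pow_sub_mem_fil ha hb h d m (by omega), smul_zero]

theorem hasSubst_of_mem_fil {a : σ → MvPowerSeries σ R} (ha : ∀ i, a i ∈ fil (fun _ => 1) 1) :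
    HasSubst a :=
  hasSubst_of_constantCoeff_zero fun i => by
    rw [← coeff_zero_eq_constantCoeff_apply]
    exact ha i 0 (by simp)

variable [DecidableEq σ] [Fintype σ]

omit [Fintype σ] in
theorem exists_polynomial_sub_mem_fil (p : MvPowerSeries σ R) (k : ℕ) :
    ∃ q : MvPolynomial σ R, p - (q : MvPowerSeries σ R) ∈ fil (fun _ : σ => 1) k := by
  classical
  have hfin := Finsupp.finite_of_nat_weight_lt (σ := σ) (fun _ => 1) (by simp) k
  refine ⟨∑ m ∈ hfin.toFinset, MvPolynomial.monomial m (coeff m p), fun m hm => ?_⟩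
  rw [map_sub, MvPolynomial.coeff_coe, MvPolynomial.coeff_sum, sub_eq_zero]
  simp only [MvPolynomial.coeff_monomial]
  rw [Finset.sum_ite_eq' hfin.toFinset m, if_pos]
  simpa using hm

/-- The chain rule. -/
theorem pderiv_subst {a : σ → MvPowerSeries σ R} (ha : ∀ i, a i ∈ fil (fun _ => 1) 1) (i : σ)
    (p : MvPowerSeries σ R) :
    pderiv R i (subst a p) = ∑ j, subst a (pderiv R j p) * pderiv R i (a j) := by
  have hs := hasSubst_of_mem_fil ha
  have hpoly : ∀ q : MvPolynomial σ R, pderiv R i (subst a (q : MvPowerSeries σ R)) =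
      ∑ j, subst a (pderiv R j (q : MvPowerSeries σ R)) * pderiv R i (a j) := by
    intro q
    simp only [← coe_substAlgHom hs]
    induction q using MvPolynomial.induction_on with
    | C r =>
      have : (substAlgHom hs) (C r : MvPowerSeries σ R) = C r :=
        (substAlgHom hs (R := R)).commutes r
      rw [MvPolynomial.coe_C, this]
      simp only [pderiv_C, map_zero, zero_mul, Finset.sum_const_zero]
    | add f g hf hg =>
      simp only [MvPolynomial.coe_add, map_add, hf, hg, add_mul, Finset.sum_add_distrib]
    | mul_X f j hf =>
      have hX : substAlgHom hs (X j : MvPowerSeries σ R) = a j := substAlgHom_X hs j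
      have hd : ∀ x : σ, substAlgHom hs (pderiv R x (X j : MvPowerSeries σ R)) =
          if x = j then 1 else 0 := by
        intro x
        rw [pderiv_X, Pi.single_apply]
        by_cases h : x = j
        · rw [if_pos h, if_pos h.symm, map_one]
        · rw [if_neg h, if_neg (Ne.symm h), map_zero]
      simp only [MvPolynomial.coe_mul, MvPolynomial.coe_X, map_mul, Derivation.leibniz, smul_eq_mul,
        map_add, hf, hX, hd, mul_ite, mul_one, mul_zero, add_mul, ite_mul, zero_mul,
        Finset.sum_add_distrib, Finset.sum_ite_eq', Finset.mem_univ, if_true, Finset.mul_sum,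
        mul_assoc]
  rw [← sub_eq_zero]
  refine eq_zero_of_forall_fil (w := fun _ => 1) fun k => ?_
  -- Both sides depend continuously on `p`, so polynomials suffice; the order is `k + 1` because the
  -- derivative loses one.
  obtain ⟨q, hq⟩ := exists_polynomial_sub_mem_fil p (k + 1)
  have e1 := pderiv_mem_fil (l := k) (subst_mem_fil hs ha hq) i le_rfl
  have e2 : ∑ j, subst a (pderiv R j (p - (q : MvPowerSeries σ R))) * pderiv R i (a j) ∈
      fil (fun _ : σ => 1) k := Ideal.sum_mem _ fun j _ => Ideal.mul_mem_right _ _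
        (subst_mem_fil hs ha (pderiv_mem_fil (l := k) hq j le_rfl))
  have e3 := Ideal.sub_mem _ e1 e2
  convert e3 using 1
  rw [subst_sub hs, map_sub, hpoly q]
  simp only [map_sub, subst_sub hs, sub_mul, Finset.sum_sub_distrib]
  abel

omit [DecidableEq σ] [Fintype σ] in
/-- A formal change of coordinates that is the identity to first order has an inverse. -/
theorem exists_right_inverse (a : σ → MvPowerSeries σ R)
    (ha : ∀ i, a i - X i ∈ fil (fun _ => 1) 2) :
    ∃ b : σ → MvPowerSeries σ R, (∀ i, b i - X i ∈ fil (fun _ => 1) 2) ∧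
      ∀ i, subst b (a i) = X i := by
  have h1 : ∀ f : σ → MvPowerSeries σ R, (∀ i, f i ∈ fil (fun _ => 1) 2) →
      ∀ i, X i + f i ∈ fil (fun _ : σ => 1) 1 := fun f hf i =>
    Ideal.add_mem _ (X_mem_fil (w := fun _ => 1) i) (fil_mono (by norm_num) (hf i))
  -- The inverse is sought as `X + f`, which means `f = -(a - X)(X + f)`. Since `a - X` has order
  -- two, the right-hand side is a contraction.
  obtain ⟨f, hf, hfix⟩ := exists_fixedPoint (fun _ : σ => 1)
    {f : σ → MvPowerSeries σ R | ∀ i, f i ∈ fil (fun _ => 1) 2}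
    (fun f i => - subst (fun j => X j + f j) (a i - X i))
    (fun i => Ideal.zero_mem _)
    (fun f hf i => neg_mem (subst_mem_fil (hasSubst_of_mem_fil (h1 f hf)) (h1 f hf) (ha i)))
    (fun y hy i => by
      obtain ⟨x, hx, hxy⟩ := hy 2
      simpa using Ideal.add_mem _ (hxy i) (hx i))
    (fun k x hx y hy hxy i => by
      -- The subtraction is truncated. For `k = 0` the claim only asks for order one, which follows
      -- from membership of `x` and `y` in the closed set.
      have e : ∀ j, (X j + x j) - (X j + y j) ∈ fil (fun _ : σ => 1) (1 + (k - 1)) := by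
        intro j
        have : X j + x j - (X j + y j) = x j - y j := by ring
        rw [this]
        rcases k with _ | k
        · exact fil_mono (by norm_num) (Ideal.sub_mem _ (hx j) (hy j))
        · exact fil_mono (by omega) (hxy j)
      have := subst_sub_subst_mem_fil (hasSubst_of_mem_fil (h1 x hx))
        (hasSubst_of_mem_fil (h1 y hy)) (h1 x hx) (h1 y hy) e (ha i)
      have := neg_mem (fil_mono (show k + 1 ≤ 2 + (k - 1) by omega) this)
      convert this using 1
      ring)
  refine ⟨fun i => X i + f i, fun i => by simpa using hf i, fun i => ?_⟩
  have hs := hasSubst_of_mem_fil (h1 f hf)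
  have h2 := congrFun hfix i
  simp only [subst_sub hs, subst_X hs] at h2
  linear_combination -h2

omit [DecidableEq σ] [Fintype σ] in
-- The usual group argument: `b` has a one-sided inverse `c` of its own, and associativity of
-- substitution gives `c = a`.
theorem subst_inverse {a b : σ → MvPowerSeries σ R}
    (hb : ∀ i, b i - X i ∈ fil (fun _ => 1) 2) (hab : ∀ i, subst b (a i) = X i) (i : σ) :
    subst a (b i) = X i := by
  have h1 : ∀ f : σ → MvPowerSeries σ R, (∀ i, f i - X i ∈ fil (fun _ => 1) 2) → HasSubst f :=
    fun f hf => hasSubst_of_mem_fil fun i => by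
      simpa using Ideal.add_mem _ (fil_mono (by norm_num) (hf i)) (X_mem_fil (w := fun _ => 1) i)
  obtain ⟨c, hc, hbc⟩ := exists_right_inverse b hb
  have hca : c = a := by
    funext j
    have := subst_comp_subst_apply (h1 b hb) (h1 c hc) (a j)
    rw [hab, subst_X (h1 c hc)] at this
    simp only [hbc] at this
    rw [this, subst_self, id]
  rw [← hca]
  exact hbc i

end Subst

end FormalCR

/-! ### Weights and bidegrees of power series over a general coefficient algebra -/

namespace FormalCR

open MvPowerSeries

section Torsion

/-- The coefficient algebra may have zero divisors, but nonzero integers are units because it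
contains the inverses from ℂ. Divisions by combinatorial constants rest on this. -/
theorem natCast_mul_cancel {B : Type*} [CommRing B] [Algebra ℂ B] {k : ℕ} (hk : k ≠ 0) {x y : B}
    (h : (k : B) * x = k * y) : x = y := by
  have h1 : algebraMap ℂ B ((k : ℂ)⁻¹) * (k : B) = 1 := by
    rw [← map_natCast (algebraMap ℂ B) k, ← map_mul, inv_mul_cancel₀ (Nat.cast_ne_zero.mpr hk),
      map_one]
  linear_combination (y - x) * h1 + algebraMap ℂ B ((k : ℂ)⁻¹) * h

end Torsion

section Grading

variable {n : ℕ}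

/-- The weights `1, 1, 2` of `z`, `z̄`, `u`. -/
def wt : Coord n → ℕ
  | Sum.inl _ => 1
  | Sum.inr (Sum.inl _) => 1
  | Sum.inr (Sum.inr _) => 2

/-- The weight that counts the degree in `z`. -/
def zw : Coord n → ℕ
  | Sum.inl _ => 1
  | Sum.inr _ => 0

/-- The weight that counts the degree in `z̄`. -/
def bw : Coord n → ℕ
  | Sum.inr (Sum.inl _) => 1
  | _ => 0

/-- The weight that counts the degree in `u`. -/
def uw : Coord n → ℕ
  | Sum.inr (Sum.inr _) => 1
  | _ => 0

theorem weight_coord (w : Coord n → ℕ) (m : MIdx n) :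
    Finsupp.weight w m = ∑ j, m (Coord.z j) * w (Coord.z j) +
      (∑ j, m (Coord.zb j) * w (Coord.zb j) + m Coord.u * w Coord.u) := by
  rw [Finsupp.weight_eq_sum, Fintype.sum_sum_type, Fintype.sum_sum_type]
  simp

theorem weight_uw (m : MIdx n) : Finsupp.weight uw m = m Coord.u := by
  simp [weight_coord, uw]

theorem weight_zw (m : MIdx n) : Finsupp.weight zw m = ∑ j, m (Coord.z j) := by
  simp [weight_coord, zw]

theorem weight_bw (m : MIdx n) : Finsupp.weight bw m = ∑ j, m (Coord.zb j) := by
  simp [weight_coord, bw]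

theorem weight_wt (m : MIdx n) :
    Finsupp.weight wt m = Finsupp.weight zw m + Finsupp.weight bw m + 2 * m Coord.u := by
  rw [weight_zw, weight_bw, weight_coord]
  simp [wt]
  ring

theorem weight_bar (w : Coord n → ℕ) (m : MIdx n) :
    Finsupp.weight w (Finsupp.equivMapDomain Coord.bar m) =
      Finsupp.weight (fun i => w (Coord.bar i)) m := by
  rw [weight_coord, weight_coord]
  have h1 : ∀ j : Fin n, (Finsupp.equivMapDomain Coord.bar m) (Coord.z j) = m (Coord.zb j) :=
    fun j => rfl
  have h2 : ∀ j : Fin n, (Finsupp.equivMapDomain Coord.bar m) (Coord.zb j) = m (Coord.z j) :=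
    fun j => rfl
  have h3 : (Finsupp.equivMapDomain Coord.bar m) (Coord.u (n := n)) = m Coord.u := rfl
  have e1 : ∀ j : Fin n, Coord.bar (Coord.z j) = Coord.zb j := fun _ => rfl
  have e2 : ∀ j : Fin n, Coord.bar (Coord.zb j) = Coord.z j := fun _ => rfl
  have e3 : Coord.bar (Coord.u (n := n)) = Coord.u := rfl
  simp only [h1, h2, h3, e1, e2, e3]
  ring

theorem weight_wt_bar (m : MIdx n) :
    Finsupp.weight wt (Finsupp.equivMapDomain Coord.bar m) = Finsupp.weight wt m := by
  rw [weight_bar]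
  congr 2
  funext i
  rcases i with j | j | j <;> rfl

theorem weight_zw_bar (m : MIdx n) :
    Finsupp.weight zw (Finsupp.equivMapDomain Coord.bar m) = Finsupp.weight bw m := by
  rw [weight_bar]
  congr 2
  funext i
  rcases i with j | j | j <;> rfl

theorem weight_bw_bar (m : MIdx n) :
    Finsupp.weight bw (Finsupp.equivMapDomain Coord.bar m) = Finsupp.weight zw m := by
  rw [weight_bar]
  congr 2
  funext i
  rcases i with j | j | j <;> rfl

theorem bar_bar (m : MIdx n) :
    Finsupp.equivMapDomain Coord.bar (Finsupp.equivMapDomain Coord.bar m) = m := by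
  ext i
  rcases i with j | j | j <;> rfl

theorem bar_add (m m' : MIdx n) : Finsupp.equivMapDomain Coord.bar (m + m') =
    Finsupp.equivMapDomain Coord.bar m + Finsupp.equivMapDomain Coord.bar m' := by
  ext i
  rcases i with j | j | j <;> rfl

end Grading

section Series

variable {n : ℕ} {A : Type*} [CommRing A]

/-- Power series in `(z, z̄, u)` with coefficients in `A`. -/
abbrev PS (n : ℕ) (A : Type*) : Type _ := MvPowerSeries (Coord n) A

/-- The power series with given coefficients. -/
def mkPS (c : MIdx n → A) : PS n A := c

theorem coeff_mkPS (c : MIdx n → A) (m : MIdx n) : coeff m (mkPS c) = c m := rfl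

/-- `p` is homogeneous of degree `s` in `z` and `t` in `z̄`. -/
def IsBi (s t : ℕ) (p : PS n A) : Prop :=
  ∀ m, coeff m p ≠ 0 → Finsupp.weight zw m = s ∧ Finsupp.weight bw m = t

/-- The component of degree `a` in `z` and `b` in `z̄`. -/
noncomputable def proj (a b : ℕ) : PS n A →ₗ[A] PS n A where
  toFun p := mkPS fun m =>
    if Finsupp.weight zw m = a ∧ Finsupp.weight bw m = b then coeff m p else 0
  map_add' p q := by
    ext m
    simp only [map_add, coeff_mkPS]
    split_ifs <;> simp
  map_smul' c p := by
    ext m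
    simp only [map_smul, coeff_mkPS, RingHom.id_apply]
    split_ifs <;> simp

theorem coeff_proj (a b : ℕ) (p : PS n A) (m : MIdx n) : coeff m (proj a b p) =
    if Finsupp.weight zw m = a ∧ Finsupp.weight bw m = b then coeff m p else 0 := rfl

theorem isBi_proj (a b : ℕ) (p : PS n A) : IsBi a b (proj a b p) := by
  intro m hm
  rw [coeff_proj] at hm
  by_contra h
  exact hm (if_neg h)

theorem IsBi.proj_eq {a b : ℕ} {p : PS n A} (h : IsBi a b p) : proj a b p = p := by
  ext m
  rw [coeff_proj]
  split_ifs with h1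
  · rfl
  · by_contra h2
    exact h1 (h m (Ne.symm h2))

theorem IsBi.proj_ne {a b a' b' : ℕ} {p : PS n A} (h : IsBi a b p) (hne : ¬ (a' = a ∧ b' = b)) :
    proj a' b' p = 0 := by
  ext m
  rw [coeff_proj]
  split_ifs with h1
  · by_contra h2
    exact hne ⟨h1.1.symm.trans (h m h2).1, h1.2.symm.trans (h m h2).2⟩
  · rfl

theorem isBi_of_proj_eq {a b : ℕ} {p : PS n A} (h : proj a b p = p) : IsBi a b p :=
  h ▸ isBi_proj a b p

theorem ext_proj {p q : PS n A} (h : ∀ a b, proj a b p = proj a b q) : p = q := by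
  ext m
  have := congrArg (coeff m) (h (Finsupp.weight zw m) (Finsupp.weight bw m))
  simpa [coeff_proj] using this

theorem proj_mem_fil {w : Coord n → ℕ} {k : ℕ} {p : PS n A} (hp : p ∈ fil w k) (a b : ℕ) :
    proj a b p ∈ fil w k := by
  intro m hm
  rw [coeff_proj, hp m hm, ite_self]

theorem isBi_zero (a b : ℕ) : IsBi a b (0 : PS n A) := fun _ hm => absurd (map_zero _) hm

theorem IsBi.add {a b : ℕ} {p q : PS n A} (hp : IsBi a b p) (hq : IsBi a b q) :
    IsBi a b (p + q) := isBi_of_proj_eq (by rw [map_add, hp.proj_eq, hq.proj_eq])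

theorem IsBi.neg {a b : ℕ} {p : PS n A} (hp : IsBi a b p) :
    IsBi a b (-p) := isBi_of_proj_eq (by rw [map_neg, hp.proj_eq])

theorem IsBi.sub {a b : ℕ} {p q : PS n A} (hp : IsBi a b p) (hq : IsBi a b q) :
    IsBi a b (p - q) := isBi_of_proj_eq (by rw [map_sub, hp.proj_eq, hq.proj_eq])

theorem IsBi.sum {a b : ℕ} {ι : Type*} {s : Finset ι} {f : ι → PS n A}
    (h : ∀ i ∈ s, IsBi a b (f i)) : IsBi a b (∑ i ∈ s, f i) :=
  isBi_of_proj_eq (by rw [map_sum]; exact Finset.sum_congr rfl fun i hi => (h i hi).proj_eq)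

theorem proj_mul {s t : ℕ} {c : PS n A} (hc : IsBi s t c) (a b : ℕ) (x : PS n A) :
    proj (a + s) (b + t) (c * x) = c * proj a b x := by
  classical
  ext m
  rw [coeff_proj, coeff_mul, coeff_mul]
  split_ifs with h
  · refine Finset.sum_congr rfl fun y hy => ?_
    rw [← Finset.HasAntidiagonal.mem_antidiagonal.mp hy, map_add, map_add] at h
    by_cases h0 : coeff y.1 c = 0
    · rw [h0, zero_mul, zero_mul]
    · have := hc _ h0
      rw [coeff_proj, if_pos]
      omega
  · refine (Finset.sum_eq_zero fun y hy => ?_).symm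
    rw [← Finset.HasAntidiagonal.mem_antidiagonal.mp hy, map_add, map_add] at h
    by_cases h0 : coeff y.1 c = 0
    · rw [h0, zero_mul]
    · have := hc _ h0
      rw [coeff_proj, if_neg, mul_zero]
      omega

theorem proj_mul_of_lt {s t : ℕ} {c : PS n A} (hc : IsBi s t c) {a b : ℕ} (h : a < s ∨ b < t)
    (x : PS n A) : proj a b (c * x) = 0 := by
  classical
  ext m
  rw [coeff_proj, coeff_mul]
  split_ifs with h1
  · refine Finset.sum_eq_zero fun y hy => ?_
    rw [← Finset.HasAntidiagonal.mem_antidiagonal.mp hy, map_add, map_add] at h1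
    by_cases h0 : coeff y.1 c = 0
    · rw [h0, zero_mul]
    · have := hc _ h0
      omega
  · rfl

theorem IsBi.mul {s t a b : ℕ} {c x : PS n A} (hc : IsBi s t c) (hx : IsBi a b x) :
    IsBi (a + s) (b + t) (c * x) :=
  isBi_of_proj_eq (by rw [proj_mul hc, hx.proj_eq])

theorem isBi_X_z (j : Fin n) : IsBi 1 0 (X (Coord.z j) : PS n A) := by
  classical
  intro m hm
  rw [coeff_X] at hm
  have : m = Finsupp.single (Coord.z j) 1 := by
    by_contra h
    exact hm (if_neg h)
  rw [this, Finsupp.weight_single, Finsupp.weight_single]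
  exact ⟨rfl, rfl⟩

theorem isBi_X_zb (j : Fin n) : IsBi 0 1 (X (Coord.zb j) : PS n A) := by
  classical
  intro m hm
  rw [coeff_X] at hm
  have : m = Finsupp.single (Coord.zb j) 1 := by
    by_contra h
    exact hm (if_neg h)
  rw [this, Finsupp.weight_single, Finsupp.weight_single]
  exact ⟨rfl, rfl⟩

theorem isBi_C (a : A) : IsBi 0 0 (C a : PS n A) := by
  classical
  intro m hm
  rw [coeff_C] at hm
  have : m = 0 := by
    by_contra h
    exact hm (if_neg h)
  rw [this, map_zero, map_zero]
  exact ⟨rfl, rfl⟩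

theorem isBi_X_u : IsBi 0 0 (X Coord.u : PS n A) := by
  classical
  intro m hm
  rw [coeff_X] at hm
  have : m = Finsupp.single Coord.u 1 := by
    by_contra h
    exact hm (if_neg h)
  rw [this, Finsupp.weight_single, Finsupp.weight_single]
  exact ⟨rfl, rfl⟩

theorem proj_pderiv_u (a b : ℕ) (x : PS n A) :
    proj a b (pderiv A Coord.u x) = pderiv A Coord.u (proj a b x) := by
  ext m
  rw [coeff_proj, coeff_pderiv, coeff_pderiv, coeff_proj, map_add, map_add]
  simp only [Finsupp.weight_single, zw, bw, smul_zero, add_zero]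
  split_ifs <;> simp

theorem proj_pderiv_z (a b : ℕ) (j : Fin n) (x : PS n A) :
    proj a b (pderiv A (Coord.z j) x) = pderiv A (Coord.z j) (proj (a + 1) b x) := by
  ext m
  rw [coeff_proj, coeff_pderiv, coeff_pderiv, coeff_proj, map_add, map_add]
  simp only [Finsupp.weight_single, zw, bw, smul_zero, add_zero, one_smul, add_left_inj]
  split_ifs <;> simp

theorem proj_pderiv_zb (a b : ℕ) (j : Fin n) (x : PS n A) :
    proj a b (pderiv A (Coord.zb j) x) = pderiv A (Coord.zb j) (proj a (b + 1) x) := by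
  ext m
  rw [coeff_proj, coeff_pderiv, coeff_pderiv, coeff_proj, map_add, map_add]
  simp only [Finsupp.weight_single, zw, bw, smul_zero, add_zero, one_smul, add_left_inj]
  split_ifs <;> simp

theorem IsBi.pderiv_u {a b : ℕ} {x : PS n A} (h : IsBi a b x) : IsBi a b (pderiv A Coord.u x) :=
  isBi_of_proj_eq (by rw [proj_pderiv_u, h.proj_eq])

theorem coeff_X_mul_pderiv (i : Coord n) (m : MIdx n) (x : PS n A) :
    coeff m (X i * pderiv A i x) = m i * coeff m x := by
  classical
  by_cases h : m i = 0
  · rw [coeff_mul, h, Nat.cast_zero, zero_mul]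
    refine Finset.sum_eq_zero fun y hy => ?_
    rw [coeff_X, if_neg, zero_mul]
    intro h1
    have := Finset.HasAntidiagonal.mem_antidiagonal.mp hy
    rw [← this, h1, Finsupp.add_apply, Finsupp.single_eq_same] at h
    omega
  · obtain ⟨m', rfl⟩ : ∃ m', m = Finsupp.single i 1 + m' := by
      refine ⟨m - Finsupp.single i 1, ?_⟩
      ext k
      by_cases hk : k = i
      · subst hk
        simp
        omega
      · simp [Ne.symm hk]
    rw [show (X i : PS n A) = monomial (Finsupp.single i 1) 1 from rfl, coeff_add_monomial_mul,
      coeff_pderiv, one_mul, add_comm m', Finsupp.add_apply, Finsupp.single_eq_same]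
    push_cast
    ring

/-- The Euler field `∑ z_j ∂/∂z_j`. -/
noncomputable def eul : Derivation A (PS n A) (PS n A) :=
  ∑ j, (X (Coord.z j) : PS n A) • pderiv A (Coord.z j)

/-- The Euler field `∑ z̄_j ∂/∂z̄_j`. -/
noncomputable def eulb : Derivation A (PS n A) (PS n A) :=
  ∑ j, (X (Coord.zb j) : PS n A) • pderiv A (Coord.zb j)

theorem derivation_sum_apply {ι : Type*} (s : Finset ι)
    (f : ι → Derivation A (PS n A) (PS n A)) (x : PS n A) :
    (∑ i ∈ s, f i) x = ∑ i ∈ s, f i x := by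
  classical
  induction s using Finset.induction_on with
  | empty => simp
  | insert a s ha ih => rw [Finset.sum_insert ha, Finset.sum_insert ha, Derivation.add_apply, ih]

theorem eul_apply (x : PS n A) :
    eul x = ∑ j, X (Coord.z j) * pderiv A (Coord.z j) x := by
  rw [eul, derivation_sum_apply]; rfl

theorem eulb_apply (x : PS n A) :
    eulb x = ∑ j, X (Coord.zb j) * pderiv A (Coord.zb j) x := by
  rw [eulb, derivation_sum_apply]; rfl

theorem coeff_eul (m : MIdx n) (x : PS n A) :
    coeff m (eul x) = (Finsupp.weight zw m : ℕ) * coeff m x := by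
  rw [eul_apply, map_sum, weight_zw]
  simp only [coeff_X_mul_pderiv]
  push_cast
  rw [Finset.sum_mul]

theorem coeff_eulb (m : MIdx n) (x : PS n A) :
    coeff m (eulb x) = (Finsupp.weight bw m : ℕ) * coeff m x := by
  rw [eulb_apply, map_sum, weight_bw]
  simp only [coeff_X_mul_pderiv]
  push_cast
  rw [Finset.sum_mul]

theorem coeff_natCast_mul (k : ℕ) (m : MIdx n) (x : PS n A) :
    coeff m ((k : PS n A) * x) = k * coeff m x := by
  rw [← nsmul_eq_mul, map_nsmul, nsmul_eq_mul]

theorem proj_eul (a b : ℕ) (x : PS n A) : proj a b (eul x) = (a : PS n A) * proj a b x := by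
  ext m
  rw [coeff_proj, coeff_eul, coeff_natCast_mul, coeff_proj]
  split_ifs with h
  · rw [h.1]
  · rw [mul_zero]

theorem IsBi.eul {a b : ℕ} {x : PS n A} (h : IsBi a b x) : eul x = (a : PS n A) * x := by
  ext m
  rw [coeff_eul, coeff_natCast_mul]
  by_cases h0 : coeff m x = 0
  · rw [h0, mul_zero, mul_zero]
  · rw [(h m h0).1]

theorem IsBi.eulb {a b : ℕ} {x : PS n A} (h : IsBi a b x) : eulb x = (b : PS n A) * x := by
  ext m
  rw [coeff_eulb, coeff_natCast_mul]
  by_cases h0 : coeff m x = 0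
  · rw [h0, mul_zero, mul_zero]
  · rw [(h m h0).2]

theorem eul_mem_fil {w : Coord n → ℕ} {k : ℕ} {p : PS n A} (hp : p ∈ fil w k) :
    eul p ∈ fil w k := by
  intro m hm
  rw [coeff_eul, hp m hm, mul_zero]

theorem eul_mem_fil_zw (p : PS n A) : eul p ∈ fil zw 1 := by
  intro m hm
  rw [coeff_eul, Nat.lt_one_iff.mp hm, Nat.cast_zero, zero_mul]

end Series

/-! ### Conjugation of power series -/

section Conj

variable {n : ℕ} {A : Type*} [CommRing A] [StarRing A]

/-- The complex conjugate of a power series. -/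
noncomputable def cj : PS n A →+* PS n A where
  toFun p := mkPS fun m => star (coeff (Finsupp.equivMapDomain Coord.bar m) p)
  map_one' := by
    classical
    ext m
    change star (coeff (Finsupp.equivMapDomain Coord.bar m) 1) = _
    rw [coeff_one, coeff_one]
    by_cases h : m = 0
    · subst h
      rw [if_pos rfl, if_pos, star_one]
      ext i
      rfl
    · rw [if_neg h, if_neg, star_zero]
      intro h1
      apply h
      rw [← bar_bar m, h1]
      ext i
      rfl
  map_mul' p q := by
    classical
    ext m
    rw [coeff_mkPS, coeff_mul, coeff_mul, star_sum]
    refine Finset.sum_bij' (fun x _ => (Finsupp.equivMapDomain Coord.bar x.1,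
      Finsupp.equivMapDomain Coord.bar x.2)) (fun x _ => (Finsupp.equivMapDomain Coord.bar x.1,
      Finsupp.equivMapDomain Coord.bar x.2)) ?_ ?_ ?_ ?_ ?_
    · intro x hx
      rw [Finset.HasAntidiagonal.mem_antidiagonal] at hx ⊢
      rw [← bar_add, hx, bar_bar]
    · intro x hx
      rw [Finset.HasAntidiagonal.mem_antidiagonal] at hx ⊢
      rw [← bar_add, hx]
    · intro x _
      rw [bar_bar, bar_bar]
    · intro x _
      rw [bar_bar, bar_bar]
    · intro x _
      rw [coeff_mkPS, coeff_mkPS, bar_bar, bar_bar, star_mul']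
  map_zero' := by
    ext m
    exact star_zero _
  map_add' p q := by
    ext m
    rw [coeff_mkPS, map_add, star_add]
    rfl

theorem coeff_cj (p : PS n A) (m : MIdx n) :
    coeff m (cj p) = star (coeff (Finsupp.equivMapDomain Coord.bar m) p) := rfl

@[simp] theorem cj_cj (p : PS n A) : cj (cj p) = p := by
  ext m
  rw [coeff_cj, coeff_cj, bar_bar, star_star]

theorem bar_single (i : Coord n) (k : ℕ) :
    Finsupp.equivMapDomain Coord.bar (Finsupp.single i k) = Finsupp.single (Coord.bar i) k :=
  Finsupp.equivMapDomain_single _ _ _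

theorem cj_X (i : Coord n) : cj (X i : PS n A) = X (Coord.bar i) := by
  classical
  ext m
  rw [coeff_cj, coeff_X, coeff_X]
  have h : Finsupp.equivMapDomain Coord.bar m = Finsupp.single i 1 ↔
      m = Finsupp.single (Coord.bar i) 1 := by
    constructor
    · intro h
      rw [← bar_bar m, h, bar_single]
    · rintro rfl
      rw [bar_single]
      congr 1
      rcases i with j | j | j <;> rfl
  by_cases h1 : m = Finsupp.single (Coord.bar i) 1
  · rw [if_pos h1, if_pos (h.mpr h1), star_one]
  · rw [if_neg h1, if_neg (mt h.mp h1), star_zero]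

@[simp] theorem cj_X_z (j : Fin n) : cj (X (Coord.z j) : PS n A) = X (Coord.zb j) := cj_X _

@[simp] theorem cj_X_zb (j : Fin n) : cj (X (Coord.zb j) : PS n A) = X (Coord.z j) := cj_X _

@[simp] theorem cj_X_u : cj (X Coord.u : PS n A) = X Coord.u := cj_X _

@[simp] theorem cj_C (a : A) : cj (C a : PS n A) = C (star a) := by
  classical
  ext m
  rw [coeff_cj, coeff_C, coeff_C]
  have h : Finsupp.equivMapDomain Coord.bar m = 0 ↔ m = 0 := by
    constructor
    · intro h
      rw [← bar_bar m, h]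
      ext i
      rfl
    · rintro rfl
      ext i
      rfl
  by_cases h1 : m = 0
  · rw [if_pos h1, if_pos (h.mpr h1)]
  · rw [if_neg h1, if_neg (mt h.mp h1), star_zero]

theorem cj_pderiv (i : Coord n) (p : PS n A) :
    cj (pderiv A i p) = pderiv A (Coord.bar i) (cj p) := by
  ext m
  rw [coeff_cj, coeff_pderiv, coeff_pderiv, coeff_cj, bar_add, bar_single, star_mul']
  have h : Coord.bar (Coord.bar i) = i := by rcases i with j | j | j <;> rfl
  have h2 : (Finsupp.equivMapDomain Coord.bar m) i = m (Coord.bar i) := by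
    rcases i with j | j | j <;> rfl
  rw [h, h2, star_add, star_natCast, star_one]

theorem cj_pderiv_u (p : PS n A) : cj (pderiv A Coord.u p) = pderiv A Coord.u (cj p) :=
  cj_pderiv _ _

theorem cj_mem_fil {k : ℕ} {p : PS n A} (hp : p ∈ fil wt k) : cj p ∈ fil wt k := by
  intro m hm
  rw [coeff_cj, hp _ (by rwa [weight_wt_bar]), star_zero]

theorem cj_proj (a b : ℕ) (p : PS n A) : cj (proj a b p) = proj b a (cj p) := by
  ext m
  rw [coeff_cj, coeff_proj, coeff_proj, coeff_cj, weight_zw_bar, weight_bw_bar]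
  simp only [and_comm]
  split_ifs
  · rfl
  · rw [star_zero]

theorem IsBi.cj {a b : ℕ} {x : PS n A} (h : IsBi a b x) : IsBi b a (cj x) :=
  isBi_of_proj_eq (by rw [← cj_proj, h.proj_eq])

end Conj

/-! ### Primitives in `u` and uniqueness for equations in `u` -/

section Integration

variable {n : ℕ} {A : Type*} [CommRing A] [Algebra ℂ A]

/-- The primitive with respect to `u` that vanishes at `u = 0`. -/
noncomputable def intU : PS n A →ₗ[A] PS n A where
  toFun p := mkPS fun m => if m Coord.u = 0 then 0 else
    algebraMap ℂ A ((m Coord.u : ℂ)⁻¹) * coeff (m - Finsupp.single Coord.u 1) p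
  map_add' p q := by
    ext m
    simp only [map_add, coeff_mkPS]
    split_ifs
    · rw [add_zero]
    · rw [mul_add]
  map_smul' c p := by
    ext m
    simp only [map_smul, coeff_mkPS, RingHom.id_apply, smul_eq_mul]
    split_ifs
    · rw [mul_zero]
    · ring

theorem coeff_intU (p : PS n A) (m : MIdx n) : coeff m (intU p) = if m Coord.u = 0 then 0 else
    algebraMap ℂ A ((m Coord.u : ℂ)⁻¹) * coeff (m - Finsupp.single Coord.u 1) p := rfl

theorem weight_sub_single_u (w : Coord n → ℕ) {m : MIdx n} (h : m Coord.u ≠ 0) :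
    Finsupp.weight w (m - Finsupp.single Coord.u 1) + w Coord.u = Finsupp.weight w m :=
  Finsupp.weight_sub_single_add (w := w) h

@[simp] theorem pderiv_intU (p : PS n A) : pderiv A Coord.u (intU p) = p := by
  ext m
  rw [coeff_pderiv, coeff_intU, if_neg (by simp), add_tsub_cancel_right, Finsupp.add_apply,
    Finsupp.single_eq_same]
  have : ((m Coord.u + 1 : ℕ) : ℂ) ≠ 0 := Nat.cast_ne_zero.mpr (Nat.succ_ne_zero _)
  have h2 : (m Coord.u : A) + 1 = algebraMap ℂ A ((m Coord.u + 1 : ℕ) : ℂ) := by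
    rw [map_natCast]; push_cast; rfl
  rw [h2, mul_right_comm, ← map_mul, inv_mul_cancel₀ this, map_one, one_mul]

theorem intU_mem_fil {w : Coord n → ℕ} {k : ℕ} {p : PS n A} (hp : p ∈ fil w k) :
    intU p ∈ fil w (k + w Coord.u) := by
  intro m hm
  rw [coeff_intU]
  split_ifs with h
  · rfl
  · rw [hp, mul_zero]
    have := weight_sub_single_u w h
    omega

theorem proj_intU (a b : ℕ) (p : PS n A) : proj a b (intU p) = intU (proj a b p) := by
  ext m
  rw [coeff_proj, coeff_intU, coeff_intU, coeff_proj]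
  by_cases h : m Coord.u = 0
  · rw [if_pos h, if_pos h, ite_self]
  · rw [if_neg h, if_neg h]
    have h1 := weight_sub_single_u zw h
    have h2 := weight_sub_single_u bw h
    simp only [zw, bw, add_zero] at h1 h2
    rw [← h1, ← h2]
    split_ifs
    · rfl
    · rw [mul_zero]

theorem IsBi.intU {a b : ℕ} {x : PS n A} (h : IsBi a b x) : IsBi a b (intU x) :=
  isBi_of_proj_eq (by rw [proj_intU, h.proj_eq])

/-- Membership in `fil uw 1` is the initial condition: the series vanishes at `u = 0`. -/
theorem eq_zero_of_pderiv_u {p : PS n A} (h : pderiv A Coord.u p = 0) (h0 : p ∈ fil uw 1) :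
    p = 0 := by
  ext m
  by_cases hm : m Coord.u = 0
  · exact h0 m (by rw [weight_uw, hm]; exact Nat.zero_lt_one)
  · have h1 := congrArg (coeff (m - Finsupp.single Coord.u 1)) h
    rw [coeff_pderiv, Finsupp.sub_add_single_one_cancel hm, map_zero, Finsupp.coe_tsub,
      Pi.sub_apply, Finsupp.single_eq_same] at h1
    have h2 : ((m Coord.u - 1 : ℕ) : A) + 1 = (m Coord.u : ℕ) := by
      rw [← Nat.cast_succ, Nat.succ_eq_add_one, Nat.sub_add_cancel (Nat.one_le_iff_ne_zero.mpr hm)]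
    rw [h2] at h1
    refine natCast_mul_cancel hm ?_
    rw [mul_comm, h1, map_zero, mul_zero]

variable [StarRing A] [StarModule ℂ A]

theorem star_algebraMap_inv (k : ℕ) :
    star (algebraMap ℂ A ((k : ℂ)⁻¹)) = algebraMap ℂ A ((k : ℂ)⁻¹) := by
  rw [← algebraMap_star_comm]
  simp

theorem cj_intU (p : PS n A) : cj (intU p) = intU (cj p) := by
  ext m
  have h0 : (Finsupp.equivMapDomain Coord.bar m) (Coord.u (n := n)) = m Coord.u := rfl
  rw [coeff_cj, coeff_intU, coeff_intU, coeff_cj, h0]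
  split_ifs with h
  · rw [star_zero]
  · rw [star_mul', star_algebraMap_inv]
    have h1 : Finsupp.equivMapDomain Coord.bar (m - Finsupp.single Coord.u 1) =
        Finsupp.equivMapDomain Coord.bar m - Finsupp.single (Coord.u (n := n)) 1 := by
      rw [← Finsupp.sub_add_single_one_cancel h, bar_add, bar_single, add_tsub_cancel_right]
      exact (add_tsub_cancel_right _ _).symm
    rw [h1]

end Integration

end FormalCR

/-! ### The hyperquadric: Levi form, nonintegrability form and trace -/

namespace FormalCR

open MvPowerSeries

/-- The derivative `∂/∂u`. -/
noncomputable abbrev du {n : ℕ} {A : Type*} [CommRing A] : Derivation A (PS n A) (PS n A) :=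
  pderiv A Coord.u

/-- The imaginary unit. -/
noncomputable def im {n : ℕ} {A : Type*} [CommRing A] [Algebra ℂ A] : PS n A :=
  C (algebraMap ℂ A Complex.I)

section Scalars

variable {n : ℕ} {A : Type*} [CommRing A] [Algebra ℂ A]

theorem im_mul_im : (im : PS n A) * im = -1 := by
  rw [im, ← map_mul, ← map_mul, Complex.I_mul_I, map_neg, map_one, map_neg, map_one]

theorem isBi_im : IsBi 0 0 (im : PS n A) := isBi_C _

@[simp] theorem proj_im_mul (a b : ℕ) (x : PS n A) : proj a b (im * x) = im * proj a b x :=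
  proj_mul isBi_im a b x

@[simp] theorem pderiv_im (i : Coord n) : pderiv A i (im : PS n A) = 0 := pderiv_C

omit [Algebra ℂ A] in
theorem isBi_natCast (k : ℕ) : IsBi 0 0 (k : PS n A) := by
  rw [← map_natCast (C (σ := Coord n) (R := A)) k]
  exact isBi_C _

omit [Algebra ℂ A] in
theorem proj_natCast_mul (a b k : ℕ) (x : PS n A) : proj a b ((k : PS n A) * x) = k * proj a b x :=
  proj_mul (isBi_natCast k) a b x

omit [Algebra ℂ A] in
theorem proj_ofNat_mul (a b k : ℕ) [k.AtLeastTwo] (x : PS n A) :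
    proj a b ((ofNat(k) : PS n A) * x) = ofNat(k) * proj a b x :=
  proj_natCast_mul a b k x

variable [StarRing A] [StarModule ℂ A]

@[simp] theorem cj_im : cj (im : PS n A) = -im := by
  rw [im, cj_C, ← algebraMap_star_comm]
  simp

end Scalars

/-- The algebraic data of the Levi form and of the nonintegrability form at the origin: the
matrices `c` and `N`, together with the inverses of `c` and of the matrix of `6i𝓛 + 𝓝ʷ`. -/
structure Model (n : ℕ) (A : Type*) [CommRing A] [StarRing A] [Algebra ℂ A] where
  c : Matrix (Fin n) (Fin n) A
  d : Matrix (Fin n) (Fin n) A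
  N : Matrix (Fin n) (Fin n) A
  S : Matrix (Fin n ⊕ Fin n) (Fin n ⊕ Fin n) A
  star_c : ∀ j k, star (c j k) = c k j
  c_mul_d : c * d = 1
  N_antisymm : ∀ j k, N j k = - N k j
  mul_S : Matrix.fromBlocks N (algebraMap ℂ A (-6 * Complex.I) • c.map star)
    (algebraMap ℂ A (6 * Complex.I) • c) (N.map star) * S = 1

namespace Model

variable {n : ℕ} {A : Type*} [CommRing A] [StarRing A] [Algebra ℂ A] (μ : Model n A)

theorem d_mul_c : μ.d * μ.c = 1 := mul_eq_one_comm.mp μ.c_mul_d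

theorem c_d_apply (j k : Fin n) : ∑ l, μ.c j l * μ.d l k = if j = k then 1 else 0 := by
  rw [← Matrix.mul_apply, μ.c_mul_d, Matrix.one_apply]

theorem d_c_apply (j k : Fin n) : ∑ l, μ.d j l * μ.c l k = if j = k then 1 else 0 := by
  rw [← Matrix.mul_apply, μ.d_mul_c, Matrix.one_apply]

theorem star_d (j k : Fin n) : star (μ.d j k) = μ.d k j := by
  have h1 : μ.d.conjTranspose * μ.c = 1 := by
    have hc : μ.c.conjTranspose = μ.c := by
      ext j k
      exact μ.star_c k j
    have := congrArg Matrix.conjTranspose μ.c_mul_d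
    rwa [Matrix.conjTranspose_mul, hc, Matrix.conjTranspose_one] at this
  have h2 : μ.d.conjTranspose = μ.d := by
    calc μ.d.conjTranspose = μ.d.conjTranspose * (μ.c * μ.d) := by rw [μ.c_mul_d, mul_one]
      _ = μ.d := by rw [← mul_assoc, h1, one_mul]
  exact congrFun (congrFun h2 k) j

/-- The linear form `∑_j c_{jk} z̄_j`. -/
noncomputable def beta (k : Fin n) : PS n A := ∑ j, C (μ.c j k) * X (Coord.zb j)

/-- The linear form `∑_j N_{jk} z_j`. -/
noncomputable def nu (k : Fin n) : PS n A := ∑ j, C (μ.N j k) * X (Coord.z j)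

/-- The Levi form `∑ c_{jk} z̄_j z_k` as a power series. -/
noncomputable def quad : PS n A := ∑ k, μ.beta k * X (Coord.z k)

/-- `𝓛(z̄, F)`. -/
noncomputable def lev (F : Fin n → PS n A) : PS n A := ∑ k, μ.beta k * F k

/-- `𝓝ʷ(z, F)`. -/
noncomputable def nz (F : Fin n → PS n A) : PS n A := ∑ k, μ.nu k * F k

/-- The trace with respect to the Levi form. -/
noncomputable def tr (p : PS n A) : PS n A :=
  ∑ j, ∑ k, C (μ.d k j) * pderiv A (Coord.zb j) (pderiv A (Coord.z k) p)

/-- The tangential Euler field `∑ z_j ∂/∂z_j + i 𝓛(z̄, z) ∂/∂u` of the hyperquadric. -/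
noncomputable def eulH : Derivation A (PS n A) (PS n A) :=
  eul + (im * μ.quad) • (du : Derivation A (PS n A) (PS n A))

theorem eulH_apply (x : PS n A) : μ.eulH x = eul x + im * μ.quad * du x := rfl

theorem isBi_beta (k : Fin n) : IsBi 0 1 (μ.beta k) :=
  IsBi.sum fun j _ => (isBi_C _).mul (isBi_X_zb j)

theorem isBi_nu (k : Fin n) : IsBi 1 0 (μ.nu k) :=
  IsBi.sum fun j _ => (isBi_C _).mul (isBi_X_z j)

theorem isBi_quad : IsBi 1 1 μ.quad :=
  IsBi.sum fun k _ => (μ.isBi_beta k).mul (isBi_X_z k)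

theorem beta_mem_fil (k : Fin n) : μ.beta k ∈ fil wt 1 :=
  Ideal.sum_mem _ fun j _ => Ideal.mul_mem_left _ _ (X_mem_fil (w := wt) (Coord.zb j))

theorem nu_mem_fil (k : Fin n) : μ.nu k ∈ fil wt 1 :=
  Ideal.sum_mem _ fun j _ => Ideal.mul_mem_left _ _ (X_mem_fil (w := wt) (Coord.z j))

theorem quad_mem_fil : μ.quad ∈ fil wt 2 :=
  Ideal.sum_mem _ fun j _ => fil_mul (μ.beta_mem_fil j) (X_mem_fil (w := wt) (Coord.z j))

theorem quad_mem_fil_zw : μ.quad ∈ fil zw 1 :=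
  Ideal.sum_mem _ fun j _ => Ideal.mul_mem_left _ _ (X_mem_fil (w := zw) (Coord.z j))

theorem quad_mem_fil_bw : μ.quad ∈ fil bw 1 :=
  Ideal.sum_mem _ fun _ _ => Ideal.mul_mem_right _ _
    (Ideal.sum_mem _ fun j _ => Ideal.mul_mem_left _ _ (X_mem_fil (w := bw) (Coord.zb j)))

theorem lev_mem_fil {k : ℕ} {F : Fin n → PS n A} (h : ∀ j, F j ∈ fil wt k) :
    μ.lev F ∈ fil wt (k + 1) :=
  Ideal.sum_mem _ fun j _ => fil_mul' (μ.beta_mem_fil j) (h j) (by omega)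

theorem nz_mem_fil {k : ℕ} {F : Fin n → PS n A} (h : ∀ j, F j ∈ fil wt k) :
    μ.nz F ∈ fil wt (k + 1) :=
  Ideal.sum_mem _ fun j _ => fil_mul' (μ.nu_mem_fil j) (h j) (by omega)

theorem nz_mem_fil_zw (F : Fin n → PS n A) : μ.nz F ∈ fil zw 1 :=
  Ideal.sum_mem _ fun _ _ => Ideal.mul_mem_right _ _
    (Ideal.sum_mem _ fun j _ => Ideal.mul_mem_left _ _ (X_mem_fil (w := zw) (Coord.z j)))

theorem cj_quad : cj μ.quad = μ.quad := by
  simp only [quad, beta, map_sum, map_mul, cj_C, cj_X_z, cj_X_zb, μ.star_c, Finset.sum_mul]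
  rw [Finset.sum_comm]
  exact Finset.sum_congr rfl fun j _ => Finset.sum_congr rfl fun k _ => by ring

theorem pderiv_beta_z (k l : Fin n) : pderiv A (Coord.z l) (μ.beta k) = 0 := by
  rw [beta, map_sum]
  refine Finset.sum_eq_zero fun j _ => ?_
  rw [Derivation.leibniz, pderiv_C, pderiv_X_of_ne (by simp), smul_zero, smul_zero, add_zero]

theorem pderiv_beta_zb (k l : Fin n) : pderiv A (Coord.zb l) (μ.beta k) = C (μ.c l k) := by
  classical
  rw [beta, map_sum]
  simp only [Derivation.leibniz, pderiv_C, pderiv_X, add_zero, Pi.single_apply,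
    smul_eq_mul, mul_ite, mul_one, mul_zero]
  simp

theorem du_beta (k : Fin n) : du (μ.beta k) = 0 := by
  rw [beta, map_sum]
  refine Finset.sum_eq_zero fun j _ => ?_
  rw [Derivation.leibniz, pderiv_C, pderiv_X_of_ne (by simp), smul_zero, smul_zero, add_zero]

theorem du_nu (k : Fin n) : du (μ.nu k) = 0 := by
  rw [nu, map_sum]
  refine Finset.sum_eq_zero fun j _ => ?_
  rw [Derivation.leibniz, pderiv_C, pderiv_X_of_ne (by simp), smul_zero, smul_zero, add_zero]

theorem du_quad : du μ.quad = 0 := by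
  rw [quad, map_sum]
  refine Finset.sum_eq_zero fun j _ => ?_
  rw [Derivation.leibniz, μ.du_beta, pderiv_X_of_ne (by simp), smul_zero, smul_zero, add_zero]

theorem pderiv_quad_z (k : Fin n) : pderiv A (Coord.z k) μ.quad = μ.beta k := by
  classical
  rw [quad, map_sum]
  simp only [Derivation.leibniz, μ.pderiv_beta_z, pderiv_X, add_zero, Pi.single_apply,
    smul_eq_mul, mul_ite, mul_one, mul_zero]
  simp

theorem pderiv_quad_zb (j : Fin n) :
    pderiv A (Coord.zb j) μ.quad = ∑ k, C (μ.c j k) * X (Coord.z k) := by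
  rw [quad, map_sum]
  refine Finset.sum_congr rfl fun k _ => ?_
  rw [Derivation.leibniz, μ.pderiv_beta_zb, pderiv_X_of_ne (by simp), smul_zero, zero_add,
    smul_eq_mul, mul_comm]

@[simp] theorem du_quad_mul (x : PS n A) : du (μ.quad * x) = μ.quad * du x := by
  rw [Derivation.leibniz, μ.du_quad, smul_zero, add_zero, smul_eq_mul]

omit [StarRing A] [Algebra ℂ A] in
theorem du_natCast_mul (k : ℕ) (x : PS n A) : du ((k : PS n A) * x) = k * du x := by
  rw [Derivation.leibniz, Derivation.map_natCast, smul_zero, add_zero, smul_eq_mul]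

omit [StarRing A] [Algebra ℂ A] in
theorem du_ofNat_mul (k : ℕ) [k.AtLeastTwo] (x : PS n A) :
    du ((ofNat(k) : PS n A) * x) = ofNat(k) * du x := du_natCast_mul k x

omit [StarRing A] in
@[simp] theorem du_im_mul (x : PS n A) : du (im * x) = im * du x := by
  rw [Derivation.leibniz, pderiv_im, smul_zero, add_zero, smul_eq_mul]

@[simp] theorem du_lev (F : Fin n → PS n A) : du (μ.lev F) = μ.lev fun k => du (F k) := by
  rw [lev, map_sum, lev]
  refine Finset.sum_congr rfl fun k _ => ?_
  rw [Derivation.leibniz, μ.du_beta, smul_zero, add_zero, smul_eq_mul]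

@[simp] theorem du_nz (F : Fin n → PS n A) : du (μ.nz F) = μ.nz fun k => du (F k) := by
  rw [nz, map_sum, nz]
  refine Finset.sum_congr rfl fun k _ => ?_
  rw [Derivation.leibniz, μ.du_nu, smul_zero, add_zero, smul_eq_mul]

theorem lev_mul (y : PS n A) (F : Fin n → PS n A) : μ.lev (fun k => y * F k) = y * μ.lev F := by
  simp only [lev, Finset.mul_sum]
  exact Finset.sum_congr rfl fun k _ => by ring

theorem nz_mul (y : PS n A) (F : Fin n → PS n A) : μ.nz (fun k => y * F k) = y * μ.nz F := by
  simp only [nz, Finset.mul_sum]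
  exact Finset.sum_congr rfl fun k _ => by ring

theorem lev_add (F G : Fin n → PS n A) : μ.lev (fun k => F k + G k) = μ.lev F + μ.lev G := by
  simp only [lev, mul_add, Finset.sum_add_distrib]

theorem nz_add (F G : Fin n → PS n A) : μ.nz (fun k => F k + G k) = μ.nz F + μ.nz G := by
  simp only [nz, mul_add, Finset.sum_add_distrib]

theorem lev_neg (F : Fin n → PS n A) : μ.lev (fun k => - F k) = - μ.lev F := by
  simp only [lev, mul_neg, Finset.sum_neg_distrib]

theorem lev_zero : μ.lev (fun _ => 0) = 0 := by simp [lev]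

theorem nz_zero : μ.nz (fun _ => 0) = 0 := by simp [nz]

@[simp] theorem proj_quad_mul (a b : ℕ) (x : PS n A) :
    proj (a + 1) (b + 1) (μ.quad * x) = μ.quad * proj a b x := proj_mul μ.isBi_quad a b x

@[simp] theorem proj_quad_mul_zero_left (b : ℕ) (x : PS n A) : proj 0 b (μ.quad * x) = 0 :=
  proj_mul_of_lt μ.isBi_quad (Or.inl Nat.zero_lt_one) x

@[simp] theorem proj_quad_mul_zero_right (a : ℕ) (x : PS n A) : proj a 0 (μ.quad * x) = 0 :=
  proj_mul_of_lt μ.isBi_quad (Or.inr Nat.zero_lt_one) x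

@[simp] theorem proj_lev (a b : ℕ) (F : Fin n → PS n A) :
    proj a (b + 1) (μ.lev F) = μ.lev fun k => proj a b (F k) := by
  rw [lev, map_sum]
  exact Finset.sum_congr rfl fun k _ => proj_mul (μ.isBi_beta k) a b (F k)

@[simp] theorem proj_lev_zero (a : ℕ) (F : Fin n → PS n A) : proj a 0 (μ.lev F) = 0 := by
  rw [lev, map_sum]
  exact Finset.sum_eq_zero fun k _ =>
    proj_mul_of_lt (μ.isBi_beta k) (Or.inr Nat.zero_lt_one) (F k)

@[simp] theorem proj_nz (a b : ℕ) (F : Fin n → PS n A) :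
    proj (a + 1) b (μ.nz F) = μ.nz fun k => proj a b (F k) := by
  rw [nz, map_sum]
  exact Finset.sum_congr rfl fun k _ => proj_mul (μ.isBi_nu k) a b (F k)

@[simp] theorem proj_nz_zero (b : ℕ) (F : Fin n → PS n A) : proj 0 b (μ.nz F) = 0 := by
  rw [nz, map_sum]
  exact Finset.sum_eq_zero fun k _ =>
    proj_mul_of_lt (μ.isBi_nu k) (Or.inl Nat.zero_lt_one) (F k)

theorem isBi_lev {a b : ℕ} {F : Fin n → PS n A} (h : ∀ k, IsBi a b (F k)) :
    IsBi a (b + 1) (μ.lev F) := IsBi.sum fun k _ => (μ.isBi_beta k).mul (h k)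

theorem isBi_nz {a b : ℕ} {F : Fin n → PS n A} (h : ∀ k, IsBi a b (F k)) :
    IsBi (a + 1) b (μ.nz F) := IsBi.sum fun k _ => (μ.isBi_nu k).mul (h k)

/-! ### The trace -/

omit [StarRing A] [Algebra ℂ A] in
theorem pderiv_comm (i j : Coord n) (x : PS n A) :
    pderiv A i (pderiv A j x) = pderiv A j (pderiv A i x) := by
  classical
  ext m
  rw [coeff_pderiv, coeff_pderiv, coeff_pderiv, coeff_pderiv, add_right_comm]
  simp only [Finsupp.add_apply, Finsupp.single_apply]
  by_cases h : i = j
  · subst h; rfl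
  · rw [if_neg h, if_neg (Ne.symm h)]
    push_cast
    ring

theorem tr_add (x y : PS n A) : μ.tr (x + y) = μ.tr x + μ.tr y := by
  simp only [tr, map_add, mul_add, Finset.sum_add_distrib]

theorem tr_C_mul (a : A) (x : PS n A) : μ.tr (C a * x) = C a * μ.tr x := by
  simp only [tr, Finset.mul_sum]
  refine Finset.sum_congr rfl fun j _ => Finset.sum_congr rfl fun k _ => ?_
  rw [Derivation.leibniz, pderiv_C, smul_zero, add_zero, smul_eq_mul, Derivation.leibniz,
    pderiv_C, smul_zero, add_zero, smul_eq_mul]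
  ring

theorem tr_natCast_mul (k : ℕ) (x : PS n A) : μ.tr ((k : PS n A) * x) = k * μ.tr x := by
  rw [← map_natCast (C (σ := Coord n) (R := A)) k, tr_C_mul]

theorem tr_ofNat_mul (k : ℕ) [k.AtLeastTwo] (x : PS n A) :
    μ.tr ((ofNat(k) : PS n A) * x) = ofNat(k) * μ.tr x := μ.tr_natCast_mul k x

theorem tr_im_mul (x : PS n A) : μ.tr (im * x) = im * μ.tr x := μ.tr_C_mul _ x

theorem tr_zero : μ.tr 0 = 0 := by simp [tr]

theorem tr_neg (x : PS n A) : μ.tr (-x) = - μ.tr x := by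
  rw [eq_neg_iff_add_eq_zero, ← tr_add, neg_add_cancel, tr_zero]

theorem tr_sub (x y : PS n A) : μ.tr (x - y) = μ.tr x - μ.tr y := by
  rw [sub_eq_add_neg, tr_add, tr_neg, ← sub_eq_add_neg]

theorem proj_tr (a b : ℕ) (x : PS n A) : proj a b (μ.tr x) = μ.tr (proj (a + 1) (b + 1) x) := by
  simp only [tr, map_sum]
  refine Finset.sum_congr rfl fun j _ => Finset.sum_congr rfl fun k _ => ?_
  have := proj_mul (isBi_C (n := n) (μ.d k j)) a b
    (pderiv A (Coord.zb j) (pderiv A (Coord.z k) x))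
  rw [add_zero, add_zero] at this
  rw [this, proj_pderiv_zb, proj_pderiv_z]

theorem isBi_tr {a b : ℕ} {x : PS n A} (h : IsBi (a + 1) (b + 1) x) : IsBi a b (μ.tr x) :=
  isBi_of_proj_eq (by rw [proj_tr, h.proj_eq])

theorem tr_cj (x : PS n A) : μ.tr (cj x) = cj (μ.tr x) := by
  simp only [tr, map_sum, map_mul, cj_C, cj_pderiv, μ.star_d]
  rw [Finset.sum_comm]
  refine Finset.sum_congr rfl fun j _ => Finset.sum_congr rfl fun k _ => ?_
  rw [pderiv_comm]
  rfl

theorem tr_mem_fil {k : ℕ} {x : PS n A} (h : x ∈ fil wt (k + 2)) : μ.tr x ∈ fil wt k :=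
  Ideal.sum_mem _ fun j _ => Ideal.sum_mem _ fun l _ => Ideal.mul_mem_left _ _
    (pderiv_mem_fil (pderiv_mem_fil h (l := k + 1) (Coord.z l) (by simp [wt])) _ (by simp [wt]))

/-- The commutator of the trace with multiplication by the Levi form $Q$ is $n+e+\bar e$, as in an
$\mathfrak{sl}_2$-triple. By the product rule, the mixed second derivative of $Q$ contributes $n$
and the two cross terms contribute the Euler fields. Every inversion of a trace below comes from
this relation. -/
theorem tr_quad_mul (x : PS n A) :
    μ.tr (μ.quad * x) = μ.quad * μ.tr x + ((n : PS n A) * x + eul x + eulb x) := by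
  classical
  have h1 : ∀ j k, pderiv A (Coord.zb j) (pderiv A (Coord.z k) (μ.quad * x)) =
      μ.quad * pderiv A (Coord.zb j) (pderiv A (Coord.z k) x) + C (μ.c j k) * x +
        (∑ l, C (μ.c j l) * X (Coord.z l)) * pderiv A (Coord.z k) x +
        μ.beta k * pderiv A (Coord.zb j) x := by
    intro j k
    simp only [Derivation.leibniz, map_add, smul_eq_mul, μ.pderiv_quad_z, μ.pderiv_beta_zb,
      μ.pderiv_quad_zb]
    ring
  have e1 : ∑ j, ∑ k, C (μ.d k j) * (C (μ.c j k) * x) = (n : PS n A) * x := by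
    rw [Finset.sum_comm]
    have : ∀ k, ∑ j, C (μ.d k j) * (C (μ.c j k) * x) = x := by
      intro k
      have := congrArg (C (σ := Coord n)) (μ.d_c_apply k k)
      rw [if_pos rfl, map_sum, map_one] at this
      calc _ = (∑ j, C (μ.d k j * μ.c j k)) * x := by
            rw [Finset.sum_mul]
            exact Finset.sum_congr rfl fun j _ => by rw [map_mul]; ring
        _ = x := by rw [this, one_mul]
    rw [Finset.sum_congr rfl fun k _ => this k]
    simp
  have e2 : ∑ j, ∑ k, C (μ.d k j) * ((∑ l, C (μ.c j l) * X (Coord.z l)) *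
      pderiv A (Coord.z k) x) = eul x := by
    rw [eul_apply, Finset.sum_comm]
    refine Finset.sum_congr rfl fun k _ => ?_
    calc _ = (∑ l, C (∑ j, μ.d k j * μ.c j l) * X (Coord.z l)) * pderiv A (Coord.z k) x := by
          simp only [map_sum, map_mul, Finset.sum_mul, Finset.mul_sum]
          rw [Finset.sum_comm]
          exact Finset.sum_congr rfl fun j _ => Finset.sum_congr rfl fun l _ => by ring
      _ = _ := by simp [μ.d_c_apply]
  have e3 : ∑ j, ∑ k, C (μ.d k j) * (μ.beta k * pderiv A (Coord.zb j) x) = eulb x := by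
    rw [eulb_apply]
    refine Finset.sum_congr rfl fun j _ => ?_
    calc _ = (∑ l, C (∑ k, μ.c l k * μ.d k j) * X (Coord.zb l)) * pderiv A (Coord.zb j) x := by
          simp only [beta, map_sum, map_mul, Finset.sum_mul, Finset.mul_sum]
          rw [Finset.sum_comm]
          exact Finset.sum_congr rfl fun j _ => Finset.sum_congr rfl fun l _ => by ring
      _ = _ := by simp [μ.c_d_apply]
  have e4 : ∑ j, ∑ k, C (μ.d k j) *
      (μ.quad * pderiv A (Coord.zb j) (pderiv A (Coord.z k) x)) = μ.quad * μ.tr x := by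
    simp only [tr, Finset.mul_sum]
    exact Finset.sum_congr rfl fun j _ => Finset.sum_congr rfl fun l _ => by ring
  rw [tr]
  simp only [h1, mul_add, Finset.sum_add_distrib, e1, e2, e3, e4]
  ring

theorem tr_quad_mul_of_isBi {a b : ℕ} {x : PS n A} (h : IsBi a b x) :
    μ.tr (μ.quad * x) = μ.quad * μ.tr x + ((n + a + b : ℕ) : PS n A) * x := by
  rw [tr_quad_mul, h.eul, h.eulb]
  push_cast
  ring

theorem tr_of_isBi_zero_left {b : ℕ} {x : PS n A} (h : IsBi 0 b x) : μ.tr x = 0 := by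
  refine ext_proj fun a' b' => ?_
  rw [proj_tr, h.proj_ne (by omega), tr_zero, map_zero]

theorem tr_of_isBi_zero_right {a : ℕ} {x : PS n A} (h : IsBi a 0 x) : μ.tr x = 0 := by
  refine ext_proj fun a' b' => ?_
  rw [proj_tr, h.proj_ne (by omega), tr_zero, map_zero]

end Model

end FormalCR

/-! ### The tangential Euler operator and its homogeneous system -/

namespace FormalCR

open MvPowerSeries

section EulerInverse

variable {n : ℕ} {A : Type*} [CommRing A]

/-- The part of degree zero in `z`. -/
noncomputable def zPart (x : PS n A) : PS n A := mkPS fun m => if Finsupp.weight zw m = 0 then coeff m x else 0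

/-- The inverse of the Euler operator on the ideal generated by `z`. -/
noncomputable def eulInv [Algebra ℂ A] (x : PS n A) : PS n A :=
  mkPS fun m => algebraMap ℂ A (((Finsupp.weight zw m : ℕ) : ℂ)⁻¹) * coeff m x

theorem cj_eul [StarRing A] (x : PS n A) : cj (eul x) = eulb (cj x) := by
  ext m
  rw [coeff_cj, coeff_eul, coeff_eulb, coeff_cj, weight_zw_bar, star_mul', star_natCast]

theorem proj_eulb (a b : ℕ) (x : PS n A) : proj a b (eulb x) = (b : PS n A) * proj a b x := by
  ext m
  rw [coeff_proj, coeff_eulb, coeff_natCast_mul, coeff_proj]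
  split_ifs with h
  · rw [h.2]
  · rw [mul_zero]

end EulerInverse

namespace Model

variable {n : ℕ} {A : Type*} [CommRing A] [StarRing A] [Algebra ℂ A] (μ : Model n A)

theorem eulH_mem_fil {k : ℕ} {x : PS n A} (h : x ∈ fil wt k) : μ.eulH x ∈ fil wt k := by
  rw [eulH_apply]
  refine Ideal.add_mem _ (eul_mem_fil h) ?_
  rcases Nat.lt_or_ge k 2 with hk | hk
  · rw [mul_assoc]
    exact Ideal.mul_mem_left _ _ (fil_mono hk.le (Ideal.mul_mem_right _ _ μ.quad_mem_fil))
  · obtain ⟨l, rfl⟩ := Nat.exists_eq_add_of_le' hk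
    rw [mul_assoc]
    exact Ideal.mul_mem_left _ _ (fil_mul' μ.quad_mem_fil
      (pderiv_mem_fil (l := l) h Coord.u le_rfl) (by omega))

theorem eulH_mem_fil_zw (x : PS n A) : μ.eulH x ∈ fil zw 1 := by
  rw [eulH_apply]
  refine Ideal.add_mem _ (eul_mem_fil_zw x) (Ideal.mul_mem_right _ _ ?_)
  exact Ideal.mul_mem_left _ _ μ.quad_mem_fil_zw

theorem proj_eulH (a b : ℕ) (x : PS n A) : proj (a + 1) (b + 1) (μ.eulH x) =
    ((a + 1 : ℕ) : PS n A) * proj (a + 1) (b + 1) x + im * (μ.quad * du (proj a b x)) := by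
  rw [eulH_apply, map_add, proj_eul, mul_assoc, proj_im_mul, proj_quad_mul, proj_pderiv_u]

theorem proj_eulH_zero (a : ℕ) (x : PS n A) : proj (a + 1) 0 (μ.eulH x) =
    ((a + 1 : ℕ) : PS n A) * proj (a + 1) 0 x := by
  rw [eulH_apply, map_add, proj_eul, mul_assoc, proj_im_mul, proj_quad_mul_zero_right, mul_zero,
    add_zero]

/-- The operator is triangular: in bidegree $(a,b)$ it is multiplication by $a$ plus a term that
only involves bidegree $(a-1,b-1)$. Only the components with $a=0$ are free. -/
theorem eq_zero_of_eulH {x : PS n A} (h : μ.eulH x = 0) (h0 : ∀ b, proj 0 b x = 0) : x = 0 := by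
  refine ext_proj fun a => ?_
  induction a with
  | zero => intro b; rw [h0, map_zero]
  | succ a ih =>
    intro b
    rw [map_zero]
    refine natCast_mul_cancel (Nat.succ_ne_zero a) ?_
    rw [mul_zero]
    rcases b with _ | b
    · rw [← μ.proj_eulH_zero, h, map_zero]
    · have := μ.proj_eulH a b x
      rw [h, map_zero, ih b, map_zero, map_zero, mul_zero, mul_zero, add_zero] at this
      exact this.symm

/-- Divide by the degree in $z$: the equation becomes $x=x_0|_{z=0}+e^{-1}(p-iQx_u)$. As $Q$ is
divisible by $\bar z$, this is a contraction for the degree in $\bar z$, while the weight is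
preserved throughout. The condition on `p` at `z = 0` is necessary since both $e$ and $Q$ are
divisible by $z$. -/
theorem exists_eulH_eq {k : ℕ} {p x₀ : PS n A} (hp : p ∈ fil zw 1) (hpk : p ∈ fil wt k)
    (hx₀ : x₀ ∈ fil wt k) :
    ∃ x, μ.eulH x = p ∧ x ∈ fil wt k ∧ ∀ b, proj 0 b x = proj 0 b x₀ := by
  have hinv : ∀ {w : Coord n → ℕ} {l : ℕ} {y : PS n A}, y ∈ fil w l → eulInv y ∈ fil w l :=
    fun hy m hm => by rw [eulInv, coeff_mkPS, hy m hm, mul_zero]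
  have hD : ∀ {l : ℕ} {y : PS n A}, y ∈ fil wt l → im * (μ.quad * du y) ∈ fil wt l := by
    intro l y hy
    have := Ideal.sub_mem _ (μ.eulH_mem_fil hy) (eul_mem_fil hy)
    rwa [eulH_apply, add_sub_cancel_left, mul_assoc] at this
  have hsub : ∀ y y' : PS n A, eulInv y - eulInv y' = eulInv (y - y') := by
    intro y y'
    ext m
    rw [map_sub, eulInv, eulInv, eulInv, coeff_mkPS, coeff_mkPS, coeff_mkPS, map_sub, mul_sub]
  have hz : zPart x₀ ∈ fil wt k := fun m hm => by
    rw [zPart, coeff_mkPS, hx₀ m hm, ite_self]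
  obtain ⟨x, hx, hfix⟩ := exists_fixedPoint (ι := Unit) bw
    {x : Unit → PS n A | x () ∈ fil wt k}
    (fun x _ => zPart x₀ + eulInv (p - im * (μ.quad * du (x ()))))
    (show (0 : PS n A) ∈ fil wt k from Ideal.zero_mem _)
    (fun x hx => Ideal.add_mem _ hz (hinv (Ideal.sub_mem _ hpk (hD hx))))
    (fun y hy m hm => by
      obtain ⟨x, hx, hxy⟩ := hy (Finsupp.weight bw m + 1)
      have := hxy () m (Nat.lt_succ_self _)
      rw [map_sub, hx m hm, sub_zero] at this
      exact this)
    (fun l x _ y _ hxy _ => by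
      rw [add_sub_add_left_eq_sub, hsub]
      have : p - im * (μ.quad * du (x ())) - (p - im * (μ.quad * du (y ()))) =
          -(im * (μ.quad * du (x () - y ()))) := by
        rw [map_sub]; ring
      rw [this]
      refine hinv (neg_mem (Ideal.mul_mem_left _ _ ?_))
      exact fil_mul' μ.quad_mem_fil_bw (pderiv_mem_fil (l := l) (hxy ()) _ le_rfl) (by omega))
  have hfix' : x () = zPart x₀ + eulInv (p - im * (μ.quad * du (x ()))) :=
    (congrFun hfix ()).symm
  have hzw : p - im * (μ.quad * du (x ())) ∈ fil zw 1 := Ideal.sub_mem _ hp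
    (Ideal.mul_mem_left _ _ (Ideal.mul_mem_right _ _ μ.quad_mem_fil_zw))
  refine ⟨x (), ?_, hx, fun b => ?_⟩
  · have h1 : eul (x ()) = p - im * (μ.quad * du (x ())) := by
      generalize hq : p - im * (μ.quad * du (x ())) = q at hfix' hzw
      rw [hfix']
      ext m
      rw [coeff_eul, map_add, zPart, eulInv, coeff_mkPS, coeff_mkPS]
      by_cases h : Finsupp.weight zw m = 0
      · rw [h, Nat.cast_zero, zero_mul, hzw m (by omega)]
      · rw [if_neg h, zero_add, ← mul_assoc, ← map_natCast (algebraMap ℂ A), ← map_mul,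
          mul_inv_cancel₀ (Nat.cast_ne_zero.mpr h), map_one, one_mul]
    rw [eulH_apply, h1]
    ring
  · rw [hfix', map_add]
    have h2 : proj 0 b (eulInv (p - im * (μ.quad * du (x ())))) = 0 := by
      ext m
      rw [coeff_proj]
      split_ifs with h
      · exact hinv hzw m (by omega)
      · rfl
    rw [h2, add_zero]
    ext m
    rw [coeff_proj, coeff_proj, zPart, coeff_mkPS]
    by_cases h : Finsupp.weight zw m = 0 ∧ Finsupp.weight bw m = b
    · rw [if_pos h, if_pos h, if_pos h.1]
    · rw [if_neg h, if_neg h]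

/-- The homogeneous linear system. -/
structure Homog (F : Fin n → PS n A) (V : PS n A) : Prop where
  eulH_F : ∀ k, μ.eulH (cj (F k)) = 0
  eulH_V : μ.eulH V + μ.nz F = 0

variable {μ}

namespace Homog

variable [StarModule ℂ A] {F : Fin n → PS n A} {V : PS n A} (H : μ.Homog F V)

include H

theorem eulb_F (k : Fin n) : eulb (F k) - im * (μ.quad * du (F k)) = 0 := by
  have h := congrArg cj (H.eulH_F k)
  rw [eulH_apply, map_zero, map_add, cj_eul, cj_cj, map_mul, map_mul, cj_im, cj_quad,
    cj_pderiv_u, cj_cj] at h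
  linear_combination h

/-- The conjugate equation $(\bar e-iQ\partial_u)F=0$ is the one satisfied by $F=f(z,u+iQ)$ with $f$
holomorphic. Its components in this bidegree are a recursion that expresses $F$ through the
$F_{a,0}$ and makes $F_{a,b}$ vanish for $a<b$. -/
theorem F_succ_succ (a b : ℕ) (k : Fin n) : ((b + 1 : ℕ) : PS n A) * proj (a + 1) (b + 1) (F k) =
    im * (μ.quad * du (proj a b (F k))) := by
  have h := congrArg (proj (a + 1) (b + 1)) (H.eulb_F k)
  rw [map_sub, proj_eulb, proj_im_mul, proj_quad_mul, proj_pderiv_u, map_zero] at h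
  linear_combination h

theorem F_zero_succ (b : ℕ) (k : Fin n) : proj 0 (b + 1) (F k) = 0 := by
  have h := congrArg (proj 0 (b + 1)) (H.eulb_F k)
  rw [map_sub, proj_eulb, proj_im_mul, proj_quad_mul_zero_left, map_zero, mul_zero,
    sub_zero] at h
  exact natCast_mul_cancel (Nat.succ_ne_zero b) (by rw [h, mul_zero])

theorem F_of_lt {a b : ℕ} (h : a < b) (k : Fin n) : proj a b (F k) = 0 := by
  induction a generalizing b with
  | zero =>
    obtain ⟨c, rfl⟩ := Nat.exists_eq_succ_of_ne_zero (Nat.ne_of_gt h)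
    exact H.F_zero_succ c k
  | succ a ih =>
    obtain ⟨c, rfl⟩ := Nat.exists_eq_succ_of_ne_zero (Nat.ne_zero_of_lt h)
    refine natCast_mul_cancel (Nat.succ_ne_zero c) ?_
    have := H.F_succ_succ a c k
    rw [ih (by omega), map_zero, mul_zero, mul_zero] at this
    rw [mul_zero]
    exact this

theorem F_one (a : ℕ) (k : Fin n) : proj (a + 1) 1 (F k) =
    im * (μ.quad * du (proj a 0 (F k))) := by
  have := H.F_succ_succ a 0 k
  simpa using this

theorem F_two (a : ℕ) (k : Fin n) : 2 * proj (a + 2) 2 (F k) =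
    -(μ.quad * (μ.quad * du (du (proj a 0 (F k))))) := by
  have := H.F_succ_succ (a + 1) 1 k
  rw [H.F_one a k, du_im_mul, du_quad_mul] at this
  push_cast at this
  linear_combination this + (μ.quad * (μ.quad * du (du (proj a 0 (F k))))) * im_mul_im (n := n)
    (A := A)

omit [StarModule ℂ A] in
theorem V_succ_succ (a b : ℕ) : ((a + 1 : ℕ) : PS n A) * proj (a + 1) (b + 1) V +
    im * (μ.quad * du (proj a b V)) + μ.nz (fun k => proj a (b + 1) (F k)) = 0 := by
  have h := congrArg (proj (a + 1) (b + 1)) H.eulH_V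
  rw [map_add, proj_eulH, proj_nz, map_zero] at h
  exact h

omit [StarModule ℂ A] in
theorem V_succ_zero (a : ℕ) : ((a + 1 : ℕ) : PS n A) * proj (a + 1) 0 V +
    μ.nz (fun k => proj a 0 (F k)) = 0 := by
  have h := congrArg (proj (a + 1) 0) H.eulH_V
  rw [map_add, proj_eulH_zero, proj_nz, map_zero] at h
  exact h

theorem V_one_succ (b : ℕ) : proj 1 (b + 1) V = - (im * (μ.quad * du (proj 0 b V))) := by
  have h := H.V_succ_succ 0 b
  simp only [H.F_zero_succ, nz_zero, zero_add, Nat.cast_one, one_mul, add_zero] at h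
  linear_combination h

theorem V_two_two : 2 * proj 2 2 V = -(μ.quad * (μ.quad * du (du (proj 0 0 V)))) := by
  have h := H.V_succ_succ 1 1
  simp only [H.F_of_lt (show 1 < 1 + 1 by norm_num), nz_zero, H.V_one_succ 0, map_neg, du_im_mul,
    du_quad_mul] at h
  push_cast at h
  linear_combination h + (μ.quad * (μ.quad * du (du (proj 0 0 V)))) * im_mul_im (n := n) (A := A)

theorem V_three_three : 6 * proj 3 3 V =
    im * (μ.quad * (μ.quad * (μ.quad * du (du (du (proj 0 0 V)))))) := by
  have h := H.V_succ_succ 2 2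
  have h2 := congrArg du H.V_two_two
  simp only [H.F_of_lt (show 2 < 2 + 1 by norm_num), nz_zero] at h
  rw [show (2 : PS n A) = ((2 : ℕ) : PS n A) from rfl, Derivation.leibniz, Derivation.map_natCast,
    map_neg, du_quad_mul, du_quad_mul] at h2
  simp only [smul_eq_mul, mul_zero, add_zero] at h2
  push_cast at h h2
  linear_combination 2 * h - im * μ.quad * h2

theorem V_one_two : proj 1 2 V = - (im * (μ.quad * du (proj 0 1 V))) := H.V_one_succ 1

theorem V_two_three : 2 * proj 2 3 V = -(μ.quad * (μ.quad * du (du (proj 0 1 V)))) := by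
  have h := H.V_succ_succ 1 2
  simp only [H.F_of_lt (show 1 < 2 + 1 by norm_num), nz_zero, H.V_one_two, map_neg, du_im_mul,
    du_quad_mul] at h
  push_cast at h
  linear_combination h + (μ.quad * (μ.quad * du (du (proj 0 1 V)))) * im_mul_im (n := n) (A := A)

/-- The unknown $V_{a+1,0}$ is eliminated by differentiating its own equation in `u`. The
contributions of $F_{a,1}$ and $V_{a+1,0}$ combine to a multiple of $a$, so they cancel for $a=0$.
-/
theorem V_succ_succ_one (a : ℕ) : ((a + 2 : ℕ) : PS n A) * ((a + 1 : ℕ) : PS n A) *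
    proj (a + 2) 1 V = -(a : PS n A) * (im * (μ.quad * μ.nz fun k => du (proj a 0 (F k)))) := by
  have h := H.V_succ_succ (a + 1) 0
  have h0 := congrArg du (H.V_succ_zero a)
  simp only [H.F_one, nz_mul] at h
  rw [map_add, Derivation.leibniz, Derivation.map_natCast, smul_zero, add_zero, map_zero,
    smul_eq_mul, du_nz] at h0
  push_cast at h h0 ⊢
  linear_combination ((a : PS n A) + 1) * h - im * μ.quad * h0

theorem V_two_one : proj 2 1 V = 0 := by
  have h := H.V_succ_succ_one 0
  rw [Nat.cast_zero, neg_zero, zero_mul, mul_assoc] at h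
  refine natCast_mul_cancel (k := 0 + 2) (by norm_num)
    (natCast_mul_cancel (k := 0 + 1) (by norm_num) ?_)
  rw [mul_zero, mul_zero]
  linear_combination h

theorem V_three_two : 6 * proj 3 2 V =
    μ.quad * (μ.quad * μ.nz fun k => du (du (proj 0 0 (F k)))) := by
  have h := H.V_succ_succ 2 1
  rw [H.V_two_one, map_zero, mul_zero, mul_zero, add_zero] at h
  have h2 : (2 : PS n A) * μ.nz (fun k => proj 2 2 (F k)) =
      -(μ.quad * (μ.quad * μ.nz fun k => du (du (proj 0 0 (F k))))) := by
    rw [← nz_mul, ← nz_mul, ← nz_mul, nz, nz, ← Finset.sum_neg_distrib]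
    refine Finset.sum_congr rfl fun k _ => ?_
    rw [H.F_two 0 k, mul_neg]
  push_cast at h
  linear_combination 2 * h - h2

end Homog

end Model

end FormalCR

/-! ### Components of the defining function produced by a homogeneous solution -/

namespace FormalCR

open MvPowerSeries

namespace Model

variable {n : ℕ} {A : Type*} [CommRing A] [StarRing A] [Algebra ℂ A] {μ : Model n A}

/-- `φ` is the sum of `ψ` and of the imaginary part of the defining function obtained from the
homogeneous solution `(F, V)`. -/
def Deform (μ : Model n A) (F : Fin n → PS n A) (V ψ φ : PS n A) : Prop :=
  4 * im * φ = 4 * im * ψ + 2 * (V - cj V) + (μ.nz F - cj (μ.nz F)) +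
    4 * im * (μ.lev F + cj (μ.lev F))

namespace Deform

variable [StarModule ℂ A] {F : Fin n → PS n A} {V ψ φ : PS n A} (H : μ.Homog F V)
  (h : μ.Deform F V ψ φ)

include h

omit [StarModule ℂ A] in
-- The relation behind this is twice the difference of $V=G+i\varphi-i\mathcal L(\bar
-- z,F)-i\overline{\mathcal L(\bar z,F)}-\frac12\mathcal N^w(z,F)$ and its conjugate, for real $G$
-- and $\varphi$, with a given real $\psi$ added. Conjugation exchanges the bidegrees. The
-- identities below eliminate the components of $F$ and $V$ that are not free.
theorem proj_eq (a b : ℕ) : 4 * im * proj a b φ = 4 * im * proj a b ψ +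
    2 * (proj a b V - cj (proj b a V)) + (proj a b (μ.nz F) - cj (proj b a (μ.nz F))) +
    4 * im * (proj a b (μ.lev F) + cj (proj b a (μ.lev F))) := by
  have h1 := congrArg (proj a b) h
  simp only [mul_assoc, map_add, map_sub, proj_im_mul, proj_ofNat_mul, ← cj_proj] at h1 ⊢
  exact h1

omit [StarModule ℂ A] in
theorem zero_zero : 4 * im * proj 0 0 φ = 4 * im * proj 0 0 ψ +
    2 * (proj 0 0 V - cj (proj 0 0 V)) := by
  have h1 := h.proj_eq 0 0
  simpa using h1

include H

omit [StarModule ℂ A] in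
theorem one_zero : 4 * im * proj 1 0 φ = 4 * im * proj 1 0 ψ - (μ.nz fun k => proj 0 0 (F k)) -
    2 * cj (proj 0 1 V) + 4 * im * cj (μ.lev fun k => proj 0 0 (F k)) := by
  have h1 := h.proj_eq 1 0
  have h2 := H.V_succ_zero 0
  simp only [proj_nz, proj_lev, proj_nz_zero, proj_lev_zero, map_zero] at h1
  push_cast at h2
  linear_combination h1 + 2 * h2

theorem succ_succ_zero (a : ℕ) : ((a + 2 : ℕ) : PS n A) * (4 * im * proj (a + 2) 0 φ) =
    ((a + 2 : ℕ) : PS n A) * (4 * im * proj (a + 2) 0 ψ - 2 * cj (proj 0 (a + 2) V)) +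
      (a : PS n A) * (μ.nz fun k => proj (a + 1) 0 (F k)) := by
  have h1 := h.proj_eq (a + 2) 0
  have h2 := H.V_succ_zero (a + 1)
  simp only [proj_nz, proj_lev, proj_nz_zero, proj_lev_zero, map_zero, H.F_zero_succ,
    lev_zero] at h1
  push_cast at h2 ⊢
  linear_combination ((a : PS n A) + 2) * h1 + 2 * h2

theorem one_one : 4 * im * proj 1 1 φ = 4 * im * proj 1 1 ψ -
    2 * im * (μ.quad * du (proj 0 0 V + cj (proj 0 0 V))) +
    4 * im * ((μ.lev fun k => proj 1 0 (F k)) + cj (μ.lev fun k => proj 1 0 (F k))) := by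
  have h1 := h.proj_eq 1 1
  have h2 := H.V_one_succ 0
  have h3 := congrArg cj h2
  simp only [proj_nz, proj_lev, H.F_zero_succ, nz_zero, map_zero] at h1
  rw [map_neg, map_mul, cj_im, map_mul, cj_quad, cj_pderiv_u] at h3
  rw [map_add]
  linear_combination h1 + 2 * h2 - 2 * h3

theorem two_one : 4 * im * proj 2 1 φ = 4 * im * proj 2 1 ψ -
    2 * im * (μ.quad * du (cj (proj 0 1 V))) +
    im * (μ.quad * μ.nz fun k => du (proj 0 0 (F k))) +
    4 * im * (μ.lev fun k => proj 2 0 (F k)) +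
    4 * (μ.quad * cj (μ.lev fun k => du (proj 0 0 (F k)))) := by
  have h1 := h.proj_eq 2 1
  have h2 := H.V_two_one
  have h3 := congrArg cj H.V_one_two
  simp only [proj_nz, proj_lev, H.F_zero_succ, nz_zero, map_zero, H.F_one, nz_mul, lev_mul, h2,
    map_mul, cj_im, cj_quad] at h1
  rw [map_neg, map_mul, cj_im, map_mul, cj_quad, cj_pderiv_u] at h3
  linear_combination h1 - 2 * h3 - 4 * (μ.quad * cj (μ.lev fun k => du (proj 0 0 (F k)))) *
    im_mul_im (n := n) (A := A)

theorem succ_one (a : ℕ) : ((a + 3 : ℕ) : PS n A) * ((a + 2 : ℕ) : PS n A) *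
      (4 * im * proj (a + 3) 1 φ) =
    ((a + 3 : ℕ) : PS n A) * ((a + 2 : ℕ) : PS n A) * (4 * im * proj (a + 3) 1 ψ -
      2 * im * (μ.quad * du (cj (proj 0 (a + 2) V))) +
      im * (μ.quad * μ.nz fun k => du (proj (a + 1) 0 (F k))) +
      4 * im * (μ.lev fun k => proj (a + 3) 0 (F k))) -
    2 * ((a + 1 : ℕ) : PS n A) * (im * (μ.quad * μ.nz fun k => du (proj (a + 1) 0 (F k)))) := by
  have h1 := h.proj_eq (a + 3) 1
  have h2 := H.V_succ_succ_one (a + 1)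
  have h3 := congrArg cj (H.V_one_succ (a + 2))
  simp only [proj_nz, proj_lev, H.F_zero_succ, nz_zero, map_zero, H.F_one, nz_mul,
    H.F_of_lt (show 1 < a + 2 by omega), lev_zero] at h1
  rw [map_neg, map_mul, cj_im, map_mul, cj_quad, cj_pderiv_u] at h3
  push_cast at h2 ⊢
  linear_combination ((a : PS n A) + 3) * ((a : PS n A) + 2) * h1 + 2 * h2 -
    2 * ((a : PS n A) + 3) * ((a : PS n A) + 2) * h3

theorem two_two : 4 * im * proj 2 2 φ = 4 * im * proj 2 2 ψ -
    μ.quad * (μ.quad * du (du (proj 0 0 V - cj (proj 0 0 V)))) -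
    4 * (μ.quad * du ((μ.lev fun k => proj 1 0 (F k)) - cj (μ.lev fun k => proj 1 0 (F k)))) := by
  have h1 := h.proj_eq 2 2
  have h2 := H.V_two_two
  have h3 := congrArg cj h2
  rw [map_mul, map_ofNat] at h3
  simp only [proj_nz, proj_lev, H.F_of_lt (show 1 < 2 by norm_num), nz_zero, map_zero, H.F_one,
    lev_mul, map_mul, cj_im, cj_quad] at h1
  simp only [map_neg, map_mul, cj_quad, cj_pderiv_u] at h3
  simp only [map_sub, du_lev, ← cj_pderiv_u] at h3 ⊢
  linear_combination h1 + h2 - h3 + 4 * μ.quad * (μ.lev (fun k => du (proj 1 0 (F k))) -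
    cj (μ.lev fun k => du (proj 1 0 (F k)))) * im_mul_im (n := n) (A := A)

theorem three_two : 24 * im * proj 3 2 φ = 24 * im * proj 3 2 ψ +
    6 * (μ.quad * (μ.quad * du (du (cj (proj 0 1 V))))) -
    24 * (μ.quad * μ.lev fun k => du (proj 2 0 (F k))) -
    μ.quad * (μ.quad * μ.nz fun k => du (du (proj 0 0 (F k)))) -
    12 * im * (μ.quad * (μ.quad * cj (μ.lev fun k => du (du (proj 0 0 (F k)))))) := by
  have h1 := h.proj_eq 3 2
  have h2 := H.V_three_two
  have h3 := congrArg cj H.V_two_three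
  have h4 : 2 * μ.nz (fun k => proj 2 2 (F k)) =
      -(μ.quad * (μ.quad * μ.nz fun k => du (du (proj 0 0 (F k))))) := by
    simp only [← nz_mul, ← mul_neg_one (μ.quad * _), H.F_two 0]
    simp only [← neg_one_mul (μ.nz _), ← nz_mul]
    simp
  have h5 : 2 * μ.lev (fun k => proj 2 2 (F k)) =
      -(μ.quad * (μ.quad * μ.lev fun k => du (du (proj 0 0 (F k))))) := by
    rw [← lev_mul]
    simp only [H.F_two 0, lev_neg, lev_mul]
  have h6 := congrArg cj h5
  simp only [proj_nz, proj_lev, H.F_of_lt (show 1 < 3 by norm_num), nz_zero, map_zero, H.F_one,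
    lev_mul] at h1
  simp only [map_neg, map_mul, map_ofNat, cj_quad, cj_pderiv_u] at h3 h6
  linear_combination 6 * h1 + 2 * h2 - 6 * h3 + 3 * h4 + 12 * im * h6 + 24 * μ.quad *
    (μ.lev fun k => du (proj 2 0 (F k))) * im_mul_im (n := n) (A := A)

theorem three_three : 12 * im * proj 3 3 φ = 12 * im * proj 3 3 ψ +
    im * (μ.quad * (μ.quad * (μ.quad * du (du (du (proj 0 0 V + cj (proj 0 0 V))))))) -
    6 * im * (μ.quad * (μ.quad * du (du ((μ.lev fun k => proj 1 0 (F k)) +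
      cj (μ.lev fun k => proj 1 0 (F k)))))) := by
  have h1 := h.proj_eq 3 3
  have h2 := H.V_three_three
  have h3 := congrArg cj h2
  have h5 : 2 * μ.lev (fun k => proj 3 2 (F k)) =
      -(μ.quad * (μ.quad * μ.lev fun k => du (du (proj 1 0 (F k))))) := by
    rw [← lev_mul]
    simp only [H.F_two 1, lev_neg, lev_mul]
  have h6 := congrArg cj h5
  simp only [proj_nz, proj_lev, H.F_of_lt (show 2 < 3 by norm_num), nz_zero, map_zero] at h1
  simp only [map_neg, map_mul, map_ofNat, cj_quad, cj_pderiv_u, cj_im] at h3 h6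
  simp only [map_add, du_lev, ← cj_pderiv_u] at h3 h6 ⊢
  linear_combination 3 * h1 + h2 - h3 + 6 * im * h5 + 6 * im * h6

end Deform

end Model

end FormalCR

/-! ### Inversion of the Levi form, of the traces and of the form of strong nondegeneracy -/

namespace FormalCR

open MvPowerSeries

section Helpers

variable {n : ℕ} {A : Type*} [CommRing A]

theorem eq_single_u {m : MIdx n} (h1 : Finsupp.weight zw m = 0) (h2 : Finsupp.weight bw m = 0) :
    m = Finsupp.single Coord.u (m Coord.u) := by
  rw [weight_zw] at h1
  rw [weight_bw] at h2
  rw [Finset.sum_eq_zero_iff] at h1 h2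
  ext i
  rcases i with j | j | j
  · rw [h1 j (Finset.mem_univ _), Finsupp.single_eq_of_ne (by simp)]
  · rw [h2 j (Finset.mem_univ _), Finsupp.single_eq_of_ne (by simp)]
  · exact (Finsupp.single_eq_same).symm

/-- In bidegree $(a,b)$ the weight is $a+b$ plus twice the degree in `u`, so a bound on the weight
is a bound on the order in `u`. This supplies the zero initial values of the differential equations
in `u`. -/
theorem IsBi.mem_fil_uw {a b k l : ℕ} {x : PS n A} (hb : IsBi a b x) (h : x ∈ fil wt k)
    (hl : a + b + 2 * l < k + 2) : x ∈ fil uw l := by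
  intro m hm
  by_contra h0
  obtain ⟨h1, h2⟩ := hb m h0
  refine h0 (h m ?_)
  rw [weight_uw] at hm
  rw [weight_wt, h1, h2]
  omega

theorem IsBi.mem_fil_uw_succ {l : ℕ} {x : PS n A} (hb : IsBi 0 0 x) (h : x ∈ fil uw l)
    (hl : coeff (Finsupp.single Coord.u l) x = 0) : x ∈ fil uw (l + 1) := by
  intro m hm
  by_contra h0
  obtain ⟨h1, h2⟩ := hb m h0
  rw [weight_uw] at hm
  have h3 := eq_single_u h1 h2
  rcases Nat.lt_or_ge (m Coord.u) l with h4 | h4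
  · exact h0 (h m (by rwa [weight_uw]))
  · have : m Coord.u = l := by omega
    rw [h3, this] at h0
    exact h0 hl

theorem du_mem_fil_uw {l : ℕ} {x : PS n A} (h : x ∈ fil uw (l + 1)) : du x ∈ fil uw l :=
  pderiv_mem_fil h _ le_rfl

theorem IsBi.pderiv_zb_eq_zero {a : ℕ} {x : PS n A} (h : IsBi a 0 x) (j : Fin n) :
    pderiv A (Coord.zb j) x = 0 := by
  refine ext_proj fun a' b' => ?_
  rw [proj_pderiv_zb, h.proj_ne (by omega), map_zero, map_zero]

theorem IsBi.pderiv_z_eq_zero {b : ℕ} {x : PS n A} (h : IsBi 0 b x) (j : Fin n) :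
    pderiv A (Coord.z j) x = 0 := by
  refine ext_proj fun a' b' => ?_
  rw [proj_pderiv_z, h.proj_ne (by omega), map_zero, map_zero]

end Helpers

namespace Model

variable {n : ℕ} {A : Type*} [CommRing A] [StarRing A] [Algebra ℂ A] (μ : Model n A)

/-- The inverse of `lev` on series of degree one in `z̄`. -/
noncomputable def levInv (x : PS n A) (k : Fin n) : PS n A :=
  ∑ j, C (μ.d k j) * pderiv A (Coord.zb j) x

theorem lev_levInv {a : ℕ} {x : PS n A} (h : IsBi a 1 x) : μ.lev (μ.levInv x) = x := by
  have e : eulb x = x := by rw [h.eulb, Nat.cast_one, one_mul]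
  conv_rhs => rw [← e, eulb_apply]
  have : ∀ j, ∑ k, μ.beta k * (C (μ.d k j) * pderiv A (Coord.zb j) x) =
      X (Coord.zb j) * pderiv A (Coord.zb j) x := by
    intro j
    calc _ = (∑ l, C (∑ k, μ.c l k * μ.d k j) * X (Coord.zb l)) * pderiv A (Coord.zb j) x := by
          simp only [beta, map_sum, map_mul, Finset.sum_mul]
          rw [Finset.sum_comm]
          exact Finset.sum_congr rfl fun j _ => Finset.sum_congr rfl fun l _ => by ring
      _ = _ := by simp [μ.c_d_apply]
  simp only [lev, levInv, Finset.mul_sum]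
  rw [Finset.sum_comm]
  exact Finset.sum_congr rfl fun j _ => this j

theorem isBi_levInv {a b : ℕ} {x : PS n A} (h : IsBi a (b + 1) x) (k : Fin n) :
    IsBi a b (μ.levInv x k) := by
  refine IsBi.sum fun j _ => (isBi_C _).mul (isBi_of_proj_eq ?_)
  rw [proj_pderiv_zb, h.proj_eq]

theorem levInv_mem_fil {l : ℕ} {x : PS n A} (h : x ∈ fil wt (l + 1)) (k : Fin n) :
    μ.levInv x k ∈ fil wt l :=
  Ideal.sum_mem _ fun j _ => Ideal.mul_mem_left _ _ (pderiv_mem_fil h (Coord.zb j) le_rfl)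

theorem eq_zero_of_lev {a : ℕ} {F : Fin n → PS n A} (hF : ∀ k, IsBi a 0 (F k))
    (h : μ.lev F = 0) (k : Fin n) : F k = 0 := by
  have h1 : ∀ j, ∑ l, C (μ.c j l) * F l = 0 := by
    intro j
    have := congrArg (pderiv A (Coord.zb j)) h
    rw [lev, map_sum, map_zero] at this
    rw [← this]
    refine Finset.sum_congr rfl fun l _ => ?_
    rw [Derivation.leibniz, (hF l).pderiv_zb_eq_zero, smul_zero, zero_add, μ.pderiv_beta_zb,
      smul_eq_mul, mul_comm]
  calc F k = ∑ l, C (∑ j, μ.d k j * μ.c j l) * F l := by simp [μ.d_c_apply]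
    _ = ∑ j, C (μ.d k j) * ∑ l, C (μ.c j l) * F l := by
      simp only [map_sum, map_mul, Finset.sum_mul, Finset.mul_sum]
      rw [Finset.sum_comm]
      exact Finset.sum_congr rfl fun j _ => Finset.sum_congr rfl fun l _ => by ring
    _ = 0 := by simp [h1]

theorem tr_quad {x : PS n A} (h : IsBi 0 0 x) : μ.tr (μ.quad * x) = (n : PS n A) * x := by
  rw [μ.tr_quad_mul_of_isBi h, μ.tr_of_isBi_zero_left h]
  simp

/-- Each trace removes one factor $Q$; the successive factors are $3(n+2)$, $2(n+1)$ and $n$. -/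
theorem tr_quad_three {x : PS n A} (h : IsBi 0 0 x) :
    μ.tr (μ.tr (μ.tr (μ.quad * (μ.quad * (μ.quad * x))))) =
      ((6 * (n * (n + 1) * (n + 2)) : ℕ) : PS n A) * x := by
  have h1 : IsBi 1 1 (μ.quad * x) := μ.isBi_quad.mul h
  have h2 : IsBi 2 2 (μ.quad * (μ.quad * x)) := μ.isBi_quad.mul h1
  have e1 := μ.tr_quad h
  have e2 : μ.tr (μ.quad * (μ.quad * x)) = ((2 * (n + 1) : ℕ) : PS n A) * (μ.quad * x) := by
    rw [μ.tr_quad_mul_of_isBi h1, e1]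
    push_cast
    ring
  have e3 : μ.tr (μ.quad * (μ.quad * (μ.quad * x))) =
      ((3 * (n + 2) : ℕ) : PS n A) * (μ.quad * (μ.quad * x)) := by
    rw [μ.tr_quad_mul_of_isBi h2, e2]
    push_cast
    ring
  rw [e3, tr_natCast_mul, e2, tr_natCast_mul, tr_natCast_mul, e1]
  push_cast
  ring

theorem tr_quad_two {x : PS n A} (h : IsBi 1 0 x) :
    μ.tr (μ.tr (μ.quad * (μ.quad * x))) = ((2 * ((n + 1) * (n + 2)) : ℕ) : PS n A) * x := by
  have h1 : IsBi 2 1 (μ.quad * x) := μ.isBi_quad.mul h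
  have e1 : μ.tr (μ.quad * x) = ((n + 1 : ℕ) : PS n A) * x := by
    rw [μ.tr_quad_mul_of_isBi h, μ.tr_of_isBi_zero_right h]
    simp
  have e2 : μ.tr (μ.quad * (μ.quad * x)) = ((2 * (n + 2) : ℕ) : PS n A) * (μ.quad * x) := by
    rw [μ.tr_quad_mul_of_isBi h1, e1]
    push_cast
    ring
  rw [e2, tr_natCast_mul, e1]
  push_cast
  ring

/-- One has $\mathbf{tr}(Qx)=Q\,\mathbf{tr}\,x+(n+2)x$. A further trace gives
$(2n+2)\,\mathbf{tr}\,x=0$, after which $(n+2)x=0$ remains. -/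
theorem eq_zero_of_tr_quad_mul (hn : 0 < n) {x : PS n A} (hx : IsBi 1 1 x)
    (h : μ.tr (μ.quad * x) = 0) : x = 0 := by
  have h1 := μ.tr_quad_mul_of_isBi hx
  have h2 : μ.tr x = 0 := by
    have h3 := congrArg μ.tr h1
    rw [h, tr_zero, tr_add, tr_natCast_mul, μ.tr_quad (μ.isBi_tr hx)] at h3
    refine natCast_mul_cancel (k := n + (n + 1 + 1)) (by omega) ?_
    rw [mul_zero]
    push_cast at h3 ⊢
    linear_combination -h3
  rw [h, h2, mul_zero, zero_add] at h1
  exact natCast_mul_cancel (k := n + 1 + 1) (by omega) (by rw [← h1, mul_zero])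

/-- The components of `6i𝓛(ξ̄, ·) + 𝓝ʷ(ξ, ·)`. -/
noncomputable def strong (ξ : Fin n → PS n A) (k : Fin n) : PS n A :=
  ∑ j, (C (μ.N j k) * ξ j + 6 * im * (C (μ.c j k) * cj (ξ j)))

/-- The conjugate of $\mathcal L(\bar z,\xi)$ is $\mathcal L(\bar\xi,z)$ because the Levi form is
hermitian, and $-\mathcal N^w(z,\xi)=\mathcal N^w(\xi,z)$ by antisymmetry. So the left-hand side is
$(6i\mathcal L+\mathcal N^w)(\xi,z)$. -/
theorem strong_eq (ξ : Fin n → PS n A) :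
    6 * im * cj (μ.lev ξ) - μ.nz ξ = ∑ k, X (Coord.z k) * μ.strong ξ k := by
  have h1 : cj (μ.lev ξ) = ∑ k, X (Coord.z k) * ∑ j, C (μ.c j k) * cj (ξ j) := by
    simp only [lev, beta, map_sum, map_mul, cj_C, μ.star_c, cj_X_zb, Finset.mul_sum,
      Finset.sum_mul]
    rw [Finset.sum_comm]
    exact Finset.sum_congr rfl fun j _ => Finset.sum_congr rfl fun l _ => by ring
  have h2 : μ.nz ξ = - ∑ k, X (Coord.z k) * ∑ j, C (μ.N j k) * ξ j := by
    simp only [nz, nu, Finset.mul_sum, Finset.sum_mul, ← Finset.sum_neg_distrib]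
    rw [Finset.sum_comm]
    refine Finset.sum_congr rfl fun j _ => Finset.sum_congr rfl fun l _ => ?_
    rw [μ.N_antisymm, map_neg]
    ring
  rw [h1, h2]
  simp only [strong, Finset.mul_sum, ← Finset.sum_neg_distrib, ← Finset.sum_sub_distrib]
  exact Finset.sum_congr rfl fun j _ => Finset.sum_congr rfl fun l _ => by ring

/-- The complex `2n × 2n` matrix of `6i𝓛 + 𝓝ʷ`. -/
noncomputable def T : Matrix (Fin n ⊕ Fin n) (Fin n ⊕ Fin n) A :=
  Matrix.fromBlocks μ.N (algebraMap ℂ A (-6 * Complex.I) • μ.c.map star)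
    (algebraMap ℂ A (6 * Complex.I) • μ.c) (μ.N.map star)

omit [StarRing A] in
theorem C_six : (C (algebraMap ℂ A (6 * Complex.I)) : PS n A) = 6 * im := by
  rw [map_mul, map_mul, im, map_ofNat, map_ofNat]

omit [StarRing A] in
theorem C_I : (C (algebraMap ℂ A Complex.I) : PS n A) = im := rfl

theorem vecMul_T (a b : Fin n → PS n A) : Matrix.vecMul (Sum.elim a b) (μ.T.map C) =
    Sum.elim (fun k => ∑ j, (C (μ.N j k) * a j + 6 * im * (C (μ.c j k) * b j)))
      (fun k => ∑ j, (C (star (μ.N j k)) * b j - 6 * im * (C (star (μ.c j k)) * a j))) := by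
  funext i
  rcases i with k | k
  · simp only [Matrix.vecMul, dotProduct, Fintype.sum_sum_type, Sum.elim_inl, Sum.elim_inr,
      Matrix.map_apply, T, Matrix.fromBlocks_apply₁₁, Matrix.fromBlocks_apply₂₁, Matrix.smul_apply,
      smul_eq_mul, map_mul, map_ofNat, C_I]
    rw [← Finset.sum_add_distrib]
    exact Finset.sum_congr rfl fun j _ => by ring
  · simp only [Matrix.vecMul, dotProduct, Fintype.sum_sum_type, Sum.elim_inl, Sum.elim_inr,
      Matrix.map_apply, T, Matrix.fromBlocks_apply₁₂, Matrix.fromBlocks_apply₂₂, Matrix.smul_apply,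
      smul_eq_mul, map_mul, map_neg, map_ofNat, C_I]
    rw [← Finset.sum_add_distrib]
    exact Finset.sum_congr rfl fun j _ => by ring

theorem T_mul_S : (μ.T.map C : Matrix _ _ (PS n A)) * μ.S.map C = 1 := by
  rw [← Matrix.map_mul, show μ.T * μ.S = 1 from μ.mul_S]
  exact Matrix.map_one _ (map_zero _) (map_one _)

theorem vecMul_T_injective {v v' : Fin n ⊕ Fin n → PS n A}
    (h : Matrix.vecMul v (μ.T.map C) = Matrix.vecMul v' (μ.T.map C)) : v = v' := by
  have := congrArg (fun x => Matrix.vecMul x (μ.S.map C)) h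
  simpa only [Matrix.vecMul_vecMul, T_mul_S, Matrix.vecMul_one] using this

variable [StarModule ℂ A]

/-- The map is only real-linear in ξ. Adjoining the conjugate equations makes it linear in
$(\xi,\bar\xi)$, where the matrix inverse applies. -/
theorem vecMul_T_strong (ξ : Fin n → PS n A) :
    Matrix.vecMul (Sum.elim ξ fun k => cj (ξ k)) (μ.T.map C) =
      Sum.elim (μ.strong ξ) fun k => cj (μ.strong ξ k) := by
  rw [vecMul_T]
  congr 1
  funext k
  simp only [strong, map_sum, map_add, map_mul, cj_C, cj_cj, cj_im, map_ofNat]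
  exact Finset.sum_congr rfl fun j _ => by ring

theorem strong_injective {ξ : Fin n → PS n A} (h : ∀ k, μ.strong ξ k = 0) (k : Fin n) :
    ξ k = 0 := by
  have h1 := μ.vecMul_T_strong ξ
  have h2 : (Sum.elim (μ.strong ξ) fun k => cj (μ.strong ξ k)) =
      (0 : Fin n ⊕ Fin n → PS n A) := by
    funext i
    rcases i with k | k <;> simp [h]
  rw [h2, ← Matrix.zero_vecMul (μ.T.map C)] at h1
  exact congrFun (μ.vecMul_T_injective h1) (Sum.inl k)

/-- The complex system is solved by the matrix inverse. Since the right-hand side $(\ell,\bar\ell)$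
is invariant under conjugation with exchange of the halves, so is the unique solution, which
therefore has the form $(\xi,\bar\xi)$. -/
theorem exists_strong_eq (ℓ : Fin n → PS n A) {k : ℕ} (hbi : ∀ j, IsBi 0 0 (ℓ j))
    (hfil : ∀ j, ℓ j ∈ fil wt k) : ∃ ξ : Fin n → PS n A, (∀ j, μ.strong ξ j = ℓ j) ∧
      (∀ j, IsBi 0 0 (ξ j)) ∧ ∀ j, ξ j ∈ fil wt k := by
  set r : Fin n ⊕ Fin n → PS n A := Sum.elim ℓ fun k => cj (ℓ k) with hr
  set v : Fin n ⊕ Fin n → PS n A := Matrix.vecMul r (μ.S.map C) with hv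
  have hST : (μ.S.map C : Matrix _ _ (PS n A)) * μ.T.map C = 1 := mul_eq_one_comm.mp μ.T_mul_S
  have h1 : Matrix.vecMul v (μ.T.map C) = r := by
    rw [hv, Matrix.vecMul_vecMul, hST, Matrix.vecMul_one]
  have hv0 : v = Sum.elim (fun k => v (Sum.inl k)) (fun k => v (Sum.inr k)) := by
    funext i
    rcases i with k | k <;> rfl
  have h2 : v = Sum.elim (fun k => cj (v (Sum.inr k))) fun k => cj (v (Sum.inl k)) := by
    apply μ.vecMul_T_injective
    rw [h1, vecMul_T]
    rw [hv0, vecMul_T] at h1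
    funext i
    rcases i with k | k
    · have := congrArg cj (congrFun h1 (Sum.inr k))
      simp only [hr, Sum.elim_inr, Sum.elim_inl, cj_cj, map_sum, map_sub, map_mul, cj_C,
        star_star, cj_im, map_ofNat] at this ⊢
      rw [← this]
      exact Finset.sum_congr rfl fun j _ => by ring
    · have := congrArg cj (congrFun h1 (Sum.inl k))
      simp only [hr, Sum.elim_inr, Sum.elim_inl, map_sum, map_add, map_mul, cj_C,
        cj_im, map_ofNat] at this ⊢
      rw [← this]
      exact Finset.sum_congr rfl fun j _ => by ring
  have h3 : Sum.elim (fun k => v (Sum.inl k)) (fun k => cj (v (Sum.inl k))) = v := by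
    funext i
    rcases i with k | k
    · rfl
    · rw [Sum.elim_inr]
      exact (congrFun h2 (Sum.inr k)).symm
  refine ⟨fun k => v (Sum.inl k), fun j => ?_, fun j => ?_, fun j => ?_⟩
  · have := μ.vecMul_T_strong fun k => v (Sum.inl k)
    rw [h3, h1] at this
    exact (congrFun this (Sum.inl j)).symm
  · change IsBi 0 0 (∑ i, r i * C (μ.S i (Sum.inl j)))
    refine IsBi.sum fun i _ => ?_
    rw [mul_comm]
    refine (isBi_C (A := A) _).mul (a := 0) (b := 0) ?_
    rcases i with k | k
    · exact hbi k
    · exact (hbi k).cj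
  · change ∑ i, r i * C (μ.S i (Sum.inl j)) ∈ fil wt k
    refine Ideal.sum_mem _ fun i _ => Ideal.mul_mem_right _ _ ?_
    rcases i with k | k
    · exact hfil k
    · exact cj_mem_fil (hfil k)

/-- The Chern–Moser normalization for perturbations of the hyperquadric. -/
structure Norm (φ : PS n A) : Prop where
  pure : ∀ a, proj a 0 φ = 0
  one_one : proj 1 1 φ = 0
  deg_one : ∀ a, proj (a + 2) 1 φ = 0
  tr_two_two : μ.tr (proj 2 2 φ) = 0
  tr_three_two : μ.tr (μ.tr (proj 3 2 φ)) = 0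
  tr_three_three : μ.tr (μ.tr (μ.tr (proj 3 3 φ))) = 0

omit [StarModule ℂ A] in
theorem isBi_strong {ξ : Fin n → PS n A} (h : ∀ j, IsBi 0 0 (ξ j)) (k : Fin n) :
    IsBi 0 0 (μ.strong ξ k) := by
  refine IsBi.sum fun j _ => ((isBi_C _).mul (h j)).add ?_
  have h6 : IsBi 0 0 (6 * im : PS n A) := by
    rw [← C_six]
    exact isBi_C _
  exact h6.mul (a := 0) (b := 0) ((isBi_C _).mul (a := 0) (b := 0) (h j).cj)

omit [StarRing A] [Algebra ℂ A] [StarModule ℂ A] in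
theorem eq_of_sum_X_mul {f g : Fin n → PS n A} (hf : ∀ k, IsBi 0 0 (f k))
    (hg : ∀ k, IsBi 0 0 (g k))
    (h : ∑ k, X (Coord.z k) * f k = ∑ k, X (Coord.z k) * g k) (k : Fin n) : f k = g k := by
  classical
  have key : ∀ f : Fin n → PS n A, (∀ k, IsBi 0 0 (f k)) →
      pderiv A (Coord.z k) (∑ k, X (Coord.z k) * f k) = f k := by
    intro f hf
    rw [map_sum]
    simp only [Derivation.leibniz, (hf _).pderiv_z_eq_zero, pderiv_X, zero_add,
      Pi.single_apply, smul_eq_mul, mul_ite, mul_one, mul_zero]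
    simp
  rw [← key f hf, h, key g hg]

end Model

end FormalCR

/-! ### Uniqueness for the normalized homogeneous system -/

namespace FormalCR

open MvPowerSeries

namespace Model

variable {n : ℕ} {A : Type*} [CommRing A] [StarRing A] [Algebra ℂ A] [StarModule ℂ A]
  (μ : Model n A)

/-- The normalized homogeneous linear system has only the trivial solution. -/
theorem homog_unique (hn : 0 < n) {F : Fin n → PS n A} {V φ : PS n A} (H : μ.Homog F V)
    (h : μ.Deform F V 0 φ) (hφ : μ.Norm φ) (hF : ∀ k, F k ∈ fil wt 2) (hV : V ∈ fil wt 3)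
    (hFu : ∀ k, coeff (Finsupp.single Coord.u 1) (F k) = 0)
    (hVu : coeff (Finsupp.single Coord.u 2) V = 0) : (∀ k, F k = 0) ∧ V = 0 := by
  have hI := im_mul_im (n := n) (A := A)
  -- the real part of the component of `V` that depends on `u` only
  have h00 : cj (proj 0 0 V) = proj 0 0 V := by
    have h1 := h.zero_zero
    rw [hφ.pure, map_zero] at h1
    refine natCast_mul_cancel (k := 2) (by norm_num) ?_
    push_cast
    linear_combination h1
  -- The condition in bidegree (1,1) determines the hermitian part of $\mathcal L(\bar z,F_{1,0})$
  -- in terms of $V_{0,0}'$.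
  have hR : (μ.lev fun k => proj 1 0 (F k)) + cj (μ.lev fun k => proj 1 0 (F k)) =
      μ.quad * du (proj 0 0 V) := by
    have h1 := h.one_one H
    rw [hφ.one_one, h00, map_zero, map_add] at h1
    refine natCast_mul_cancel (k := 4) (by norm_num) ?_
    push_cast
    linear_combination im * h1 - 4 * ((μ.quad * du (proj 0 0 V)) -
      ((μ.lev fun k => proj 1 0 (F k)) + cj (μ.lev fun k => proj 1 0 (F k)))) * hI
  have hbi00 : IsBi 0 0 (proj 0 0 V) := isBi_proj 0 0 V
  -- With this value the (3,3) component becomes $(2-6)\,iQ^3V_{0,0}'''$ up to the factor 12 on the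
  -- left. The triple trace turns it into a nonzero integer multiple of $V_{0,0}'''$.
  have hV3 : du (du (du (proj 0 0 V))) = 0 := by
    have h1 := h.three_three H
    rw [hR, h00, map_zero, du_quad_mul, du_quad_mul] at h1
    have h2 : 12 * proj 3 3 φ =
        -(4 * (μ.quad * (μ.quad * (μ.quad * du (du (du (proj 0 0 V))))))) := by
      simp only [map_add] at h1
      linear_combination -im * h1 + (12 * proj 3 3 φ +
        4 * (μ.quad * (μ.quad * (μ.quad * du (du (du (proj 0 0 V))))))) * hI
    have h3 := congrArg (fun x => μ.tr (μ.tr (μ.tr x))) h2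
    simp only [tr_neg, tr_ofNat_mul, hφ.tr_three_three,
      μ.tr_quad_three hbi00.pderiv_u.pderiv_u.pderiv_u] at h3
    refine natCast_mul_cancel (k := 4 * (6 * (n * (n + 1) * (n + 2)))) (by positivity) ?_
    rw [mul_zero, Nat.cast_mul, mul_assoc]
    linear_combination h3
  -- Three initial values are needed: those of degree 0 and 1 in `u` vanish as `V` has weight at
  -- least 3, and the coefficient of $u^2$ vanishes by assumption.
  have hV00 : proj 0 0 V = 0 := by
    have e1 : proj 0 0 V ∈ fil uw (2 + 1) :=
      hbi00.mem_fil_uw_succ (hbi00.mem_fil_uw (proj_mem_fil hV 0 0) (by norm_num)) (by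
        rw [coeff_proj, hVu, ite_self])
    have e2 := du_mem_fil_uw e1
    have e3 := du_mem_fil_uw e2
    have e4 := eq_zero_of_pderiv_u hV3 e3
    have e5 := eq_zero_of_pderiv_u e4 (fil_mono (by norm_num) e2)
    exact eq_zero_of_pderiv_u e5 (fil_mono (by norm_num) e1)
  -- The hermitian part of $R=\mathcal L(\bar z,F_{1,0})$ is now zero. For the skew part, bidegree
  -- (2,2) gives $\mathbf{tr}(QR')=0$, hence $R'=0$; the initial value vanishes because $R$ has
  -- weight at least 3 and bidegree (1,1).
  have hF1 : ∀ k, proj 1 0 (F k) = 0 := by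
    refine μ.eq_zero_of_lev (a := 1) (fun k => isBi_proj 1 0 (F k)) ?_
    set R := μ.lev fun k => proj 1 0 (F k) with hRdef
    have hbiR : IsBi 1 1 R := μ.isBi_lev fun k => isBi_proj 1 0 (F k)
    have hR' : cj R = -R := by
      rw [hV00, map_zero, mul_zero] at hR
      linear_combination hR
    have h1 := h.two_two H
    rw [h00, sub_self, map_zero, map_zero, map_zero, mul_zero, mul_zero, mul_zero, ← hRdef,
      hR'] at h1
    have h2 : 4 * im * proj 2 2 φ = -(8 * (μ.quad * du R)) := by
      simp only [map_sub, map_neg] at h1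
      linear_combination h1
    have h3 := congrArg μ.tr h2
    rw [mul_assoc, tr_neg, tr_ofNat_mul, tr_im_mul, hφ.tr_two_two, tr_ofNat_mul] at h3
    have h4 : du R = 0 := by
      refine μ.eq_zero_of_tr_quad_mul hn hbiR.pderiv_u ?_
      refine natCast_mul_cancel (k := 8) (by norm_num) ?_
      push_cast
      linear_combination h3
    refine eq_zero_of_pderiv_u h4 (hbiR.mem_fil_uw (k := 3) ?_ (by norm_num))
    exact μ.lev_mem_fil fun k => proj_mem_fil (hF k) 1 0
  have hV01 : 2 * cj (proj 0 1 V) = -(μ.nz fun k => proj 0 0 (F k)) +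
      4 * (im * cj (μ.lev fun k => proj 0 0 (F k))) := by
    have := h.one_zero H
    rw [hφ.pure, map_zero] at this
    linear_combination this
  have hF20 : 4 * (μ.lev fun k => proj 2 0 (F k)) =
      -(2 * (μ.quad * μ.nz fun k => du (proj 0 0 (F k)))) +
      8 * (im * (μ.quad * cj (μ.lev fun k => du (proj 0 0 (F k))))) := by
    have h1 := h.two_one H
    have h2 := congrArg du hV01
    simp only [map_add, map_neg, du_ofNat_mul, du_im_mul, du_nz, du_lev, ← cj_pderiv_u] at h1 h2
    rw [hφ.deg_one 0, map_zero] at h1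
    linear_combination im * h1 + μ.quad * h2 + (-2 * (μ.quad * cj (du (proj 0 1 V))) +
      (μ.quad * μ.nz fun k => du (proj 0 0 (F k))) + 4 * μ.lev fun k => proj 2 0 (F k)) * hI
  have hF0 : ∀ k, proj 0 0 (F k) = 0 := by
    set ξ : Fin n → PS n A := fun k => du (du (proj 0 0 (F k))) with hξ
    have hbiξ : ∀ k, IsBi 0 0 (ξ k) := fun k => (isBi_proj 0 0 (F k)).pderiv_u.pderiv_u
    have hd1 : 2 * cj (du (du (proj 0 1 V))) = -μ.nz ξ + 4 * (im * cj (μ.lev ξ)) := by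
      have h2 := congrArg (fun x => du (du x)) hV01
      simpa only [map_add, map_neg, du_ofNat_mul, du_im_mul, du_nz, du_lev, ← cj_pderiv_u]
        using h2
    have hd2 : 4 * (μ.lev fun k => du (proj 2 0 (F k))) = -(2 * (μ.quad * μ.nz ξ)) +
        8 * (im * (μ.quad * cj (μ.lev ξ))) := by
      have h2 := congrArg du hF20
      simpa only [map_add, map_neg, du_ofNat_mul, du_im_mul, du_nz, du_lev, ← cj_pderiv_u,
        du_quad_mul] using h2
    have h32 := h.three_two H
    simp only [← cj_pderiv_u, map_zero, mul_zero, zero_add] at h32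
    -- Here the form of strong nondegeneracy appears. The contributions of $V_{0,1}$, of $F_{2,0}$
    -- and of the remaining terms of bidegree (3,2) add up to $-3+12-1=8$ times $Q^2\mathcal
    -- N^w(z,\xi)$ and $12-48-12=-48$ times $iQ^2\mathcal L(\bar\xi,z)$.
    have h1 : 24 * (im * proj 3 2 φ) =
        -(8 * (μ.quad * (μ.quad * (6 * im * cj (μ.lev ξ) - μ.nz ξ)))) := by
      linear_combination h32 + 3 * μ.quad * μ.quad * hd1 - 6 * μ.quad * hd2
    have h2 := congrArg (fun x => μ.tr (μ.tr x)) h1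
    have hbi : IsBi 1 0 (6 * im * cj (μ.lev ξ) - μ.nz ξ) := by
      rw [strong_eq]
      exact IsBi.sum fun k _ => mul_comm (X (Coord.z k)) (μ.strong ξ k) ▸
        (μ.isBi_strong hbiξ k).mul (isBi_X_z k)
    simp only [tr_neg, tr_ofNat_mul, tr_im_mul, hφ.tr_three_two, mul_zero, μ.tr_quad_two hbi] at h2
    have h3 : 6 * im * cj (μ.lev ξ) - μ.nz ξ = 0 := by
      refine natCast_mul_cancel (k := 8 * (2 * ((n + 1) * (n + 2)))) (by positivity) ?_
      rw [mul_zero, Nat.cast_mul, mul_assoc]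
      push_cast at h2 ⊢
      linear_combination h2
    have h4 : ∀ k, μ.strong ξ k = 0 := by
      refine eq_of_sum_X_mul (μ.isBi_strong hbiξ) (fun _ => isBi_zero 0 0) ?_
      rw [← strong_eq, h3]
      simp
    intro k
    -- The two initial values: no constant term since `F` has weight at least 2, and no linear term
    -- in `u` by assumption.
    have e1 : proj 0 0 (F k) ∈ fil uw (1 + 1) :=
      (isBi_proj 0 0 (F k)).mem_fil_uw_succ
        ((isBi_proj 0 0 (F k)).mem_fil_uw (proj_mem_fil (hF k) 0 0) (by norm_num)) (by
          rw [coeff_proj, hFu, ite_self])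
    have e4 := eq_zero_of_pderiv_u (μ.strong_injective h4 k) (du_mem_fil_uw e1)
    exact eq_zero_of_pderiv_u e4 (fil_mono (by norm_num) e1)
  have hF2 : ∀ k, proj 2 0 (F k) = 0 := by
    refine μ.eq_zero_of_lev (a := 2) (fun k => isBi_proj 2 0 (F k)) ?_
    refine natCast_mul_cancel (k := 4) (by norm_num) ?_
    simp only [hF0, map_zero, lev_zero, nz_zero] at hF20
    push_cast
    linear_combination hF20
  have hVs : ∀ a, (∀ k, proj (a + 1) 0 (F k) = 0) → proj 0 (a + 2) V = 0 := by
    intro a ha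
    have h1 := h.succ_succ_zero H a
    simp only [ha, nz_zero, hφ.pure, map_zero, mul_zero, zero_sub, add_zero] at h1
    have h2 : cj (proj 0 (a + 2) V) = 0 := by
      refine natCast_mul_cancel (k := (a + 2) * 2) (by positivity) ?_
      rw [Nat.cast_mul]
      push_cast at h1 ⊢
      linear_combination h1
    rw [← cj_cj (proj 0 (a + 2) V), h2, map_zero]
  -- The condition in bidegree $(a+3,1)$ expresses $F_{a+3,0}$ through $F_{a+1,0}$ and $V_{0,a+2}$,
  -- and the latter depends on $F_{a+1,0}$ only. The induction therefore goes in steps of two.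
  have hFa : ∀ a k, proj a 0 (F k) = 0 := by
    intro a
    induction a using Nat.strong_induction_on with
    | _ a ih =>
      match a, ih with
      | 0, _ => exact hF0
      | 1, _ => exact hF1
      | 2, _ => exact hF2
      | a + 3, ih =>
        have h1 := ih (a + 1) (by omega)
        have h2 := h.succ_one H a
        rw [hVs a h1, show a + 3 = a + 1 + 2 from rfl, hφ.deg_one] at h2
        simp only [h1, nz_zero, map_zero, mul_zero, add_zero, zero_add,
          sub_zero] at h2
        refine μ.eq_zero_of_lev (a := a + 3) (fun k => isBi_proj (a + 3) 0 (F k)) ?_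
        refine natCast_mul_cancel (k := (a + 3) * (a + 2) * 4) (by positivity) ?_
        push_cast at h2 ⊢
        linear_combination im * h2 + (((a : PS n A) + 3) * ((a : PS n A) + 2) * 4 *
          μ.lev fun k => proj (a + 3) 0 (F k)) * hI
  have hF' : ∀ k, F k = 0 := by
    intro k
    have h1 : cj (F k) = 0 := by
      refine μ.eq_zero_of_eulH (H.eulH_F k) fun b => ?_
      rw [← cj_proj, hFa, map_zero]
    rw [← cj_cj (F k), h1, map_zero]
  refine ⟨hF', μ.eq_zero_of_eulH ?_ fun b => ?_⟩
  · have h1 := H.eulH_V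
    rwa [show F = fun _ => 0 from funext hF', nz_zero, add_zero] at h1
  · match b with
    | 0 => exact hV00
    | 1 =>
      simp only [hF0, nz_zero, lev_zero, map_zero, mul_zero, neg_zero, add_zero] at hV01
      have h2 : cj (proj 0 1 V) = 0 :=
        natCast_mul_cancel (k := 2) (by norm_num) (by push_cast; linear_combination hV01)
      rw [← cj_cj (proj 0 1 V), h2, map_zero]
    | b + 2 => exact hVs b (hFa (b + 1))

end Model

end FormalCR

/-! ### Homogeneous solutions with prescribed free components -/

namespace FormalCR

open MvPowerSeries

section InverseOfNat

variable {n : ℕ} {A : Type*} [CommRing A] [Algebra ℂ A]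

/-- The constant series `1 / k`. -/
noncomputable def invN (k : ℕ) : PS n A := C (algebraMap ℂ A ((k : ℂ)⁻¹))

theorem natCast_mul_invN {k : ℕ} (hk : k ≠ 0) : (k : PS n A) * invN k = 1 := by
  rw [invN, ← map_natCast (C (σ := Coord n) (R := A)) k, ← map_natCast (algebraMap ℂ A) k,
    ← map_mul, ← map_mul, mul_inv_cancel₀ (Nat.cast_ne_zero.mpr hk), map_one, map_one]

theorem isBi_invN (k : ℕ) : IsBi 0 0 (invN k : PS n A) := isBi_C _

theorem proj_invN_mul (a b k : ℕ) (x : PS n A) : proj a b (invN k * x) = invN k * proj a b x :=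
  proj_mul (isBi_invN k) a b x

omit [Algebra ℂ A] in
theorem IsBi.scalar_mul {a b : ℕ} {c x : PS n A} (hc : IsBi 0 0 c) (hx : IsBi a b x) :
    IsBi a b (c * x) := hc.mul hx

theorem du_invN_mul (k : ℕ) (x : PS n A) : du (invN k * x) = invN k * du x := by
  rw [Derivation.leibniz, invN, pderiv_C, smul_zero, add_zero, smul_eq_mul]

theorem cj_invN [StarRing A] [StarModule ℂ A] (k : ℕ) : cj (invN k : PS n A) = invN k := by
  rw [invN, cj_C, star_algebraMap_inv]

/-- The series in `(z, u)` with prescribed components. -/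
noncomputable def glueZ (s : ℕ → PS n A) : PS n A :=
  mkPS fun m => coeff m (proj (Finsupp.weight zw m) 0 (s (Finsupp.weight zw m)))

omit [Algebra ℂ A] in
theorem proj_glueZ {s : ℕ → PS n A} (hs : ∀ a, IsBi a 0 (s a)) (a : ℕ) :
    proj a 0 (glueZ s) = s a := by
  ext m
  rw [coeff_proj, glueZ, coeff_mkPS]
  by_cases h : Finsupp.weight zw m = a ∧ Finsupp.weight bw m = 0
  · rw [if_pos h, h.1, (hs a).proj_eq]
  · rw [if_neg h]
    by_contra h1
    exact h (hs a m (Ne.symm h1))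

omit [Algebra ℂ A] in
theorem glueZ_mem_fil {s : ℕ → PS n A} {k : ℕ} {w : Coord n → ℕ} (hs : ∀ a, s a ∈ fil w k) :
    glueZ s ∈ fil w k := fun m hm => by
  rw [glueZ, coeff_mkPS, proj_mem_fil (hs _) _ _ m hm]

end InverseOfNat

namespace Model

variable {n : ℕ} {A : Type*} [CommRing A] [StarRing A] [Algebra ℂ A] [StarModule ℂ A]
  (μ : Model n A)

omit [StarModule ℂ A] in
theorem tr_invN_mul (k : ℕ) (x : PS n A) : μ.tr (invN k * x) = invN k * μ.tr x :=
  μ.tr_C_mul _ x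

/-- The components of degree zero in `z̄` of the first part of the solution. -/
noncomputable def solF (μ : Model n A) (y F1 : Fin n → PS n A) (ψ : PS n A) :
    ℕ → Fin n → PS n A
  | 0 => y
  | 1 => F1
  | 2 => μ.levInv (-proj 2 1 ψ + im * (μ.quad * du (proj 1 0 ψ)) -
      invN 2 * (μ.quad * μ.nz fun k => du (y k)) +
      2 * (im * (μ.quad * cj (μ.lev fun k => du (y k)))))
  | a + 3 => μ.levInv (-proj (a + 3) 1 ψ + im * (μ.quad * du (proj (a + 2) 0 ψ)) -
      invN ((a + 3) * (a + 2)) * (μ.quad * μ.nz fun k => du (solF μ y F1 ψ (a + 1) k)))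

/-- The conjugates of the components of degree zero in `z` of the second part of the solution. -/
noncomputable def solV (μ : Model n A) (Fs : ℕ → Fin n → PS n A) (V0 ψ : PS n A) : ℕ → PS n A
  | 0 => cj V0
  | 1 => 2 * (im * proj 1 0 ψ) - invN 2 * μ.nz (Fs 0) + 2 * (im * cj (μ.lev (Fs 0)))
  | b + 2 => 2 * (im * proj (b + 2) 0 ψ) +
      invN (2 * (b + 2)) * ((b : PS n A) * μ.nz (Fs (b + 1)))

omit [StarModule ℂ A] in
theorem isBi_solF {y F1 : Fin n → PS n A} {ψ : PS n A} (hy : ∀ k, IsBi 0 0 (y k))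
    (hF1 : ∀ k, IsBi 1 0 (F1 k)) (a : ℕ) (k : Fin n) : IsBi a 0 (μ.solF y F1 ψ a k) := by
  induction a using Nat.strong_induction_on generalizing k with
  | _ a ih =>
    match a, ih with
    | 0, _ => exact hy k
    | 1, _ => exact hF1 k
    | 2, _ =>
      rw [solF]
      have h2 : IsBi 0 0 (2 : PS n A) := isBi_natCast 2
      refine μ.isBi_levInv ((((isBi_proj 2 1 ψ).neg.add ?_).sub ?_).add ?_) k
      · exact isBi_im.scalar_mul (μ.isBi_quad.mul (isBi_proj 1 0 ψ).pderiv_u)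
      · exact (isBi_invN 2).scalar_mul (μ.isBi_quad.mul (μ.isBi_nz fun k => (hy k).pderiv_u))
      · exact h2.scalar_mul (isBi_im.scalar_mul (μ.isBi_quad.mul
          (μ.isBi_lev fun k => (hy k).pderiv_u).cj))
    | a + 3, ih =>
      rw [solF]
      refine μ.isBi_levInv (((isBi_proj (a + 3) 1 ψ).neg.add ?_).sub ?_) k
      · exact isBi_im.scalar_mul (μ.isBi_quad.mul (isBi_proj (a + 2) 0 ψ).pderiv_u)
      · exact (isBi_invN _).scalar_mul (μ.isBi_quad.mul
          (μ.isBi_nz fun k => (ih (a + 1) (by omega) k).pderiv_u))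

omit [StarModule ℂ A] in
theorem isBi_solV {Fs : ℕ → Fin n → PS n A} {V0 ψ : PS n A} (hF : ∀ a k, IsBi a 0 (Fs a k))
    (hV : IsBi 0 0 V0) (b : ℕ) : IsBi b 0 (μ.solV Fs V0 ψ b) := by
  have h2 : IsBi 0 0 (2 : PS n A) := isBi_natCast 2
  match b with
  | 0 => exact hV.cj
  | 1 =>
    exact ((h2.scalar_mul (isBi_im.scalar_mul (isBi_proj 1 0 ψ))).sub
      ((isBi_invN 2).scalar_mul (μ.isBi_nz (hF 0)))).add
      (h2.scalar_mul (isBi_im.scalar_mul (μ.isBi_lev (hF 0)).cj))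
  | b + 2 =>
    exact (h2.scalar_mul (isBi_im.scalar_mul (isBi_proj _ 0 ψ))).add
      ((isBi_invN _).scalar_mul ((isBi_natCast b).scalar_mul (μ.isBi_nz (hF (b + 1)))))

omit [StarModule ℂ A] in
theorem quad_du_mem_fil {k : ℕ} {x : PS n A} (h : x ∈ fil wt k) : μ.quad * du x ∈ fil wt k := by
  rcases Nat.lt_or_ge k 2 with hk | hk
  · exact fil_mono hk.le (Ideal.mul_mem_right _ _ μ.quad_mem_fil)
  · obtain ⟨l, rfl⟩ := Nat.exists_eq_add_of_le' hk
    exact fil_mul' μ.quad_mem_fil (pderiv_mem_fil (l := l) h Coord.u le_rfl) (by omega)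

omit [StarModule ℂ A] in
theorem solF_mem_fil {N : ℕ} {y F1 : Fin n → PS n A} {ψ : PS n A} (hy : ∀ k, y k ∈ fil wt N)
    (hF1 : ∀ k, F1 k ∈ fil wt N) (hψ : ψ ∈ fil wt (N + 1)) (a : ℕ) (k : Fin n) :
    μ.solF y F1 ψ a k ∈ fil wt N := by
  have hnz : ∀ {F : Fin n → PS n A}, (∀ k, F k ∈ fil wt N) →
      (μ.quad * μ.nz fun k => du (F k)) ∈ fil wt (N + 1) := fun hF => by
    rw [← du_nz]
    exact μ.quad_du_mem_fil (μ.nz_mem_fil hF)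
  have hlev : ∀ {F : Fin n → PS n A}, (∀ k, F k ∈ fil wt N) →
      (μ.quad * cj (μ.lev fun k => du (F k))) ∈ fil wt (N + 1) := fun hF => by
    rw [← du_lev, cj_pderiv_u]
    exact μ.quad_du_mem_fil (cj_mem_fil (μ.lev_mem_fil hF))
  induction a using Nat.strong_induction_on generalizing k with
  | _ a ih =>
    match a, ih with
    | 0, _ => exact hy k
    | 1, _ => exact hF1 k
    | 2, _ =>
      rw [solF]
      refine μ.levInv_mem_fil (add_mem (sub_mem (add_mem (neg_mem (proj_mem_fil hψ 2 1)) ?_) ?_)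
        ?_) k
      · exact Ideal.mul_mem_left _ _ (μ.quad_du_mem_fil (proj_mem_fil hψ 1 0))
      · exact Ideal.mul_mem_left _ _ (hnz hy)
      · exact Ideal.mul_mem_left _ _ (Ideal.mul_mem_left _ _ (hlev hy))
    | a + 3, ih =>
      rw [solF]
      refine μ.levInv_mem_fil (sub_mem (add_mem (neg_mem (proj_mem_fil hψ (a + 3) 1)) ?_) ?_) k
      · exact Ideal.mul_mem_left _ _ (μ.quad_du_mem_fil (proj_mem_fil hψ (a + 2) 0))
      · exact Ideal.mul_mem_left _ _ (hnz (ih (a + 1) (by omega)))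

omit [StarModule ℂ A] in
theorem solV_mem_fil {N : ℕ} {Fs : ℕ → Fin n → PS n A} {V0 ψ : PS n A}
    (hF : ∀ a k, Fs a k ∈ fil wt N) (hV : V0 ∈ fil wt (N + 1)) (hψ : ψ ∈ fil wt (N + 1)) (b : ℕ) :
    μ.solV Fs V0 ψ b ∈ fil wt (N + 1) := by
  match b with
  | 0 => exact cj_mem_fil hV
  | 1 =>
    exact add_mem (sub_mem (Ideal.mul_mem_left _ _ (Ideal.mul_mem_left _ _ (proj_mem_fil hψ 1 0)))
      (Ideal.mul_mem_left _ _ (μ.nz_mem_fil (hF 0))))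
      (Ideal.mul_mem_left _ _ (Ideal.mul_mem_left _ _ (cj_mem_fil (μ.lev_mem_fil (hF 0)))))
  | b + 2 =>
    exact add_mem (Ideal.mul_mem_left _ _ (Ideal.mul_mem_left _ _ (proj_mem_fil hψ _ 0)))
      (Ideal.mul_mem_left _ _ (Ideal.mul_mem_left _ _ (μ.nz_mem_fil (hF (b + 1)))))

omit [StarModule ℂ A] in
/-- A homogeneous solution with given components of degree zero in `z̄`, respectively `z`. -/
theorem exists_homog {N : ℕ} {Fs : ℕ → Fin n → PS n A} {Vs : ℕ → PS n A}
    (hF : ∀ a k, IsBi a 0 (Fs a k)) (hV : ∀ b, IsBi b 0 (Vs b))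
    (hFf : ∀ a k, Fs a k ∈ fil wt N) (hVf : ∀ b, Vs b ∈ fil wt (N + 1)) :
    ∃ F V, μ.Homog F V ∧ (∀ k, F k ∈ fil wt N) ∧ V ∈ fil wt (N + 1) ∧
      (∀ a k, proj a 0 (F k) = Fs a k) ∧ ∀ b, cj (proj 0 b V) = Vs b := by
  have h1 : ∀ k, ∃ x, μ.eulH x = 0 ∧ x ∈ fil wt N ∧
      ∀ b, proj 0 b x = proj 0 b (cj (glueZ fun a => Fs a k)) := fun k =>
    μ.exists_eulH_eq (Ideal.zero_mem _) (Ideal.zero_mem _)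
      (cj_mem_fil (glueZ_mem_fil fun a => hFf a k))
  choose x hx1 hx2 hx3 using h1
  set F : Fin n → PS n A := fun k => cj (x k) with hFdef
  have hFN : ∀ k, F k ∈ fil wt N := fun k => cj_mem_fil (hx2 k)
  obtain ⟨V, hV1, hV2, hV3⟩ := μ.exists_eulH_eq (k := N + 1) (p := -μ.nz F) (x₀ := cj (glueZ Vs))
    (neg_mem (μ.nz_mem_fil_zw F)) (neg_mem (μ.nz_mem_fil hFN)) (cj_mem_fil (glueZ_mem_fil hVf))
  refine ⟨F, V, ⟨fun k => ?_, ?_⟩, hFN, hV2, fun a k => ?_, fun b => ?_⟩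
  · simp only [hFdef, cj_cj, hx1]
  · rw [hV1, neg_add_cancel]
  · rw [hFdef, ← cj_cj (proj a 0 (cj (x k))), cj_proj, cj_cj, hx3, cj_proj, cj_cj,
      proj_glueZ fun a => hF a k]
  · rw [hV3, cj_proj, cj_cj, proj_glueZ hV]

/-- Solving $Q\,\mathbf{tr}\,q+(n+2)q=t$: the trace of this equation gives
$\mathbf{tr}\,q=\mathbf{tr}\,t/(2n+2)$, and then $q$ is explicit. The formula is compatible with
conjugation and weights. -/
theorem exists_tr_quad_mul_eq {t : PS n A} (ht : IsBi 1 1 t) (htr : cj t = t) {k : ℕ}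
    (htk : t ∈ fil wt k) :
    ∃ q, IsBi 1 1 q ∧ cj q = q ∧ q ∈ fil wt k ∧ μ.tr (μ.quad * q) = t := by
  have hs : IsBi 0 0 (μ.tr t) := μ.isBi_tr ht
  have hsk : μ.quad * μ.tr t ∈ fil wt k := by
    rcases Nat.lt_or_ge k 2 with hk | hk
    · exact fil_mono hk.le (Ideal.mul_mem_right _ _ μ.quad_mem_fil)
    · obtain ⟨l, rfl⟩ := Nat.exists_eq_add_of_le' hk
      exact fil_mul' μ.quad_mem_fil (μ.tr_mem_fil htk) (by omega)
  have hb : IsBi 1 1 (invN (n + 2) * (t - invN (2 * n + 2) * (μ.quad * μ.tr t))) :=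
    (isBi_invN _).scalar_mul (ht.sub ((isBi_invN _).scalar_mul (μ.isBi_quad.mul hs)))
  refine ⟨invN (n + 2) * (t - invN (2 * n + 2) * (μ.quad * μ.tr t)), hb, ?_, ?_, ?_⟩
  · simp only [map_mul, map_sub, cj_invN, cj_quad, htr, ← tr_cj]
  · exact Ideal.mul_mem_left _ _ (sub_mem htk (Ideal.mul_mem_left _ _ hsk))
  · have e1 := natCast_mul_invN (n := n) (A := A) (k := n + 2) (by omega)
    have e2 := natCast_mul_invN (n := n) (A := A) (k := 2 * n + 2) (by omega)
    rw [μ.tr_quad_mul_of_isBi hb, tr_invN_mul, tr_sub, tr_invN_mul, μ.tr_quad hs]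
    push_cast at e1 e2 ⊢
    linear_combination t * e1 + invN (n + 2) * μ.quad * μ.tr t * (-1) * e2

end Model

end FormalCR

/-! ### Existence for the normalized homogeneous system -/

namespace FormalCR

open MvPowerSeries

namespace Model

variable {n : ℕ} {A : Type*} [CommRing A] [StarRing A] [Algebra ℂ A] [StarModule ℂ A]
  (μ : Model n A)

omit [StarModule ℂ A] in
theorem tr_mem_fil_sub {k : ℕ} {x : PS n A} (h : x ∈ fil wt k) : μ.tr x ∈ fil wt (k - 2) := by
  rcases Nat.lt_or_ge k 2 with hk | hk
  · rw [Nat.sub_eq_zero_of_le hk.le]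
    exact fil_zero _
  · obtain ⟨l, rfl⟩ := Nat.exists_eq_add_of_le' hk
    exact μ.tr_mem_fil h

omit [StarRing A] [StarModule ℂ A] in
theorem eq_zero_of_im_mul {x : PS n A} (h : im * x = 0) : x = 0 := by
  linear_combination -im * h + x * im_mul_im (n := n) (A := A)

/-- This is the (3,3) equation for $\mathrm{Re}\,V_{0,0}$. Divide the triple trace of `x` by
$4\cdot6n(n+1)(n+2)$ and integrate three times from zero, which leaves no $u^2$ term. The three
integrations restore the weight 6 that the traces remove. -/
theorem exists_cubic_real {k : ℕ} {x : PS n A} (hn : 0 < n) (hx : x ∈ fil wt k) (hb : IsBi 3 3 x)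
    (hr : cj x = x) : ∃ ρ, IsBi 0 0 ρ ∧ cj ρ = ρ ∧ ρ ∈ fil wt k ∧
      coeff (Finsupp.single Coord.u 2) ρ = 0 ∧
      μ.tr (μ.tr (μ.tr (4 * (μ.quad * (μ.quad * (μ.quad * du (du (du ρ)))))))) =
        μ.tr (μ.tr (μ.tr x)) := by
  set s := invN (4 * (6 * (n * (n + 1) * (n + 2)))) * μ.tr (μ.tr (μ.tr x)) with hs
  have hbi : IsBi 0 0 s := (isBi_invN _).scalar_mul (μ.isBi_tr (μ.isBi_tr (μ.isBi_tr hb)))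
  refine ⟨intU (intU (intU s)), hbi.intU.intU.intU, ?_, ?_, ?_, ?_⟩
  · rw [cj_intU, cj_intU, cj_intU, hs, map_mul, cj_invN, ← tr_cj, ← tr_cj, ← tr_cj, hr]
  · refine fil_mono ?_ (intU_mem_fil (intU_mem_fil (intU_mem_fil (Ideal.mul_mem_left _ _
      (μ.tr_mem_fil_sub (μ.tr_mem_fil_sub (μ.tr_mem_fil_sub hx)))))))
    simp only [wt]
    omega
  · exact intU_mem_fil (intU_mem_fil (intU_mem_fil (fil_zero (w := uw) s))) _ (by
      rw [weight_uw]; simp [uw])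
  · simp only [pderiv_intU, tr_ofNat_mul]
    rw [μ.tr_quad_three hbi, hs]
    have h := natCast_mul_invN (n := n) (A := A) (k := 4 * (6 * (n * (n + 1) * (n + 2))))
      (by positivity)
    push_cast at h ⊢
    linear_combination μ.tr (μ.tr (μ.tr x)) * h

/-- This is the (3,2) equation for $F_{0,0}$. The double trace of `x`, divided by
$8\cdot2(n+1)(n+2)$, is a linear form in $z$; its coefficients are of the form $(6i\mathcal
L+\mathcal N^w)(\xi,\cdot)$ by strong nondegeneracy, and ξ is integrated twice from zero. -/
theorem exists_transversal {k : ℕ} {x : PS n A} (hx : x ∈ fil wt (k + 1)) (hb : IsBi 3 2 x) :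
    ∃ y : Fin n → PS n A, (∀ j, IsBi 0 0 (y j)) ∧ (∀ j, y j ∈ fil wt k) ∧
      (∀ j, coeff (Finsupp.single Coord.u 1) (y j) = 0) ∧
      μ.tr (μ.tr (8 * (μ.quad * (μ.quad * (6 * im * cj (μ.lev fun j => du (du (y j))) -
        μ.nz fun j => du (du (y j))))))) = μ.tr (μ.tr x) := by
  set s := invN (8 * (2 * ((n + 1) * (n + 2)))) * μ.tr (μ.tr x) with hs
  have hbi : IsBi 1 0 s := (isBi_invN _).scalar_mul (μ.isBi_tr (μ.isBi_tr hb))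
  have hsf : s ∈ fil wt (k + 1 - 2 - 2) :=
    Ideal.mul_mem_left _ _ (μ.tr_mem_fil_sub (μ.tr_mem_fil_sub hx))
  -- Two traces lower the weight by 4 and the derivative in $z$ by 1. The subtraction is truncated,
  -- so the condition is empty when `k` is small.
  obtain ⟨ξ, h1, h2, h3⟩ := μ.exists_strong_eq (k := k + 1 - 2 - 2 - 1)
    (fun j => pderiv A (Coord.z j) s)
    (fun j => isBi_of_proj_eq (by rw [proj_pderiv_z, hbi.proj_eq])) (fun j => by
      rcases Nat.eq_zero_or_pos (k + 1 - 2 - 2) with h0 | h0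
      · rw [h0]
        exact fil_zero _
      · exact pderiv_mem_fil hsf _ (by simp only [wt]; omega))
  have h4 : 6 * im * cj (μ.lev ξ) - μ.nz ξ = s := by
    rw [strong_eq]
    simp only [h1]
    rw [← eul_apply, hbi.eul, Nat.cast_one, one_mul]
  refine ⟨fun j => intU (intU (ξ j)), fun j => (h2 j).intU.intU, fun j => ?_, fun j => ?_, ?_⟩
  · refine fil_mono ?_ (intU_mem_fil (intU_mem_fil (h3 j)))
    simp only [wt]
    omega
  · exact intU_mem_fil (intU_mem_fil (fil_zero (w := uw) (ξ j))) _ (by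
      rw [weight_uw]; simp [uw])
  · simp only [pderiv_intU, h4, tr_ofNat_mul, μ.tr_quad_two hbi]
    rw [hs]
    have h := natCast_mul_invN (n := n) (A := A) (k := 8 * (2 * ((n + 1) * (n + 2))))
      (by positivity)
    push_cast at h ⊢
    linear_combination μ.tr (μ.tr x) * h

/-- Every real perturbation of the hyperquadric can be normalized by a solution of the homogeneous
linear system. -/
theorem homog_exists (hn : 0 < n) {k : ℕ} {ψ : PS n A} (hr : cj ψ = ψ)
    (hψ : ψ ∈ fil wt (k + 2)) : ∃ (F : Fin n → PS n A) (V φ : PS n A), μ.Homog F V ∧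
      μ.Deform F V ψ φ ∧ cj φ = φ ∧ μ.Norm φ ∧ φ ∈ fil wt (k + 2) ∧
      (∀ j, F j ∈ fil wt (k + 1)) ∧ V ∈ fil wt (k + 2) ∧
      (∀ j, coeff (Finsupp.single Coord.u 1) (F j) = 0) ∧
      coeff (Finsupp.single Coord.u 2) (V + cj V) = 0 := by
  have hI := im_mul_im (n := n) (A := A)
  have i2 := natCast_mul_invN (n := n) (A := A) (k := 2) (by norm_num)
  have i4 := natCast_mul_invN (n := n) (A := A) (k := 4) (by norm_num)
  push_cast at i2 i4
  have hp : ∀ a b, cj (proj a b ψ) = proj b a ψ := fun a b => by rw [cj_proj, hr]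
  have hq2 : ∀ {x : PS n A}, x ∈ fil wt (k + 2) → μ.quad * (μ.quad * du (du x)) ∈
      fil wt (k + 2) := fun hx => by
    rw [← du_quad_mul]
    exact μ.quad_du_mem_fil (μ.quad_du_mem_fil hx)
  have b00 : IsBi 0 0 (proj 0 0 ψ) := isBi_proj 0 0 ψ
  -- the component of type `(3, 3)`
  obtain ⟨ρ, hρb, hρr, hρf, hρu, hρ⟩ := μ.exists_cubic_real hn (k := k + 2)
    (x := 12 * proj 3 3 ψ + 6 * (μ.quad * (μ.quad * du (du (proj 1 1 ψ)))))
    (add_mem (Ideal.mul_mem_left _ _ (proj_mem_fil hψ 3 3))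
      (Ideal.mul_mem_left _ _ (hq2 (proj_mem_fil hψ 1 1))))
    (((isBi_natCast 12).scalar_mul (isBi_proj 3 3 ψ)).add ((isBi_natCast 6).scalar_mul
      (μ.isBi_quad.mul (μ.isBi_quad.mul (isBi_proj 1 1 ψ).pderiv_u.pderiv_u))))
    (by simp only [map_add, map_mul, map_ofNat, cj_quad, cj_pderiv_u, hp])
  -- the component of type `(2, 2)`
  obtain ⟨q, hqb, hqr, hqf, hq⟩ := μ.exists_tr_quad_mul_eq (k := k)
    (t := μ.tr (proj 2 2 ψ + invN 2 * (μ.quad * (μ.quad * du (du (proj 0 0 ψ))))))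
    (μ.isBi_tr ((isBi_proj 2 2 ψ).add ((isBi_invN 2).scalar_mul
      (μ.isBi_quad.mul (μ.isBi_quad.mul b00.pderiv_u.pderiv_u)))))
    (by simp only [← tr_cj, map_add, map_mul, cj_invN, cj_quad, cj_pderiv_u, hp])
    (μ.tr_mem_fil (add_mem (proj_mem_fil hψ 2 2)
      (Ideal.mul_mem_left _ _ (hq2 (proj_mem_fil hψ 0 0)))))
  -- the component of type `(3, 2)`
  obtain ⟨y, hyb, hyf, hyu, hy⟩ := μ.exists_transversal (k := k + 1)
    (x := 24 * (im * proj 3 2 ψ) + 24 * (μ.quad * du (proj 2 1 ψ)) -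
      12 * (im * (μ.quad * (μ.quad * du (du (proj 1 0 ψ))))))
    (sub_mem (add_mem (Ideal.mul_mem_left _ _ (Ideal.mul_mem_left _ _ (proj_mem_fil hψ 3 2)))
      (Ideal.mul_mem_left _ _ (μ.quad_du_mem_fil (proj_mem_fil hψ 2 1))))
      (Ideal.mul_mem_left _ _ (Ideal.mul_mem_left _ _ (hq2 (proj_mem_fil hψ 1 0)))))
    ((((isBi_natCast 24).scalar_mul (isBi_im.scalar_mul (isBi_proj 3 2 ψ))).add
      ((isBi_natCast 24).scalar_mul (μ.isBi_quad.mul (isBi_proj 2 1 ψ).pderiv_u))).sub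
      ((isBi_natCast 12).scalar_mul (isBi_im.scalar_mul
        (μ.isBi_quad.mul (μ.isBi_quad.mul (isBi_proj 1 0 ψ).pderiv_u.pderiv_u)))))
  -- `R` is to be $\mathcal L(\bar z,F_{1,0})$. Its hermitian part is forced by bidegree (1,1); its
  -- skew part is half of `i` times the primitive of `q`, so that its derivative in `u` produces the
  -- term that bidegree (2,2) requires.
  set R := invN 2 * (μ.quad * du ρ - proj 1 1 ψ + im * intU q) with hR
  have hRb : IsBi 1 1 R := (isBi_invN 2).scalar_mul (((μ.isBi_quad.mul hρb.pderiv_u).sub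
    (isBi_proj 1 1 ψ)).add (isBi_im.scalar_mul hqb.intU))
  have hRf : R ∈ fil wt (k + 2) := Ideal.mul_mem_left _ _ (add_mem (sub_mem
    (μ.quad_du_mem_fil hρf) (proj_mem_fil hψ 1 1)) (Ideal.mul_mem_left _ _ (intU_mem_fil hqf)))
  have hcR : cj R = invN 2 * (μ.quad * du ρ - proj 1 1 ψ - im * intU q) := by
    simp only [hR, map_mul, map_add, map_sub, cj_invN, cj_quad, cj_pderiv_u, hρr, hp, cj_im,
      cj_intU, hqr]
    ring
  have hFb := μ.isBi_solF (ψ := ψ) hyb (μ.isBi_levInv hRb)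
  have hFf := μ.solF_mem_fil hyf (μ.levInv_mem_fil hRf) hψ
  -- This is $V_{0,0}$: the real part ρ serves bidegree (3,3), and the imaginary part cancels
  -- $\psi_{0,0}$.
  have hV0b : IsBi 0 0 (ρ - im * proj 0 0 ψ) := hρb.sub (isBi_im.scalar_mul b00)
  have hV0f : ρ - im * proj 0 0 ψ ∈ fil wt (k + 2) :=
    sub_mem hρf (Ideal.mul_mem_left _ _ (proj_mem_fil hψ 0 0))
  -- In `solF` from index 2 on, and in `solV` from index 1 on, the components are those obtained by
  -- solving the conditions in bidegrees $(a,1)$ and $(a,0)$, respectively.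
  obtain ⟨F, V, H, hF, hV, hFa, hVb⟩ := μ.exists_homog hFb
    (μ.isBi_solV (ψ := ψ) hFb hV0b) hFf (μ.solV_mem_fil hFf hV0f hψ)
  have hV00 : cj (proj 0 0 V) = ρ + im * proj 0 0 ψ := by
    rw [hVb]
    simp only [solV, map_sub, map_mul, cj_im, hρr, hp]
    ring
  have hV00' : proj 0 0 V = ρ - im * proj 0 0 ψ := by
    rw [← cj_cj (proj 0 0 V), hVb, solV, cj_cj]
  set θ := 2 * (V - cj V) + (μ.nz F - cj (μ.nz F)) + 4 * im * (μ.lev F + cj (μ.lev F)) with hθ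
  -- The relation is solved for the new defining function: $-i/4$ is the inverse of $4i$. The result
  -- is real because θ is purely imaginary.
  have hD : μ.Deform F V ψ (ψ - im * invN 4 * θ) := by
    change 4 * im * _ = _
    linear_combination (-im * im * θ) * i4 - θ * hI - hθ
  generalize hφ : ψ - im * invN 4 * θ = φ at hD
  have hθr : cj θ = -θ := by
    simp only [hθ, map_add, map_sub, map_mul, map_ofNat, cj_cj, cj_im]
    ring
  have hF0 : (fun j => proj 0 0 (F j)) = y := funext fun j => hFa 0 j
  have hFS : ∀ a, (fun j => proj a 0 (F j)) = μ.solF y (μ.levInv R) ψ a :=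
    fun a => funext fun j => hFa a j
  have hF1 : (μ.lev fun j => proj 1 0 (F j)) = R := by
    rw [hFS]
    exact μ.lev_levInv hRb
  have hVs : ∀ a : ℕ, ((a + 2 : ℕ) : PS n A) * (2 * cj (proj 0 (a + 2) V)) =
      ((a + 2 : ℕ) : PS n A) * (4 * (im * proj (a + 2) 0 ψ)) + (a : PS n A) * μ.nz fun j => proj (a + 1) 0 (F j) := by
    intro a
    have h := hVb (a + 2)
    rw [solV] at h
    rw [h, hFS]
    have := natCast_mul_invN (n := n) (A := A) (k := 2 * (a + 2)) (by positivity)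
    push_cast at this ⊢
    linear_combination (a * μ.nz (μ.solF y (μ.levInv R) ψ (a + 1))) * this
  have hV1 : 2 * cj (proj 0 1 V) = 4 * (im * proj 1 0 ψ) - μ.nz y + 4 * (im * cj (μ.lev y)) := by
    rw [hVb, solV, solF]
    linear_combination -μ.nz y * i2
  have hF2b : IsBi 2 1 (-proj 2 1 ψ + im * (μ.quad * du (proj 1 0 ψ)) -
      invN 2 * (μ.quad * μ.nz fun k => du (y k)) +
      2 * (im * (μ.quad * cj (μ.lev fun k => du (y k))))) :=
    (((isBi_proj 2 1 ψ).neg.add (isBi_im.scalar_mul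
      (μ.isBi_quad.mul (isBi_proj 1 0 ψ).pderiv_u))).sub ((isBi_invN 2).scalar_mul
      (μ.isBi_quad.mul (μ.isBi_nz fun k => (hyb k).pderiv_u)))).add
      ((isBi_natCast 2).scalar_mul (isBi_im.scalar_mul (μ.isBi_quad.mul
        (μ.isBi_lev fun k => (hyb k).pderiv_u).cj)))
  have hF2 : (μ.lev fun j => proj 2 0 (F j)) = -proj 2 1 ψ + im * (μ.quad * du (proj 1 0 ψ)) -
      invN 2 * (μ.quad * μ.nz fun k => du (y k)) +
      2 * (im * (μ.quad * cj (μ.lev fun k => du (y k)))) := by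
    rw [hFS]
    exact μ.lev_levInv hF2b
  have hF3 : ∀ a : ℕ, ((a + 3 : ℕ) : PS n A) * ((a + 2 : ℕ) : PS n A) *
      (μ.lev fun j => proj (a + 3) 0 (F j)) =
      ((a + 3 : ℕ) : PS n A) * ((a + 2 : ℕ) : PS n A) * (-proj (a + 3) 1 ψ + im * (μ.quad * du (proj (a + 2) 0 ψ))) -
      μ.quad * μ.nz fun k => du (proj (a + 1) 0 (F k)) := by
    intro a
    have h1 : (fun k => du (proj (a + 1) 0 (F k))) = fun k => du (μ.solF y (μ.levInv R) ψ (a + 1) k) :=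
      funext fun k => by rw [hFa]
    have hb : IsBi (a + 3) 1 (-proj (a + 3) 1 ψ + im * (μ.quad * du (proj (a + 2) 0 ψ)) -
        invN ((a + 3) * (a + 2)) * (μ.quad * μ.nz fun k => du (μ.solF y (μ.levInv R) ψ (a + 1) k))) :=
      ((isBi_proj (a + 3) 1 ψ).neg.add (isBi_im.scalar_mul (μ.isBi_quad.mul
        (isBi_proj (a + 2) 0 ψ).pderiv_u))).sub ((isBi_invN _).scalar_mul (μ.isBi_quad.mul
          (μ.isBi_nz fun k => (hFb (a + 1) k).pderiv_u)))
    have h2 : (μ.lev fun j => proj (a + 3) 0 (F j)) = -proj (a + 3) 1 ψ +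
        im * (μ.quad * du (proj (a + 2) 0 ψ)) - invN ((a + 3) * (a + 2)) *
          (μ.quad * μ.nz fun k => du (μ.solF y (μ.levInv R) ψ (a + 1) k)) := by
      rw [hFS]
      exact μ.lev_levInv hb
    rw [h2, h1]
    have := natCast_mul_invN (n := n) (A := A) (k := (a + 3) * (a + 2)) (by positivity)
    push_cast at this ⊢
    linear_combination
      -(μ.quad * μ.nz fun k => du (μ.solF y (μ.levInv R) ψ (a + 1) k)) * this
  refine ⟨F, V, φ, H, hD, ?_, ⟨fun a => ?_, ?_, fun a => ?_, ?_, ?_, ?_⟩, ?_, hF, hV,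
    fun j => ?_, ?_⟩
  · rw [← hφ, map_sub, map_mul, map_mul, hθr, hr, cj_im, cj_invN]
    ring
  · refine eq_zero_of_im_mul (natCast_mul_cancel (k := 4) (by norm_num) ?_)
    rw [mul_zero]
    push_cast
    match a with
    | 0 =>
      have h := hD.zero_zero
      rw [hV00, hV00'] at h
      linear_combination h
    | 1 =>
      have h := hD.one_zero H
      rw [hF0, hV1] at h
      linear_combination h
    | a + 2 =>
      have h := hD.succ_succ_zero H a
      refine natCast_mul_cancel (k := a + 2) (by omega) ?_
      rw [mul_zero]
      linear_combination h - hVs a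
  · refine eq_zero_of_im_mul (natCast_mul_cancel (k := 4) (by norm_num) ?_)
    have h := hD.one_one H
    rw [hF1, hcR, hV00, hV00', hR, show ρ - im * proj 0 0 ψ + (ρ + im * proj 0 0 ψ) = 2 * ρ by ring,
      du_ofNat_mul] at h
    push_cast
    linear_combination h + 4 * im * (μ.quad * du ρ - proj 1 1 ψ) * i2
  · refine eq_zero_of_im_mul (natCast_mul_cancel (k := 4) (by norm_num) ?_)
    rw [mul_zero]
    push_cast
    match a with
    | 0 =>
      have h := hD.two_one H
      have e := congrArg du hV1
      simp only [map_add, map_sub, du_ofNat_mul, du_im_mul, du_nz, du_lev, ← cj_pderiv_u] at e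
      have hF0' : ∀ j, proj 0 0 (F j) = y j := fun j => hFa 0 j
      simp only [hF0', hF2, ← cj_pderiv_u] at h
      linear_combination h - im * μ.quad * e + 4 * (μ.quad * cj (μ.lev fun k => du (y k))) * hI -
        2 * (im * μ.quad * μ.nz fun k => du (y k)) * i2
    | a + 1 =>
      have h := hD.succ_one H a
      have e := congrArg du (hVs a)
      refine natCast_mul_cancel (k := (a + 3) * (a + 2)) (by positivity) ?_
      rw [mul_zero]
      simp only [map_add, du_natCast_mul, du_ofNat_mul, du_im_mul, du_nz] at e
      have e3 := hF3 a
      push_cast at h e e3 ⊢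
      linear_combination h - ((a : PS n A) + 3) * im * μ.quad * e + 4 * im * e3
  · refine eq_zero_of_im_mul (natCast_mul_cancel (k := 4) (by norm_num) ?_)
    have h := congrArg μ.tr (hD.two_two H)
    rw [hF1, show R - cj R = im * intU q by
      rw [hcR, hR]; linear_combination im * intU q * i2, hV00, hV00',
      show ρ - im * proj 0 0 ψ - (ρ + im * proj 0 0 ψ) = -(2 * (im * proj 0 0 ψ)) by ring,
      map_neg, map_neg, du_ofNat_mul, du_ofNat_mul, du_im_mul, du_im_mul, du_im_mul,
      pderiv_intU] at h
    have e : ∀ x y z : PS n A, 4 * im * x - μ.quad * (μ.quad * -(2 * (im * y))) -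
        4 * (μ.quad * (im * z)) = 4 * (im * (x + invN 2 * (μ.quad * (μ.quad * y)) - μ.quad * z)) :=
      fun x y z => by linear_combination -2 * im * (μ.quad * (μ.quad * y)) * i2
    rw [e, mul_assoc, tr_ofNat_mul, tr_ofNat_mul, tr_im_mul, tr_im_mul, tr_sub, hq] at h
    push_cast
    linear_combination h
  · refine eq_zero_of_im_mul (natCast_mul_cancel (k := 24) (by norm_num) ?_)
    have e1 := congrArg (fun x => du (du x)) hV1
    have e2 := congrArg du hF2
    have h := hD.three_two H
    have hF0' : ∀ j, proj 0 0 (F j) = y j := fun j => hFa 0 j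
    simp only [map_add, map_sub, map_neg, du_ofNat_mul, du_im_mul, du_nz, du_lev, ← cj_pderiv_u,
      du_invN_mul, du_quad_mul] at e1 e2
    simp only [hF0', ← cj_pderiv_u] at h
    have h2 : 24 * (im * proj 3 2 φ) = 24 * (im * proj 3 2 ψ) + 24 * (μ.quad * du (proj 2 1 ψ)) -
        12 * (im * (μ.quad * (μ.quad * du (du (proj 1 0 ψ))))) -
        8 * (μ.quad * (μ.quad * (6 * im * cj (μ.lev fun j => du (du (y j))) -
        μ.nz fun j => du (du (y j))))) := by
      linear_combination h + 3 * μ.quad * μ.quad * e1 - 24 * μ.quad * e2 +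
        12 * μ.quad * μ.quad * (μ.nz fun j => du (du (y j))) * i2
    have h3 := congrArg (fun x => μ.tr (μ.tr x)) h2
    rw [tr_sub _ _ (8 * _), tr_sub _ _ (μ.tr (8 * _)), hy, sub_self, tr_ofNat_mul, tr_ofNat_mul,
      tr_im_mul, tr_im_mul] at h3
    push_cast
    linear_combination h3
  · refine eq_zero_of_im_mul (natCast_mul_cancel (k := 12) (by norm_num) ?_)
    have h := hD.three_three H
    rw [hF1, show R + cj R = μ.quad * du ρ - proj 1 1 ψ by
      rw [hcR, hR]; linear_combination (μ.quad * du ρ - proj 1 1 ψ) * i2, hV00, hV00',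
      show ρ - im * proj 0 0 ψ + (ρ + im * proj 0 0 ψ) = 2 * ρ by ring] at h
    simp only [map_sub, du_ofNat_mul, du_quad_mul] at h
    have h2 : 12 * (im * proj 3 3 φ) = im * ((12 * proj 3 3 ψ +
        6 * (μ.quad * (μ.quad * du (du (proj 1 1 ψ))))) -
        4 * (μ.quad * (μ.quad * (μ.quad * du (du (du ρ)))))) := by
      linear_combination h
    have h3 := congrArg (fun x => μ.tr (μ.tr (μ.tr x))) h2
    simp only [tr_im_mul, tr_sub, tr_ofNat_mul _ 12 (im * proj 3 3 φ)] at h3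
    rw [hρ, sub_self, tr_ofNat_mul, tr_ofNat_mul] at h3
    simp only [tr_im_mul] at h3
    push_cast
    linear_combination h3
  · rw [← hφ]
    refine sub_mem hψ (Ideal.mul_mem_left _ _ (add_mem (add_mem (Ideal.mul_mem_left _ _
      (sub_mem hV (cj_mem_fil hV))) (sub_mem (μ.nz_mem_fil hF) (cj_mem_fil (μ.nz_mem_fil hF))))
      (Ideal.mul_mem_left _ _ (add_mem (μ.lev_mem_fil hF) (cj_mem_fil (μ.lev_mem_fil hF))))))
  · rw [← hyu j, ← hF0, coeff_proj, if_pos (by simp [weight_zw, weight_bw])]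
  · have h : coeff (Finsupp.single Coord.u 2) (proj 0 0 V + cj (proj 0 0 V)) = 0 := by
      rw [hV00, hV00', show ρ - im * proj 0 0 ψ + (ρ + im * proj 0 0 ψ) = 2 * ρ by ring,
        ← map_ofNat (C (σ := Coord n) (R := A)) 2, coeff_C_mul, hρu, mul_zero]
    rw [← h, cj_proj, ← map_add, coeff_proj, if_pos (by simp [weight_zw, weight_bw])]

end Model

end FormalCR

/-! ### The linearized equations and the shear -/

namespace FormalCR

open MvPowerSeries

/-- A `Model` together with the hermitian part `H` and the symmetric part `B` of the coefficients of
`z̄` and `z` in the linear part of the transversal component of an almost CR structure. -/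
structure LinModel (n : ℕ) (A : Type*) [CommRing A] [StarRing A] [Algebra ℂ A] extends
    Model n A where
  H : Matrix (Fin n) (Fin n) A
  B : Matrix (Fin n) (Fin n) A
  star_H : ∀ j k, star (H j k) = H k j
  B_symm : ∀ j k, B j k = B k j

namespace LinModel

variable {n : ℕ} {A : Type*} [CommRing A] [StarRing A] [Algebra ℂ A] (μ : LinModel n A)

/-- The symmetric part of the linear part of the transversal component, evaluated at `F`. -/
noncomputable def sy (F : Fin n → PS n A) (j : Fin n) : PS n A :=
  ∑ k, (C (μ.H j k) * cj (F k) + C (μ.B j k) * F k)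

/-- The symmetric part of the linear part of the transversal component. -/
noncomputable abbrev syX (j : Fin n) : PS n A := μ.sy (fun k => X (Coord.z k)) j

/-- The coefficients of `z̄` in the linear part of the transversal component. -/
noncomputable def coefA (j k : Fin n) : A := μ.H j k + algebraMap ℂ A Complex.I * μ.c k j

/-- The coefficients of `z` in the linear part of the transversal component. -/
noncomputable def coefB (j k : Fin n) : A := μ.B j k + algebraMap ℂ A ((2 : ℕ) : ℂ)⁻¹ * μ.N k j

/-- The linear part of the transversal component, evaluated at `F`. -/
noncomputable def lin (F : Fin n → PS n A) (j : Fin n) : PS n A :=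
  ∑ k, (C (μ.coefA j k) * cj (F k) + C (μ.coefB j k) * F k)

/-- The linear part of the transversal component. -/
noncomputable abbrev linX (j : Fin n) : PS n A := μ.lin (fun k => X (Coord.z k)) j

/-- The linearization of the transversal equation. -/
noncomputable def lam (F : Fin n → PS n A) (G φ : PS n A) : PS n A :=
  μ.eulH G + im * μ.eulH φ - ∑ j, X (Coord.z j) * μ.lin F j - ∑ j, μ.linX j * μ.eulH (F j)

/-- The real function that removes the symmetric part from the linearized equation. -/
noncomputable def shear (F : Fin n → PS n A) : PS n A :=
  ∑ j, F j * μ.syX j + cj (∑ j, F j * μ.syX j)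

theorem lin_eq (F : Fin n → PS n A) (j : Fin n) : μ.lin F j =
    μ.sy F j + im * (∑ k, C (μ.c k j) * cj (F k)) + invN 2 * ∑ k, C (μ.N k j) * F k := by
  simp only [lin, sy, coefA, coefB, Finset.mul_sum, ← Finset.sum_add_distrib, map_add, map_mul]
  refine Finset.sum_congr rfl fun k _ => ?_
  rw [show (C (algebraMap ℂ A Complex.I) : PS n A) = im from rfl,
    show (C (algebraMap ℂ A ((2 : ℕ) : ℂ)⁻¹) : PS n A) = invN 2 from rfl]
  ring

theorem linX_eq (j : Fin n) : μ.linX j = μ.syX j + im * μ.beta j + invN 2 * μ.nu j := by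
  rw [linX, lin_eq]
  simp only [cj_X_z]
  rfl

theorem sum_X_lin (F : Fin n → PS n A) : ∑ j, X (Coord.z j) * μ.lin F j =
    ∑ j, X (Coord.z j) * μ.sy F j + im * cj (μ.lev F) - invN 2 * μ.nz F := by
  have h1 : cj (μ.lev F) = ∑ j, X (Coord.z j) * ∑ k, C (μ.c k j) * cj (F k) := by
    simp only [Model.lev, Model.beta, map_sum, map_mul, cj_C, μ.star_c, cj_X_zb, Finset.mul_sum,
      Finset.sum_mul]
    rw [Finset.sum_comm]
    exact Finset.sum_congr rfl fun j _ => Finset.sum_congr rfl fun l _ => by ring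
  have h2 : μ.nz F = - ∑ j, X (Coord.z j) * ∑ k, C (μ.N k j) * F k := by
    simp only [Model.nz, Model.nu, Finset.mul_sum, Finset.sum_mul, ← Finset.sum_neg_distrib]
    rw [Finset.sum_comm]
    refine Finset.sum_congr rfl fun j _ => Finset.sum_congr rfl fun l _ => ?_
    rw [μ.N_antisymm, map_neg]
    ring
  rw [h1, h2, Finset.mul_sum, mul_neg, sub_neg_eq_add, Finset.mul_sum, ← Finset.sum_add_distrib,
    ← Finset.sum_add_distrib]
  refine Finset.sum_congr rfl fun j _ => ?_
  rw [lin_eq]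
  ring

theorem eulH_X_z (j : Fin n) : μ.eulH (X (Coord.z j)) = X (Coord.z j) := by
  rw [Model.eulH_apply, (isBi_X_z j).eul, pderiv_X_of_ne (by simp), mul_zero, add_zero,
    Nat.cast_one, one_mul]

theorem eulH_X_zb (j : Fin n) : μ.eulH (X (Coord.zb j)) = 0 := by
  rw [Model.eulH_apply, (isBi_X_zb j).eul, pderiv_X_of_ne (by simp), mul_zero, add_zero,
    Nat.cast_zero, zero_mul]

theorem eulH_C (a : A) : μ.eulH (C a) = 0 := by
  rw [Model.eulH_apply, (isBi_C a).eul, pderiv_C, mul_zero, add_zero, Nat.cast_zero, zero_mul]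

theorem eulH_im_mul (x : PS n A) : μ.eulH (im * x) = im * μ.eulH x := by
  rw [Derivation.leibniz, im, eulH_C, smul_zero, add_zero, smul_eq_mul]

theorem eulH_invN_mul (k : ℕ) (x : PS n A) : μ.eulH (invN k * x) = invN k * μ.eulH x := by
  rw [Derivation.leibniz, invN, eulH_C, smul_zero, add_zero, smul_eq_mul]

theorem eulH_beta (k : Fin n) : μ.eulH (μ.beta k) = 0 := by
  rw [Model.beta, map_sum]
  refine Finset.sum_eq_zero fun j _ => ?_
  rw [Derivation.leibniz, eulH_C, eulH_X_zb, smul_zero, smul_zero, add_zero]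

theorem eulH_nu (k : Fin n) : μ.eulH (μ.nu k) = μ.nu k := by
  rw [Model.nu, map_sum]
  refine Finset.sum_congr rfl fun j _ => ?_
  rw [Derivation.leibniz, eulH_C, eulH_X_z, smul_zero, add_zero, smul_eq_mul]

theorem cj_beta (k : Fin n) : cj (μ.beta k) = ∑ j, C (μ.c k j) * X (Coord.z j) := by
  simp only [Model.beta, map_sum, map_mul, cj_C, μ.star_c, cj_X_zb]

theorem eulH_cj_beta (k : Fin n) : μ.eulH (cj (μ.beta k)) = cj (μ.beta k) := by
  rw [cj_beta, map_sum]
  refine Finset.sum_congr rfl fun j _ => ?_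
  rw [Derivation.leibniz, eulH_C, eulH_X_z, smul_zero, add_zero, smul_eq_mul]

theorem eulH_lev (F : Fin n → PS n A) : μ.eulH (μ.lev F) = μ.lev fun k => μ.eulH (F k) := by
  rw [Model.lev, map_sum]
  refine Finset.sum_congr rfl fun j _ => ?_
  rw [Derivation.leibniz, eulH_beta, smul_zero, add_zero, smul_eq_mul]

theorem eulH_nz (F : Fin n → PS n A) :
    μ.eulH (μ.nz F) = μ.nz F + μ.nz fun k => μ.eulH (F k) := by
  rw [Model.nz, map_sum, Model.nz, ← Finset.sum_add_distrib]
  refine Finset.sum_congr rfl fun j _ => ?_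
  rw [Derivation.leibniz, eulH_nu, smul_eq_mul, smul_eq_mul]
  ring

theorem eulH_cj_lev (F : Fin n → PS n A) :
    μ.eulH (cj (μ.lev F)) = cj (μ.lev F) + ∑ k, cj (μ.beta k) * μ.eulH (cj (F k)) := by
  rw [Model.lev, map_sum, map_sum, ← Finset.sum_add_distrib]
  refine Finset.sum_congr rfl fun j _ => ?_
  rw [map_mul, Derivation.leibniz, eulH_cj_beta, smul_eq_mul, smul_eq_mul]
  ring

theorem eulH_syX (j : Fin n) : μ.eulH (μ.syX j) = ∑ k, C (μ.B j k) * X (Coord.z k) := by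
  simp only [syX, sy, map_sum, map_add, Derivation.leibniz, eulH_C, cj_X_z, eulH_X_z, eulH_X_zb,
    mul_zero, add_zero, zero_add, smul_eq_mul]

theorem eulH_cj_syX (j : Fin n) : μ.eulH (cj (μ.syX j)) = ∑ k, C (μ.H k j) * X (Coord.z k) := by
  simp only [syX, sy, map_sum, map_add, map_mul, Derivation.leibniz, cj_C, eulH_C, cj_X_z,
    cj_X_zb, eulH_X_z, eulH_X_zb, mul_zero, add_zero, smul_eq_mul, μ.star_H]

/-- Here `H` is hermitian and `B` symmetric, so the symmetric part of the linear part of $L^w$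
enters only through derivatives of `syX` and its conjugate. Together with the terms in which `F` is
differentiated this is $T$ applied to the real function `shear F`, up to multiples of $T\bar F$, and
can be absorbed into $G$. -/
theorem sum_X_sy (F : Fin n → PS n A) : ∑ j, X (Coord.z j) * μ.sy F j =
    ∑ j, (cj (F j) * μ.eulH (cj (μ.syX j)) + F j * μ.eulH (μ.syX j)) := by
  simp only [eulH_syX, eulH_cj_syX]
  simp only [sy, Finset.mul_sum, ← Finset.sum_add_distrib]
  rw [Finset.sum_comm]
  refine Finset.sum_congr rfl fun j _ => Finset.sum_congr rfl fun k _ => ?_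
  rw [μ.B_symm j k]
  ring

/-- After a shear and a change of the unknown function, the linearized equation takes its normal
form. -/
theorem lam_eq (F : Fin n → PS n A) (G φ : PS n A) : μ.lam F (G + μ.shear F) φ =
    μ.eulH (G + im * φ - im * cj (μ.lev F) - im * μ.lev F - invN 2 * μ.nz F) + μ.nz F +
      ∑ j, μ.eulH (cj (F j)) * (cj (μ.syX j) + im * cj (μ.beta j)) := by
  have i2 := natCast_mul_invN (n := n) (A := A) (k := 2) (by norm_num)
  push_cast at i2
  have h1 : ∑ j, μ.linX j * μ.eulH (F j) = ∑ j, μ.syX j * μ.eulH (F j) +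
      im * (μ.lev fun k => μ.eulH (F k)) + invN 2 * μ.nz fun k => μ.eulH (F k) := by
    simp only [Model.lev, Model.nz, Finset.mul_sum, ← Finset.sum_add_distrib, linX_eq]
    exact Finset.sum_congr rfl fun j _ => by ring
  have h2 : μ.eulH (μ.shear F) = ∑ j, μ.syX j * μ.eulH (F j) +
      ∑ j, (cj (F j) * μ.eulH (cj (μ.syX j)) + F j * μ.eulH (μ.syX j)) +
      ∑ j, μ.eulH (cj (F j)) * cj (μ.syX j) := by
    simp only [shear, map_add, map_sum, map_mul, Derivation.leibniz, smul_eq_mul,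
      Finset.sum_add_distrib]
    have e : ∀ f g : Fin n → PS n A, ∑ j, f j * g j = ∑ j, g j * f j := fun f g =>
      Finset.sum_congr rfl fun j _ => mul_comm _ _
    rw [e (fun j => cj (μ.syX j)) fun j => μ.eulH (cj (F j))]
    ring
  have h3 : ∑ j, μ.eulH (cj (F j)) * (cj (μ.syX j) + im * cj (μ.beta j)) =
      ∑ j, μ.eulH (cj (F j)) * cj (μ.syX j) + im * ∑ k, cj (μ.beta k) * μ.eulH (cj (F k)) := by
    simp only [Finset.mul_sum, ← Finset.sum_add_distrib]
    exact Finset.sum_congr rfl fun j _ => by ring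
  rw [lam, sum_X_lin, sum_X_sy, h1, h3]
  simp only [map_add, map_sub, eulH_im_mul, eulH_invN_mul, eulH_lev, eulH_nz, eulH_cj_lev, h2]
  linear_combination μ.nz F * i2

theorem lam_mem_fil_zw (F : Fin n → PS n A) (G φ : PS n A) : μ.lam F G φ ∈ fil zw 1 := by
  refine sub_mem (sub_mem (add_mem (μ.eulH_mem_fil_zw G) (Ideal.mul_mem_left _ _
    (μ.eulH_mem_fil_zw φ))) ?_) ?_
  · exact Ideal.sum_mem _ fun j _ => Ideal.mul_mem_right _ _ (X_mem_fil (w := zw) (Coord.z j))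
  · exact Ideal.sum_mem _ fun j _ => Ideal.mul_mem_left _ _ (μ.eulH_mem_fil_zw _)

theorem sy_mem_fil {k : ℕ} {F : Fin n → PS n A} (h : ∀ j, F j ∈ fil wt k) (j : Fin n) :
    μ.sy F j ∈ fil wt k :=
  Ideal.sum_mem _ fun l _ => add_mem (Ideal.mul_mem_left _ _ (cj_mem_fil (h l)))
    (Ideal.mul_mem_left _ _ (h l))

theorem lin_mem_fil {k : ℕ} {F : Fin n → PS n A} (h : ∀ j, F j ∈ fil wt k) (j : Fin n) :
    μ.lin F j ∈ fil wt k :=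
  Ideal.sum_mem _ fun l _ => add_mem (Ideal.mul_mem_left _ _ (cj_mem_fil (h l)))
    (Ideal.mul_mem_left _ _ (h l))

theorem syX_mem_fil (j : Fin n) : μ.syX j ∈ fil wt 1 :=
  μ.sy_mem_fil (fun k => X_mem_fil (w := wt) (Coord.z k)) j

theorem linX_mem_fil (j : Fin n) : μ.linX j ∈ fil wt 1 :=
  μ.lin_mem_fil (fun k => X_mem_fil (w := wt) (Coord.z k)) j

theorem shear_mem_fil {k : ℕ} {F : Fin n → PS n A} (h : ∀ j, F j ∈ fil wt k) :
    μ.shear F ∈ fil wt (k + 1) := by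
  have h1 : ∑ j, F j * μ.syX j ∈ fil wt (k + 1) :=
    Ideal.sum_mem _ fun j _ => fil_mul (h j) (μ.syX_mem_fil j)
  exact add_mem h1 (cj_mem_fil h1)

theorem cj_shear (F : Fin n → PS n A) : cj (μ.shear F) = μ.shear F := by
  rw [shear, map_add, cj_cj, add_comm]

omit [StarRing A] [Algebra ℂ A] in
theorem coeff_single_u (l : ℕ) (x : PS n A) : coeff (Finsupp.single Coord.u l) x =
    coeff (Finsupp.single Coord.u l) (proj 0 0 x) := by
  rw [coeff_proj, if_pos (by simp [weight_zw, weight_bw])]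

theorem proj_sy_mul (x : PS n A) (j : Fin n) : proj 0 0 (x * μ.syX j) = 0 := by
  rw [syX, sy, Finset.mul_sum, map_sum]
  refine Finset.sum_eq_zero fun k _ => ?_
  rw [mul_add, map_add, cj_X_z, mul_comm, proj_mul_of_lt ((isBi_C _).mul (isBi_X_zb k))
    (Or.inr Nat.zero_lt_one), mul_comm, proj_mul_of_lt ((isBi_C _).mul (isBi_X_z k))
    (Or.inl Nat.zero_lt_one), add_zero]

/-- Every term of the shear contains a factor $z$ or $\bar z$. Hence the shear does not disturb the
normalization of the $u^2$ coefficient of $G$. -/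
theorem proj_shear (F : Fin n → PS n A) : proj 0 0 (μ.shear F) = 0 := by
  rw [shear, map_add, ← cj_proj, map_sum, Finset.sum_eq_zero fun j _ => μ.proj_sy_mul (F j) j,
    map_zero, add_zero]

end LinModel

end FormalCR

/-! ### Unique solvability of the normalized linear system -/

namespace FormalCR

open MvPowerSeries

namespace LinModel

variable {n : ℕ} {A : Type*} [CommRing A] [StarRing A] [Algebra ℂ A] [StarModule ℂ A]
  (μ : LinModel n A)

/-- The normalization conditions on the unknown functions. -/
structure Normal (F : Fin n → PS n A) (G φ : PS n A) : Prop where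
  cj_G : cj G = G
  cj_φ : cj φ = φ
  norm : μ.Norm φ
  F_u : ∀ j, coeff (Finsupp.single Coord.u 1) (F j) = 0
  G_u : coeff (Finsupp.single Coord.u 2) G = 0

omit [StarModule ℂ A] in
theorem Normal.sub {F F' : Fin n → PS n A} {G G' φ φ' : PS n A} (h : μ.Normal F G φ)
    (h' : μ.Normal F' G' φ') :
    μ.Normal (fun j => F j - F' j) (G - G') (φ - φ') where
  cj_G := by rw [map_sub, h.cj_G, h'.cj_G]
  cj_φ := by rw [map_sub, h.cj_φ, h'.cj_φ]
  norm :=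
    { pure := fun a => by rw [map_sub, h.norm.pure, h'.norm.pure, sub_zero]
      one_one := by rw [map_sub, h.norm.one_one, h'.norm.one_one, sub_zero]
      deg_one := fun a => by rw [map_sub, h.norm.deg_one, h'.norm.deg_one, sub_zero]
      tr_two_two := by
        rw [map_sub, Model.tr_sub, h.norm.tr_two_two, h'.norm.tr_two_two, sub_zero]
      tr_three_two := by
        rw [map_sub, Model.tr_sub, Model.tr_sub, h.norm.tr_three_two, h'.norm.tr_three_two,
          sub_zero]
      tr_three_three := by
        rw [map_sub, Model.tr_sub, Model.tr_sub, Model.tr_sub, h.norm.tr_three_three,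
          h'.norm.tr_three_three, sub_zero] }
  F_u := fun j => by rw [map_sub, h.F_u, h'.F_u, sub_zero]
  G_u := by rw [map_sub, h.G_u, h'.G_u, sub_zero]

omit [StarModule ℂ A] in
theorem lam_sub (F F' : Fin n → PS n A) (G G' φ φ' : PS n A) :
    μ.lam (fun j => F j - F' j) (G - G') (φ - φ') = μ.lam F G φ - μ.lam F' G' φ' := by
  have h1 : ∀ j, μ.lin (fun j => F j - F' j) j = μ.lin F j - μ.lin F' j := fun j => by
    simp only [lin, ← Finset.sum_sub_distrib, map_sub]
    exact Finset.sum_congr rfl fun k _ => by ring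
  simp only [lam, h1, map_sub, mul_sub, Finset.sum_sub_distrib]
  ring

/-- A particular solution of the triangular system ignores the normalization and prescribes a real
function in place of φ. That function is normalized by adding a homogeneous solution. Afterwards $G$
and φ are read off as the real and imaginary parts of one series, up to the shear. -/
theorem linear_exists (hn : 0 < n) {k : ℕ} {p : Fin n → PS n A} {q : PS n A}
    (hp : ∀ j, p j ∈ fil zw 1) (hpk : ∀ j, p j ∈ fil wt (k + 1)) (hq : q ∈ fil zw 1)
    (hqk : q ∈ fil wt (k + 2)) : ∃ (F : Fin n → PS n A) (G φ : PS n A), μ.Normal F G φ ∧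
      (∀ j, μ.eulH (cj (F j)) = p j) ∧ μ.lam F G φ = q ∧ (∀ j, F j ∈ fil wt (k + 1)) ∧
      G ∈ fil wt (k + 2) ∧ φ ∈ fil wt (k + 2) := by
  have hI := im_mul_im (n := n) (A := A)
  have i2 := natCast_mul_invN (n := n) (A := A) (k := 2) (by norm_num)
  have i4 := natCast_mul_invN (n := n) (A := A) (k := 4) (by norm_num)
  push_cast at i2 i4
  -- The free components of the particular solution are taken to be zero, so it contributes nothing
  -- to the normalized coefficients of $u$ in $F$ and $u^2$ in $G$.
  choose x hx hxf hx0 using fun j => μ.exists_eulH_eq (hp j) (hpk j) (Ideal.zero_mem _)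
  set F₀ : Fin n → PS n A := fun j => cj (x j) with hF₀
  have hF₀f : ∀ j, F₀ j ∈ fil wt (k + 1) := fun j => cj_mem_fil (hxf j)
  obtain ⟨V₀, hV₀, hV₀f, hV₀0⟩ := μ.exists_eulH_eq (k := k + 2) (x₀ := 0)
    (p := q - ∑ j, p j * (cj (μ.syX j) + im * cj (μ.beta j)) - μ.nz F₀)
    (sub_mem (sub_mem hq (Ideal.sum_mem _ fun j _ => Ideal.mul_mem_right _ _ (hp j)))
      (μ.nz_mem_fil_zw F₀))
    (sub_mem (sub_mem hqk (Ideal.sum_mem _ fun j _ => fil_mul' (l := 1) (hpk j)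
      (add_mem (cj_mem_fil (μ.syX_mem_fil j)) (Ideal.mul_mem_left _ _
        (cj_mem_fil (μ.beta_mem_fil j)))) (by omega))) (μ.nz_mem_fil hF₀f)) (Ideal.zero_mem _)
  set θ := 2 * (V₀ - cj V₀) + (μ.nz F₀ - cj (μ.nz F₀)) + 4 * im * (μ.lev F₀ + cj (μ.lev F₀))
    with hθ
  have hθf : θ ∈ fil wt (k + 2) := add_mem (add_mem (Ideal.mul_mem_left _ _
      (sub_mem hV₀f (cj_mem_fil hV₀f))) (sub_mem (μ.nz_mem_fil hF₀f)
        (cj_mem_fil (μ.nz_mem_fil hF₀f)))) (Ideal.mul_mem_left _ _ (add_mem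
          (μ.lev_mem_fil hF₀f) (cj_mem_fil (μ.lev_mem_fil hF₀f))))
  have hθr : cj θ = -θ := by
    simp only [hθ, map_add, map_sub, map_mul, map_ofNat, cj_cj, cj_im]
    ring
  -- The value $\theta/(4i)=-i\theta/4$ is the defining function that the particular solution alone
  -- would force; the homogeneous solution normalizes it.
  obtain ⟨F₁, V₁, φ, H, hD, hφr, hφN, hφf, hF₁f, hV₁f, hFu, hVu⟩ := μ.homog_exists hn
    (ψ := -(im * invN 4 * θ)) (by
      rw [map_neg, map_mul, map_mul, hθr, cj_im, cj_invN]
      ring) (neg_mem (Ideal.mul_mem_left _ _ hθf))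
  set F : Fin n → PS n A := fun j => F₀ j + F₁ j with hF
  set V := V₀ + V₁ with hV
  have hFf : ∀ j, F j ∈ fil wt (k + 1) := fun j => add_mem (hF₀f j) (hF₁f j)
  have hVf : V ∈ fil wt (k + 2) := add_mem hV₀f hV₁f
  -- Inversion of the change of unknown: `W` has to be $G_0+i\varphi$ with $G_0$ and φ real, where
  -- $G_0$ is $G$ without the shear.
  set W := V + im * cj (μ.lev F) + im * μ.lev F + invN 2 * μ.nz F with hW
  have hWf : W ∈ fil wt (k + 2) := add_mem (add_mem (add_mem hVf (Ideal.mul_mem_left _ _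
    (cj_mem_fil (μ.lev_mem_fil hFf)))) (Ideal.mul_mem_left _ _ (μ.lev_mem_fil hFf)))
    (Ideal.mul_mem_left _ _ (μ.nz_mem_fil hFf))
  have hlev : μ.lev F = μ.lev F₀ + μ.lev F₁ := μ.lev_add F₀ F₁
  have hnz : μ.nz F = μ.nz F₀ + μ.nz F₁ := μ.nz_add F₀ F₁
  have hφW : im * φ = invN 2 * (W - cj W) := by
    have h := hD
    rw [Model.Deform] at h
    have h' : 4 * im * φ = θ + 2 * (V₁ - cj V₁) + (μ.nz F₁ - cj (μ.nz F₁)) +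
        4 * im * (μ.lev F₁ + cj (μ.lev F₁)) := by
      linear_combination h - 4 * invN 4 * θ * hI + θ * i4
    refine natCast_mul_cancel (k := 4) (by norm_num) ?_
    simp only [hW, hV, hlev, hnz, map_add, map_mul, cj_im, cj_cj, cj_invN]
    simp only [hθ] at h'
    push_cast
    linear_combination h' - (2 * ((V₀ + V₁) - (cj V₀ + cj V₁) + 2 * im * (μ.lev F₀ + μ.lev F₁ +
      cj (μ.lev F₀) + cj (μ.lev F₁))) + (2 * invN 2 + 1) *
      (μ.nz F₀ + μ.nz F₁ - cj (μ.nz F₀) - cj (μ.nz F₁))) * i2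
  set G₀ := invN 2 * (W + cj W) with hG₀
  have hG₀r : cj G₀ = G₀ := by
    rw [hG₀, map_mul, map_add, cj_cj, cj_invN, add_comm]
  have hp' : ∀ j, μ.eulH (cj (F j)) = p j := fun j => by
    rw [hF, map_add, map_add, H.eulH_F, add_zero, hF₀, cj_cj, hx]
  refine ⟨F, G₀ + μ.shear F, φ, ⟨?_, hφr, hφN, fun j => ?_, ?_⟩, hp', ?_, hFf,
    add_mem (Ideal.mul_mem_left _ _ (add_mem hWf (cj_mem_fil hWf))) (μ.shear_mem_fil hFf), hφf⟩
  · rw [map_add, hG₀r, cj_shear]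
  · rw [hF, map_add, hFu, add_zero, coeff_single_u, hF₀, ← cj_proj, hx0, map_zero, map_zero,
      map_zero]
  · have h1 : proj 0 0 W = proj 0 0 V := by
      simp only [hW, map_add, proj_im_mul, proj_invN_mul, ← cj_proj, Model.proj_nz_zero,
        Model.proj_lev_zero, map_zero, mul_zero, add_zero]
    have h2 : proj 0 0 V = proj 0 0 V₁ := by rw [hV, map_add, hV₀0, map_zero, zero_add]
    rw [coeff_single_u, map_add, proj_shear, add_zero, hG₀, proj_invN_mul, map_add, ← cj_proj, h1,
      h2, cj_proj, ← map_add, invN, coeff_C_mul, ← coeff_single_u, hVu, mul_zero]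
  · have h1 : G₀ + im * φ - im * cj (μ.lev F) - im * μ.lev F - invN 2 * μ.nz F = V := by
      rw [hφW, hG₀]
      linear_combination hW + W * i2
    rw [lam_eq, h1]
    simp only [hp']
    have h2 := H.eulH_V
    rw [hV, map_add, hV₀, hnz]
    linear_combination h2

/-- The combination `V` of $G$ and φ together with `F` is a normalized homogeneous solution, hence
zero by `Model.homog_unique`. What remains is $G_0+i\varphi=0$ with both terms real. -/
theorem linear_unique (hn : 0 < n) {F : Fin n → PS n A} {G φ : PS n A} (h : μ.Normal F G φ)
    (hF : ∀ j, F j ∈ fil wt 2) (hG : G ∈ fil wt 3) (hφ : φ ∈ fil wt 3)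
    (hp : ∀ j, μ.eulH (cj (F j)) = 0) (hq : μ.lam F G φ = 0) :
    (∀ j, F j = 0) ∧ G = 0 ∧ φ = 0 := by
  have hI := im_mul_im (n := n) (A := A)
  have i2 := natCast_mul_invN (n := n) (A := A) (k := 2) (by norm_num)
  push_cast at i2
  obtain ⟨G₀, rfl⟩ : ∃ G₀, G = G₀ + μ.shear F := ⟨G - μ.shear F, by ring⟩
  set V := G₀ + im * φ - im * cj (μ.lev F) - im * μ.lev F - invN 2 * μ.nz F with hV
  have hG₀ : G₀ ∈ fil wt 3 := by
    have := sub_mem hG (μ.shear_mem_fil hF)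
    rwa [add_sub_cancel_right] at this
  have hG₀r : cj G₀ = G₀ := by
    have := h.cj_G
    rw [map_add, cj_shear] at this
    exact add_right_cancel this
  have hVf : V ∈ fil wt 3 := sub_mem (sub_mem (sub_mem (add_mem hG₀ (Ideal.mul_mem_left _ _ hφ))
    (Ideal.mul_mem_left _ _ (cj_mem_fil (μ.lev_mem_fil hF)))) (Ideal.mul_mem_left _ _
      (μ.lev_mem_fil hF))) (Ideal.mul_mem_left _ _ (μ.nz_mem_fil hF))
  have H : μ.Homog F V := ⟨hp, by
    have := hq
    rw [lam_eq] at this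
    simp only [hp, zero_mul, Finset.sum_const_zero, add_zero] at this
    exact this⟩
  have hD : μ.Deform F V 0 φ := by
    change 4 * im * φ = _
    simp only [hV, map_sub, map_add, map_mul, cj_im, cj_cj, cj_invN, h.cj_φ, hG₀r]
    linear_combination (cj (μ.nz F) - μ.nz F) * i2 * (-1)
  obtain ⟨h1, h2⟩ := μ.homog_unique hn H hD h.norm hF hVf h.F_u (by
    have e : proj 0 0 V = proj 0 0 G₀ := by
      simp only [hV, map_sub, map_add, proj_im_mul, proj_invN_mul, ← cj_proj, Model.proj_nz_zero,
        Model.proj_lev_zero, map_zero, mul_zero, add_zero, sub_zero, h.norm.pure]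
    have e2 := h.G_u
    rw [coeff_single_u, map_add, proj_shear, add_zero] at e2
    rw [coeff_single_u, e, e2])
  have h3 : F = fun _ => 0 := funext h1
  have hs : μ.shear F = 0 := by
    rw [h3]
    simp [shear]
  have h4 : G₀ + im * φ = 0 := by
    rw [h2, h3, Model.lev_zero, Model.nz_zero, map_zero] at hV
    linear_combination -hV
  have h5 : G₀ - im * φ = 0 := by
    have := congrArg cj h4
    rw [map_add, map_mul, cj_im, h.cj_φ, hG₀r, map_zero] at this
    linear_combination this
  refine ⟨h1, ?_, ?_⟩
  · rw [hs, add_zero]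
    refine natCast_mul_cancel (k := 2) (by norm_num) ?_
    push_cast
    linear_combination h4 + h5
  · refine natCast_mul_cancel (k := 2) (by norm_num) ?_
    push_cast
    linear_combination -im * (h4 - h5) + 2 * φ * hI

/-- An approximate solution of the homogeneous linear system is small. -/
theorem linear_small (hn : 0 < n) {k : ℕ} (hk : 1 ≤ k) {F : Fin n → PS n A} {G φ : PS n A}
    (h : μ.Normal F G φ) (hF : ∀ j, F j ∈ fil wt 2) (hG : G ∈ fil wt 3) (hφ : φ ∈ fil wt 3)
    (hp : ∀ j, μ.eulH (cj (F j)) ∈ fil wt (k + 1)) (hq : μ.lam F G φ ∈ fil wt (k + 2)) :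
    (∀ j, F j ∈ fil wt (k + 1)) ∧ G ∈ fil wt (k + 2) ∧ φ ∈ fil wt (k + 2) := by
  -- The solution constructed for the same right-hand sides is as small as they are, and by
  -- uniqueness it is the given one.
  obtain ⟨F', G', φ', h', hp', hq', hF', hG', hφ'⟩ := μ.linear_exists hn
    (fun j => μ.eulH_mem_fil_zw _) hp (μ.lam_mem_fil_zw F G φ) hq
  obtain ⟨e1, e2, e3⟩ := μ.linear_unique hn (Normal.sub μ h h')
    (fun j => sub_mem (hF j) (fil_mono (by omega) (hF' j))) (sub_mem hG (fil_mono (by omega) hG'))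
    (sub_mem hφ (fil_mono (by omega) hφ')) (fun j => by rw [map_sub, map_sub, hp', sub_self])
    (by rw [lam_sub, hq', sub_self])
  exact ⟨fun j => sub_eq_zero.mp (e1 j) ▸ hF' j, sub_eq_zero.mp e2 ▸ hG', sub_eq_zero.mp e3 ▸ hφ'⟩

end LinModel

end FormalCR

/-! ### The nonlinear radial equations and their linearization -/

namespace FormalCR

open MvPowerSeries

section General

theorem exists_fil_limit_add {σ R ι : Type*} [CommRing R] (w : σ → ℕ)
    (x : ℕ → ι → MvPowerSeries σ R) (c : ℕ) (hx : ∀ k i, x (k + 1) i - x k i ∈ fil w (k + c)) :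
    ∃ y : ι → MvPowerSeries σ R, ∀ k i, y i - x k i ∈ fil w (k + c) := by
  obtain ⟨y, hy⟩ := exists_fil_limit w x fun k i => fil_mono (Nat.le_add_right k c) (hx k i)
  refine ⟨y, fun k i => ?_⟩
  have h : ∀ l, x (k + l) i - x k i ∈ fil w (k + c) := fun l => by
    induction l with
    | zero => simp
    | succ l ih =>
      have := Ideal.add_mem _ (fil_mono (by omega : k + c ≤ k + l + c) (hx (k + l) i)) ih
      simpa [add_assoc] using this
  have := Ideal.add_mem _ (hy (k + c) i) (h c)
  simpa using this

variable {n : ℕ} {A : Type*} [CommRing A]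

theorem X_mem_fil_wt (i : Coord n) : (X i : PS n A) ∈ fil wt (wt i) := X_mem_fil (w := wt) i

theorem hasSubst_of_mem_fil_wt {a : Coord n → PS n A} (ha : ∀ i, a i ∈ fil wt (wt i)) :
    HasSubst a := hasSubst_of_constantCoeff_zero fun i => by
  rw [← coeff_zero_eq_constantCoeff_apply]
  refine ha i 0 ?_
  rw [map_zero]
  rcases i with j | j | j <;> simp [wt]

theorem du_mem_fil {k : ℕ} {x : PS n A} (h : x ∈ fil wt (k + 2)) : du x ∈ fil wt k :=
  pderiv_mem_fil h _ le_rfl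

variable [StarRing A]

/-- The real-type map with components `z + F`, `u + G`. -/
noncomputable def comps (F : Fin n → PS n A) (G : PS n A) : Coord n → PS n A
  | Sum.inl j => X (Coord.z j) + F j
  | Sum.inr (Sum.inl j) => X (Coord.zb j) + cj (F j)
  | Sum.inr (Sum.inr _) => X Coord.u + G

theorem comps_mem_fil {F : Fin n → PS n A} {G : PS n A} (hF : ∀ j, F j ∈ fil wt 1)
    (hG : G ∈ fil wt 2) (i : Coord n) : comps F G i ∈ fil wt (wt i) := by
  rcases i with j | j | j
  · exact add_mem (X_mem_fil_wt _) (hF j)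
  · exact add_mem (X_mem_fil_wt _) (cj_mem_fil (hF j))
  · exact add_mem (X_mem_fil_wt _) hG

theorem comps_sub_mem_fil {k : ℕ} {F F' : Fin n → PS n A} {G G' : PS n A}
    (hF : ∀ j, F j - F' j ∈ fil wt (1 + k)) (hG : G - G' ∈ fil wt (2 + k)) (i : Coord n) :
    comps F G i - comps F' G' i ∈ fil wt (wt i + k) := by
  rcases i with j | j | j
  · rw [comps, comps, add_sub_add_left_eq_sub]
    exact hF j
  · rw [comps, comps, add_sub_add_left_eq_sub, ← map_sub]
    exact cj_mem_fil (hF j)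
  · rw [comps, comps, add_sub_add_left_eq_sub]
    exact hG

variable [Algebra ℂ A]

/-- A multiple of the vector field `e + L_φ(e)`, applied to `x`. -/
noncomputable def radial (φ x : PS n A) : PS n A := (1 - im * du φ) * eul x + im * eul φ * du x

omit [StarRing A] in
theorem radial_add (φ x y : PS n A) : radial φ (x + y) = radial φ x + radial φ y := by
  simp only [radial, map_add]
  ring

omit [StarRing A] in
theorem radial_sub (φ x y : PS n A) : radial φ (x - y) = radial φ x - radial φ y := by
  simp only [radial, map_sub]
  ring

omit [StarRing A] in
theorem radial_sub_radial (φ φ' x : PS n A) : radial φ x - radial φ' x =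
    im * eul (φ - φ') * du x - im * du (φ - φ') * eul x := by
  simp only [radial, map_sub]
  ring

omit [StarRing A] in
theorem radial_X_z (φ : PS n A) (j : Fin n) :
    radial φ (X (Coord.z j)) = (1 - im * du φ) * X (Coord.z j) := by
  rw [radial, (isBi_X_z j).eul, pderiv_X_of_ne (by simp), Nat.cast_one]
  ring

omit [StarRing A] in
theorem radial_X_u (φ : PS n A) : radial φ (X Coord.u) = im * eul φ := by
  classical
  rw [radial, isBi_X_u.eul, pderiv_X_self, Nat.cast_zero]
  ring

omit [StarRing A] in
theorem radial_mem_fil_zw (φ x : PS n A) : radial φ x ∈ fil zw 1 :=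
  add_mem (Ideal.mul_mem_left _ _ (eul_mem_fil_zw x))
    (Ideal.mul_mem_right _ _ (Ideal.mul_mem_left _ _ (eul_mem_fil_zw φ)))

/-- The `z̄_k`-component of the radial equation. -/
noncomputable def errB (zb : Fin n → Fin n → PS n A) (F : Fin n → PS n A) (G φ : PS n A)
    (k : Fin n) : PS n A :=
  radial φ (cj (F k)) - ∑ j, subst (comps F G) (zb k j) * radial φ (X (Coord.z j) + F j)

/-- The transversal component of the radial equation. -/
noncomputable def errW (w : Fin n → PS n A) (F : Fin n → PS n A) (G φ : PS n A) : PS n A :=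
  radial φ (X Coord.u + G) - ∑ j, subst (comps F G) (w j) * radial φ (X (Coord.z j) + F j)

theorem errB_mem_fil_zw (zb : Fin n → Fin n → PS n A) (F : Fin n → PS n A) (G φ : PS n A)
    (k : Fin n) : errB zb F G φ k ∈ fil zw 1 :=
  sub_mem (radial_mem_fil_zw _ _)
    (Ideal.sum_mem _ fun _ _ => Ideal.mul_mem_left _ _ (radial_mem_fil_zw _ _))

theorem errW_mem_fil_zw (w : Fin n → PS n A) (F : Fin n → PS n A) (G φ : PS n A) :
    errW w F G φ ∈ fil zw 1 :=
  sub_mem (radial_mem_fil_zw _ _)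
    (Ideal.sum_mem _ fun _ _ => Ideal.mul_mem_left _ _ (radial_mem_fil_zw _ _))

end General

namespace LinModel

variable {n : ℕ} {A : Type*} [CommRing A] [StarRing A] [Algebra ℂ A] (μ : LinModel n A)

/-- The real quadratic polynomial with derivatives `syX`. -/
noncomputable def q2 : PS n A := ∑ j, ∑ k, (C (μ.H j k) * X (Coord.z j) * X (Coord.zb k) +
  invN 2 * (C (μ.B j k) * X (Coord.z j) * X (Coord.z k) +
    C (star (μ.B j k)) * X (Coord.zb j) * X (Coord.zb k)))

theorem cj_q2 [StarModule ℂ A] : cj μ.q2 = μ.q2 := by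
  have h : μ.q2 = (∑ j, ∑ k, C (μ.H j k) * X (Coord.z j) * X (Coord.zb k)) +
      ∑ j, ∑ k, invN 2 * (C (μ.B j k) * X (Coord.z j) * X (Coord.z k) +
      C (star (μ.B j k)) * X (Coord.zb j) * X (Coord.zb k)) := by
    simp only [q2, Finset.sum_add_distrib]
  rw [h, map_add]
  congr 1
  · simp only [map_sum, map_mul, cj_C, cj_X_z, cj_X_zb, μ.star_H]
    rw [Finset.sum_comm]
    exact Finset.sum_congr rfl fun j _ => Finset.sum_congr rfl fun k _ => by ring
  · simp only [map_sum, map_mul, map_add, cj_C, cj_X_z, cj_X_zb, star_star, cj_invN]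
    exact Finset.sum_congr rfl fun j _ => Finset.sum_congr rfl fun k _ => by ring

theorem q2_mem_fil : μ.q2 ∈ fil wt 2 := by
  have h : ∀ (a : A) (i i' : Coord n), wt i = 1 → wt i' = 1 → C a * X i * X i' ∈
      (fil wt 2 : Ideal (PS n A)) := fun a i i' h h' =>
    fil_mul' (k := 1) (l := 1) (Ideal.mul_mem_left _ _ (h ▸ X_mem_fil_wt i)) (h' ▸ X_mem_fil_wt i')
      le_rfl
  exact Ideal.sum_mem _ fun j _ => Ideal.sum_mem _ fun k _ => add_mem (h _ _ _ rfl rfl)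
    (Ideal.mul_mem_left _ _ (add_mem (h _ _ _ rfl rfl) (h _ _ _ rfl rfl)))

theorem du_q2 : du μ.q2 = 0 := by
  have h : ∀ (a : A) (i i' : Coord n), i ≠ Coord.u → i' ≠ Coord.u →
      du (C a * X i * X i' : PS n A) = 0 := fun a i i' h h' => by
    rw [Derivation.leibniz, Derivation.leibniz, pderiv_C, pderiv_X_of_ne h,
      pderiv_X_of_ne h', smul_zero, smul_zero, smul_zero, add_zero, smul_zero, add_zero]
  rw [q2, map_sum]
  refine Finset.sum_eq_zero fun j _ => ?_
  rw [map_sum]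
  refine Finset.sum_eq_zero fun k _ => ?_
  rw [map_add, du_invN_mul, map_add, h _ _ _ (by simp) (by simp), h _ _ _ (by simp) (by simp),
    h _ _ _ (by simp) (by simp), add_zero, mul_zero, add_zero]

theorem eul_q2 : eul μ.q2 = ∑ j, X (Coord.z j) * μ.syX j := by
  have i2 := natCast_mul_invN (n := n) (A := A) (k := 2) (by norm_num)
  push_cast at i2
  have h1 : ∀ j k, eul (C (μ.H j k) * X (Coord.z j) * X (Coord.zb k) : PS n A) =
      C (μ.H j k) * X (Coord.z j) * X (Coord.zb k) := fun j k => by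
    rw [(((isBi_C _).mul (isBi_X_z j)).mul (isBi_X_zb k)).eul, Nat.cast_one, one_mul]
  have h2 : ∀ j k, eul (invN 2 * (C (μ.B j k) * X (Coord.z j) * X (Coord.z k)) : PS n A) =
      2 * (invN 2 * (C (μ.B j k) * X (Coord.z j) * X (Coord.z k))) := fun j k => by
    rw [((isBi_invN 2).mul (((isBi_C _).mul (isBi_X_z j)).mul (isBi_X_z k))).eul]
    norm_num
  have h3 : ∀ j k, eul (invN 2 * (C (star (μ.B j k)) * X (Coord.zb j) * X (Coord.zb k)) :
      PS n A) = 0 := fun j k => by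
    rw [((isBi_invN 2).mul (((isBi_C _).mul (isBi_X_zb j)).mul (isBi_X_zb k))).eul, Nat.cast_zero,
      zero_mul]
  simp only [q2, mul_add, map_sum, map_add, h1, h2, h3, syX, sy, Finset.mul_sum, cj_X_z]
  refine Finset.sum_congr rfl fun j _ => Finset.sum_congr rfl fun k _ => ?_
  linear_combination (C (μ.B j k) * X (Coord.z j) * X (Coord.z k)) * i2

/-- Contraction with $z$ kills the antisymmetric form. What is left is the Euler derivative of a
real quadratic polynomial plus $iQ$, which explains why `q2` and $Q$ are the initial terms of $G$
and φ. -/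
theorem sum_X_linX [StarModule ℂ A] :
    ∑ j, X (Coord.z j) * μ.linX j = eul μ.q2 + im * μ.quad := by
  have h : μ.nz (fun k => X (Coord.z k)) = 0 := by
    have h0 : μ.nz (fun k => X (Coord.z k)) = - μ.nz fun k => X (Coord.z k) := by
      conv_lhs => rw [Model.nz]
      simp only [Model.nu, Model.nz, Finset.sum_mul]
      conv_lhs => rw [Finset.sum_comm]
      rw [← Finset.sum_neg_distrib]
      refine Finset.sum_congr rfl fun j _ => ?_
      rw [← Finset.sum_neg_distrib]
      refine Finset.sum_congr rfl fun k _ => ?_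
      rw [μ.N_antisymm, map_neg]
      ring
    refine natCast_mul_cancel (k := 2) (by norm_num) ?_
    push_cast
    linear_combination h0
  rw [sum_X_lin, h, eul_q2, show μ.lev (fun k => X (Coord.z k)) = μ.quad from rfl, Model.cj_quad]
  ring

/-- Maps and hypersurfaces without terms of low weight. -/
structure PreAdm (F : Fin n → PS n A) (G φ : PS n A) : Prop where
  F : ∀ j, F j ∈ fil wt 2
  G_mem : G ∈ fil wt 2
  φ_mem : φ ∈ fil wt 2
  du_G : du G ∈ fil wt 1
  du_φ : du φ ∈ fil wt 1

/-- Admissible approximate solutions. -/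
structure Adm (F : Fin n → PS n A) (G φ : PS n A) : Prop extends PreAdm F G φ where
  G : G - μ.q2 ∈ fil wt 3
  φ : φ - μ.quad ∈ fil wt 3

namespace PreAdm

variable {μ} {F : Fin n → PS n A} {G φ : PS n A} (h : PreAdm F G φ)

include h

omit [Algebra ℂ A] in
theorem comps_mem (i : Coord n) : comps F G i ∈ fil wt (wt i) :=
  comps_mem_fil (fun j => fil_mono (by norm_num) (h.F j)) h.G_mem i

omit [Algebra ℂ A] in
theorem hasSubst : HasSubst (comps F G) := hasSubst_of_mem_fil_wt h.comps_mem

omit [StarRing A] in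
theorem radial_z_sub (j : Fin n) :
    radial φ (X (Coord.z j) + F j) - X (Coord.z j) ∈ fil wt 2 := by
  have e : radial φ (X (Coord.z j) + F j) - X (Coord.z j) =
      (1 - im * du φ) * eul (F j) + im * eul φ * du (F j) - im * (du φ * X (Coord.z j)) := by
    rw [radial_add, radial_X_z, radial]
    ring
  rw [e]
  exact sub_mem (add_mem (Ideal.mul_mem_left _ _ (eul_mem_fil (h.F j))) (Ideal.mul_mem_right _ _
    (Ideal.mul_mem_left _ _ (eul_mem_fil h.φ_mem)))) (Ideal.mul_mem_left _ _
      (fil_mul h.du_φ (X_mem_fil_wt (Coord.z j))))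

omit [StarRing A] in
theorem radial_z_mem (j : Fin n) : radial φ (X (Coord.z j) + F j) ∈ fil wt 1 := by
  have := add_mem (fil_mono (by simp [wt]) (h.radial_z_sub j)) (X_mem_fil_wt (Coord.z j))
  rwa [sub_add_cancel] at this

theorem subst_linX (j : Fin n) : subst (comps F G) (μ.linX j) = μ.linX j + μ.lin F j := by
  have e : ∀ (x : Coord n), subst (comps F G) (X x : PS n A) = comps F G x := fun x =>
    subst_X h.hasSubst x
  simp only [linX, lin, cj_X_z]
  rw [← coe_substAlgHom h.hasSubst, map_sum, ← Finset.sum_add_distrib]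
  refine Finset.sum_congr rfl fun k _ => ?_
  have hC : ∀ a : A, (substAlgHom h.hasSubst) (C a : PS n A) = C a := fun a =>
    (substAlgHom h.hasSubst).commutes a
  rw [map_add, map_mul, map_mul, hC, hC, coe_substAlgHom, e, e, comps, comps]
  ring

theorem subst_sub_linX {w : PS n A} {j : Fin n} (hw : w - μ.linX j ∈ fil wt 2) :
    subst (comps F G) w - μ.linX j ∈ fil wt 2 := by
  have h1 := subst_mem_fil h.hasSubst h.comps_mem hw
  rw [subst_sub h.hasSubst, h.subst_linX] at h1
  have := add_mem h1 (μ.lin_mem_fil h.F j)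
  rwa [show ∀ a b c : PS n A, a - (b + c) + c = a - b from fun a b c => by ring] at this

/-- The terms of weight two of the transversal component of the radial equation. -/
theorem errW_sub_mem [StarModule ℂ A] {w : Fin n → PS n A}
    (hw : ∀ j, w j - μ.linX j ∈ fil wt 2) :
    errW w F G φ - (eul (G - μ.q2) + im * eul (φ - μ.quad)) ∈ fil wt 3 := by
  have e : errW w F G φ - (eul (G - μ.q2) + im * eul (φ - μ.quad)) =
      im * eul φ * du G - im * du φ * eul G -
      ∑ j, ((subst (comps F G) (w j) - μ.linX j) * radial φ (X (Coord.z j) + F j) +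
        μ.linX j * (radial φ (X (Coord.z j) + F j) - X (Coord.z j))) := by
    have h1 : ∑ j, ((subst (comps F G) (w j) - μ.linX j) * radial φ (X (Coord.z j) + F j) +
        μ.linX j * (radial φ (X (Coord.z j) + F j) - X (Coord.z j))) =
        ∑ j, subst (comps F G) (w j) * radial φ (X (Coord.z j) + F j) -
        ∑ j, X (Coord.z j) * μ.linX j := by
      rw [← Finset.sum_sub_distrib]
      exact Finset.sum_congr rfl fun j _ => by ring
    rw [h1, sum_X_linX, errW, radial_add, radial_X_u, radial, map_sub, map_sub, μ.isBi_quad.eul,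
      Nat.cast_one]
    ring
  rw [e]
  refine sub_mem (sub_mem (fil_mul (Ideal.mul_mem_left _ _ (eul_mem_fil h.φ_mem)) h.du_G)
    (fil_mul' (Ideal.mul_mem_left _ _ h.du_φ) (eul_mem_fil h.G_mem) (by omega)))
    (Ideal.sum_mem _ fun j _ => add_mem (fil_mul (h.subst_sub_linX (hw j)) (h.radial_z_mem j))
      (fil_mul' (μ.linX_mem_fil j) (h.radial_z_sub j) (by omega)))

end PreAdm

namespace Adm

variable {μ} {F F' : Fin n → PS n A} {G G' φ φ' : PS n A}

theorem of (hF : ∀ j, F j ∈ fil wt 2) (hG : G - μ.q2 ∈ fil wt 3) (hφ : φ - μ.quad ∈ fil wt 3) :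
    μ.Adm F G φ where
  F := hF
  G := hG
  φ := hφ
  G_mem := by
    have := add_mem (fil_mono (by norm_num) hG) μ.q2_mem_fil
    rwa [sub_add_cancel] at this
  φ_mem := by
    have := add_mem (fil_mono (by norm_num) hφ) μ.quad_mem_fil
    rwa [sub_add_cancel] at this
  du_G := by
    have := du_mem_fil hG
    rwa [map_sub, du_q2, sub_zero] at this
  du_φ := by
    have := du_mem_fil hφ
    rwa [map_sub, Model.du_quad, sub_zero] at this

/-- As φ equals $Q$ up to weight 3, the coefficients of the radial field are those of $T$ up to
terms that raise the weight by one more. -/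
theorem radial_sub_eulH (h : μ.Adm F G φ) {k : ℕ} {x : PS n A} (hx : x ∈ fil wt (k + 2)) :
    radial φ x - μ.eulH x ∈ fil wt (k + 3) := by
  have e : radial φ x - μ.eulH x = im * eul (φ - μ.quad) * du x - im * (du φ * eul x) := by
    rw [radial, Model.eulH_apply, map_sub, μ.isBi_quad.eul, Nat.cast_one]
    ring
  rw [e]
  exact sub_mem (fil_mul' (Ideal.mul_mem_left _ _ (eul_mem_fil h.φ)) (du_mem_fil hx) (by omega))
    (Ideal.mul_mem_left _ _ (fil_mul' h.du_φ (eul_mem_fil hx) (by omega)))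

theorem radial_mem (h : μ.Adm F G φ) {k : ℕ} {x : PS n A} (hx : x ∈ fil wt (k + 2)) :
    radial φ x ∈ fil wt (k + 2) := by
  have := add_mem (fil_mono (by omega) (h.radial_sub_eulH hx)) (μ.eulH_mem_fil hx)
  rwa [sub_add_cancel] at this

variable (h : μ.Adm F G φ) (h' : μ.Adm F' G' φ') {k : ℕ} (hF : ∀ j, F j - F' j ∈ fil wt (k + 2))
  (hG : G - G' ∈ fil wt (k + 3)) (hφ : φ - φ' ∈ fil wt (k + 3))

include h h' hF hG

theorem subst_sub_mem {l : ℕ} {p : PS n A} (hp : p ∈ fil wt l) :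
    subst (comps F G) p - subst (comps F' G') p ∈ fil wt (l + (k + 1)) :=
  subst_sub_subst_mem_fil h.hasSubst h'.hasSubst h.comps_mem h'.comps_mem
    (comps_sub_mem_fil (fun j => fil_mono (by omega) (hF j)) (fil_mono (by omega) hG)) hp

include hφ

/-- The Newton estimate: the difference of the errors is the linear operator applied to the
difference, up to one additional weight. The right-hand terms contribute nothing to the linear part
since `zb` has no constant terms. -/
theorem errB_sub {zb : Fin n → Fin n → PS n A} (hzb : ∀ k j, zb k j ∈ fil wt 1) (i : Fin n) :
    errB zb F G φ i - errB zb F' G' φ' i - μ.eulH (cj (F i - F' i)) ∈ fil wt (k + 3) := by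
  have hδu : du (φ - φ') ∈ fil wt (k + 1) := du_mem_fil hφ
  have hδe : eul (φ - φ') ∈ fil wt (k + 3) := eul_mem_fil hφ
  have hx : ∀ {l : ℕ} {x : PS n A}, eul x ∈ fil wt (l + 2) →
      radial φ x - radial φ' x ∈ fil wt (k + 3) := fun hx => by
    rw [radial_sub_radial]
    exact sub_mem (Ideal.mul_mem_right _ _ (Ideal.mul_mem_left _ _ hδe))
      (fil_mul' (Ideal.mul_mem_left _ _ hδu) hx (by omega))
  have hz : ∀ j, radial φ (X (Coord.z j) + F j) - radial φ' (X (Coord.z j) + F' j) ∈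
      fil wt (k + 2) := fun j => by
    have e : radial φ (X (Coord.z j) + F j) - radial φ' (X (Coord.z j) + F' j) =
        radial φ (F j - F' j) + (radial φ (X (Coord.z j) + F' j) -
          radial φ' (X (Coord.z j) + F' j)) := by
      simp only [radial_add, radial_sub]
      ring
    rw [e, radial_sub_radial]
    exact add_mem (h.radial_mem (hF j)) (sub_mem (Ideal.mul_mem_right _ _
      (Ideal.mul_mem_left _ _ (fil_mono (by omega) hδe))) (fil_mul' (l := 1)
      (Ideal.mul_mem_left _ _ hδu) (eul_mem_fil (add_mem (X_mem_fil_wt (Coord.z j))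
        (fil_mono (by simp) (h'.F j)))) (by omega)))
  have e : errB zb F G φ i - errB zb F' G' φ' i - μ.eulH (cj (F i - F' i)) =
      (radial φ (cj (F i - F' i)) - μ.eulH (cj (F i - F' i))) +
      (radial φ (cj (F' i)) - radial φ' (cj (F' i))) -
      ∑ j, (subst (comps F G) (zb i j) *
        (radial φ (X (Coord.z j) + F j) - radial φ' (X (Coord.z j) + F' j)) +
        (subst (comps F G) (zb i j) - subst (comps F' G') (zb i j)) *
          radial φ' (X (Coord.z j) + F' j)) := by
    simp only [errB, map_sub cj, radial_sub, mul_sub, sub_mul, Finset.sum_add_distrib,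
      Finset.sum_sub_distrib]
    ring
  rw [e]
  refine sub_mem (add_mem (h.radial_sub_eulH (cj_mem_fil (hF i)))
    (hx (l := 0) (eul_mem_fil (cj_mem_fil (h'.F i))))) (Ideal.sum_mem _ fun j _ => add_mem ?_ ?_)
  · exact fil_mul' (subst_mem_fil h.hasSubst h.comps_mem (hzb i j)) (hz j) (by omega)
  · exact fil_mul' (h.subst_sub_mem h' hF hG (hzb i j)) (h'.radial_z_mem j) (by omega)

/-- The Newton estimate for the transversal component, again with one additional weight. Unlike in
`errB_sub`, the linear part of the structure contributes at leading order and yields the last two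
sums of `lam`. -/
theorem errW_sub [StarModule ℂ A] {w : Fin n → PS n A} (hw : ∀ j, w j - μ.linX j ∈ fil wt 2) :
    errW w F G φ - errW w F' G' φ' - μ.lam (fun j => F j - F' j) (G - G') (φ - φ') ∈
      fil wt (k + 4) := by
  have hδu : du (φ - φ') ∈ fil wt (k + 1) := du_mem_fil hφ
  have hδe : eul (φ - φ') ∈ fil wt (k + 3) := eul_mem_fil hφ
  -- The extra term is of leading order. After contraction with `linX` it gives
  -- $i\,\delta\varphi_u(e(q_2)+iQ)$: the second summand completes $e(\delta\varphi)$ to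
  -- $T(\delta\varphi)$, and the first cancels the leading term of $-i\,\delta\varphi_u\,e(G')$.
  have hz : ∀ j, radial φ (X (Coord.z j) + F j) - radial φ' (X (Coord.z j) + F' j) -
      μ.eulH (F j - F' j) + im * du (φ - φ') * X (Coord.z j) ∈ fil wt (k + 3) := fun j => by
    have e : radial φ (X (Coord.z j) + F j) - radial φ' (X (Coord.z j) + F' j) -
        μ.eulH (F j - F' j) + im * du (φ - φ') * X (Coord.z j) =
        (radial φ (F j - F' j) - μ.eulH (F j - F' j)) + (radial φ (F' j) - radial φ' (F' j)) := by
      simp only [radial_add, radial_sub, radial_X_z, map_sub]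
      ring
    rw [e, radial_sub_radial]
    exact add_mem (h.radial_sub_eulH (hF j)) (sub_mem (Ideal.mul_mem_right _ _
      (Ideal.mul_mem_left _ _ hδe)) (fil_mul' (l := 2)
      (Ideal.mul_mem_left _ _ hδu) (eul_mem_fil (h'.F j)) (by omega)))
  have hlin : ∀ j, μ.lin F j - μ.lin F' j = μ.lin (fun j => F j - F' j) j := fun j => by
    simp only [lin, ← Finset.sum_sub_distrib, map_sub]
    exact Finset.sum_congr rfl fun k _ => by ring
  have hs : ∀ j, subst (comps F G) (w j) - subst (comps F' G') (w j) -
      μ.lin (fun j => F j - F' j) j ∈ fil wt (k + 3) := fun j => by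
    have h1 := h.subst_sub_mem h' hF hG (hw j)
    rw [subst_sub h.hasSubst, subst_sub h'.hasSubst, h.subst_linX, h'.subst_linX] at h1
    rw [← hlin]
    convert fil_mono (by omega : k + 3 ≤ 2 + (k + 1)) h1 using 1
    ring
  have e : errW w F G φ - errW w F' G' φ' - μ.lam (fun j => F j - F' j) (G - G') (φ - φ') =
      (radial φ (G - G') - μ.eulH (G - G')) + im * eul (φ - φ') * du G' -
      im * du (φ - φ') * eul (G' - μ.q2) -
      ∑ j, ((subst (comps F G) (w j) - subst (comps F' G') (w j) -
          μ.lin (fun j => F j - F' j) j) * radial φ' (X (Coord.z j) + F' j) +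
        μ.lin (fun j => F j - F' j) j * (radial φ' (X (Coord.z j) + F' j) - X (Coord.z j)) +
        (subst (comps F G) (w j) - μ.linX j) *
          (radial φ (X (Coord.z j) + F j) - radial φ' (X (Coord.z j) + F' j)) +
        μ.linX j * (radial φ (X (Coord.z j) + F j) - radial φ' (X (Coord.z j) + F' j) -
          μ.eulH (F j - F' j) + im * du (φ - φ') * X (Coord.z j))) := by
    have h1 : radial φ G - radial φ' G' = radial φ (G - G') + (im * eul (φ - φ') * du G' -
        im * du (φ - φ') * eul G') := by
      rw [← radial_sub_radial, radial_sub]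
      ring
    have h2 : ∑ j, ((subst (comps F G) (w j) - subst (comps F' G') (w j) -
          μ.lin (fun j => F j - F' j) j) * radial φ' (X (Coord.z j) + F' j) +
        μ.lin (fun j => F j - F' j) j * (radial φ' (X (Coord.z j) + F' j) - X (Coord.z j)) +
        (subst (comps F G) (w j) - μ.linX j) *
          (radial φ (X (Coord.z j) + F j) - radial φ' (X (Coord.z j) + F' j)) +
        μ.linX j * (radial φ (X (Coord.z j) + F j) - radial φ' (X (Coord.z j) + F' j) -
          μ.eulH (F j - F' j) + im * du (φ - φ') * X (Coord.z j))) =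
        ∑ j, subst (comps F G) (w j) * radial φ (X (Coord.z j) + F j) -
        ∑ j, subst (comps F' G') (w j) * radial φ' (X (Coord.z j) + F' j) -
        ∑ j, X (Coord.z j) * μ.lin (fun j => F j - F' j) j -
        ∑ j, μ.linX j * μ.eulH (F j - F' j) +
        im * du (φ - φ') * ∑ j, X (Coord.z j) * μ.linX j := by
      rw [Finset.mul_sum, ← Finset.sum_sub_distrib, ← Finset.sum_sub_distrib,
        ← Finset.sum_sub_distrib, ← Finset.sum_add_distrib]
      exact Finset.sum_congr rfl fun j _ => by ring
    rw [h2, sum_X_linX, errW, errW, lam, radial_add, radial_add, radial_X_u, radial_X_u,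
      Model.eulH_apply μ.toModel (φ - φ'), map_sub eul G' μ.q2]
    linear_combination h1 - im * map_sub eul φ φ'
  rw [e]
  have hm : ∀ j, radial φ (X (Coord.z j) + F j) - radial φ' (X (Coord.z j) + F' j) ∈
      fil wt (k + 2) := fun j => by
    have h1 := sub_mem (add_mem (fil_mono (by omega) (hz j)) (μ.eulH_mem_fil (hF j)))
      (fil_mul' (s := k + 2) (l := 1) (Ideal.mul_mem_left _ im hδu) (X_mem_fil_wt (Coord.z j))
        (by omega))
    convert h1 using 1
    ring
  refine sub_mem (sub_mem (add_mem (h.radial_sub_eulH (k := k + 1) hG) (fil_mul' (l := 1)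
    (Ideal.mul_mem_left _ _ hδe) h'.du_G (by omega))) (fil_mul' (Ideal.mul_mem_left _ _ hδu)
    (eul_mem_fil h'.G) (by omega))) (Ideal.sum_mem _ fun j _ => add_mem (add_mem (add_mem
      (fil_mul' (hs j) (h'.radial_z_mem j) (by omega)) (fil_mul' (μ.lin_mem_fil hF j)
        (h'.radial_z_sub j) (by omega))) (fil_mul' (h.subst_sub_linX (hw j)) (hm j) (by omega)))
      (fil_mul' (μ.linX_mem_fil j) (hz j) (by omega)))

end Adm

end LinModel

end FormalCR

/-! ### Successive approximation for the radial equations -/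

namespace FormalCR

open MvPowerSeries

namespace LinModel

variable {n : ℕ} {A : Type*} [CommRing A] [StarRing A] [Algebra ℂ A] (μ : LinModel n A)

/-- The normalization conditions on the solutions of the radial equations. -/
structure Start (s : A) (F : Fin n → PS n A) (G φ : PS n A) : Prop where
  normal : μ.Normal F (G - μ.q2 - C s * X Coord.u ^ 2) (φ - μ.quad)
  adm : μ.Adm F G φ

/-- The normalized solutions of the radial equations. -/
structure Sol (zb : Fin n → Fin n → PS n A) (w : Fin n → PS n A) (s : A) (F : Fin n → PS n A)
    (G φ : PS n A) : Prop extends μ.Start s F G φ where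
  errB : ∀ k, errB zb F G φ k = 0
  errW : errW w F G φ = 0

variable {μ}

theorem Start.sub_normal {s : A} {F F' : Fin n → PS n A} {G G' φ φ' : PS n A}
    (h : μ.Start s F G φ) (h' : μ.Start s F' G' φ') :
    μ.Normal (fun j => F j - F' j) (G - G') (φ - φ') := by
  have := Normal.sub μ h.normal h'.normal
  rwa [sub_sub_sub_cancel_right, sub_sub_sub_cancel_right, sub_sub_sub_cancel_right] at this

theorem Start.of_sub {s : A} {F δF : Fin n → PS n A} {G δG φ δφ : PS n A}
    (h : μ.Start s F G φ) (h' : μ.Normal δF δG δφ) (hF : ∀ j, δF j ∈ fil wt 2)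
    (hG : δG ∈ fil wt 3) (hφ : δφ ∈ fil wt 3) :
    μ.Start s (fun j => F j - δF j) (G - δG) (φ - δφ) := by
  have e : ∀ a b c d : PS n A, a - b - c - d = a - d - b - c := fun a b c d => by ring
  have e' : ∀ a b d : PS n A, a - b - d = a - d - b := fun a b d => by ring
  refine ⟨?_, Adm.of (fun j => sub_mem (h.adm.F j) (hF j)) ?_ ?_⟩
  · have := Normal.sub μ h.normal h'
    rwa [e, e' φ] at this
  · rw [← e']
    exact sub_mem h.adm.G hG
  · rw [← e']
    exact sub_mem h.adm.φ hφ

variable [StarModule ℂ A] (μ)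

omit [StarModule ℂ A] in
-- The starting point consists of the forced terms of weight two and the prescribed $su^2$; every
-- correction leaves these unchanged.
theorem start_base (s : A) :
    μ.Start s (fun _ => 0) (μ.q2 + C s * X Coord.u ^ 2) μ.quad := by
  refine ⟨?_, Adm.of (fun _ => Ideal.zero_mem _) ?_ ?_⟩
  · rw [add_sub_cancel_left, sub_self, sub_self]
    exact ⟨map_zero _, map_zero _, ⟨fun _ => map_zero _, map_zero _, fun _ => map_zero _,
      by rw [map_zero, Model.tr_zero], by rw [map_zero, Model.tr_zero, Model.tr_zero],
      by rw [map_zero, Model.tr_zero, Model.tr_zero, Model.tr_zero]⟩, fun _ => map_zero _,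
      map_zero _⟩
  · rw [add_sub_cancel_left]
    refine Ideal.mul_mem_left _ _ (fil_mono (by simp [wt]) (fil_pow (X_mem_fil_wt Coord.u) 2))
  · rw [sub_self]
    exact Ideal.zero_mem _

variable {μ} {zb : Fin n → Fin n → PS n A} {w : Fin n → PS n A}
  (hzb : ∀ k j, zb k j ∈ fil wt 1) (hw : ∀ j, w j - μ.linX j ∈ fil wt 2)

omit [StarModule ℂ A] in
include hzb in
theorem errB_mem {F : Fin n → PS n A} {G φ : PS n A} (h : μ.Adm F G φ) (k : Fin n) :
    errB zb F G φ k ∈ fil wt 2 :=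
  sub_mem (h.radial_mem (k := 0) (cj_mem_fil (h.F k))) (Ideal.sum_mem _ fun j _ =>
    fil_mul' (subst_mem_fil h.hasSubst h.comps_mem (hzb k j)) (h.radial_z_mem j) le_rfl)

include hw in
theorem errW_mem {F : Fin n → PS n A} {G φ : PS n A} (h : μ.Adm F G φ) :
    errW w F G φ ∈ fil wt 3 := by
  have := add_mem (h.errW_sub_mem hw) (add_mem (eul_mem_fil h.G) (Ideal.mul_mem_left _ im
    (eul_mem_fil h.φ)))
  rwa [sub_add_cancel] at this

include hzb hw in
/-- One step of the successive approximation. -/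
theorem exists_step (hn : 0 < n) {s : A} {F : Fin n → PS n A} {G φ : PS n A}
    (h : μ.Start s F G φ) {k : ℕ} (hB : ∀ j, errB zb F G φ j ∈ fil wt (k + 2))
    (hW : errW w F G φ ∈ fil wt (k + 3)) :
    ∃ (F' : Fin n → PS n A) (G' φ' : PS n A), μ.Start s F' G' φ' ∧
      (∀ j, errB zb F' G' φ' j ∈ fil wt (k + 3)) ∧ errW w F' G' φ' ∈ fil wt (k + 4) ∧
      (∀ j, F j - F' j ∈ fil wt (k + 2)) ∧ G - G' ∈ fil wt (k + 3) ∧ φ - φ' ∈ fil wt (k + 3) := by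
  obtain ⟨δF, δG, δφ, hδ, hp, hq, hF, hG, hφ⟩ := μ.linear_exists hn (k := k + 1)
    (errB_mem_fil_zw zb F G φ) hB (errW_mem_fil_zw w F G φ) hW
  have h' := h.of_sub hδ (fun j => fil_mono (by omega) (hF j)) (fil_mono (by omega) hG)
    (fil_mono (by omega) hφ)
  have eF : ∀ j, F j - (F j - δF j) = δF j := fun j => sub_sub_cancel _ _
  have hF' : ∀ j, F j - (F j - δF j) ∈ fil wt (k + 2) := fun j => (eF j).symm ▸ hF j
  have hG' : G - (G - δG) ∈ fil wt (k + 3) := (sub_sub_cancel G δG).symm ▸ hG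
  have hφ' : φ - (φ - δφ) ∈ fil wt (k + 3) := (sub_sub_cancel φ δφ).symm ▸ hφ
  refine ⟨_, _, _, h', fun j => ?_, ?_, hF', hG', hφ'⟩
  · have h1 := h.adm.errB_sub h'.adm hF' hG' hφ' hzb j
    rw [eF, hp, sub_right_comm, sub_self, zero_sub] at h1
    exact neg_mem_iff.mp h1
  · have h1 := h.adm.errW_sub h'.adm hF' hG' hφ' hw
    simp only [sub_sub_cancel] at h1
    rw [hq, sub_right_comm, sub_self, zero_sub] at h1
    exact neg_mem_iff.mp h1

include hzb hw in
-- Each step solves the linear system for the current errors and gains one weight, so the iterates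
-- converge. The normalization conditions are closed for the filtration and pass to the limit, and
-- the Newton estimates show that the errors of the limit vanish.
theorem exists_sol (hn : 0 < n) (s : A) :
    ∃ (F : Fin n → PS n A) (G φ : PS n A), μ.Sol zb w s F G φ := by
  let T := (Fin n → PS n A) × PS n A × PS n A
  let P : ℕ → T → Prop := fun k x => μ.Start s x.1 x.2.1 x.2.2 ∧
    (∀ j, errB zb x.1 x.2.1 x.2.2 j ∈ fil wt (k + 2)) ∧ errW w x.1 x.2.1 x.2.2 ∈ fil wt (k + 3)
  have h0 : P 0 (fun _ => 0, μ.q2 + C s * X Coord.u ^ 2, μ.quad) :=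
    ⟨μ.start_base s, errB_mem hzb (μ.start_base s).adm, errW_mem hw (μ.start_base s).adm⟩
  have hstep : ∀ k (x : {x // P k x}), ∃ y : {y // P (k + 1) y},
      (∀ j, x.1.1 j - y.1.1 j ∈ fil wt (k + 2)) ∧ x.1.2.1 - y.1.2.1 ∈ fil wt (k + 3) ∧
        x.1.2.2 - y.1.2.2 ∈ fil wt (k + 3) := by
    rintro k ⟨⟨F, G, φ⟩, h, hB, hW⟩
    obtain ⟨F', G', φ', h', hB', hW', hd⟩ := exists_step hzb hw hn h hB hW
    exact ⟨⟨(F', G', φ'), h', hB', hW'⟩, hd⟩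
  choose next hnext using hstep
  let x : ∀ k, {x // P k x} := fun k => Nat.rec ⟨_, h0⟩ (fun k x => next k x) k
  have hx : ∀ k, x (k + 1) = next k (x k) := fun k => rfl
  obtain ⟨F, hF⟩ := exists_fil_limit_add wt (fun k => (x k).1.1) 2 fun k i => by
    rw [hx, ← neg_sub]
    exact neg_mem ((hnext k (x k)).1 i)
  obtain ⟨Gφ, hGφ⟩ := exists_fil_limit_add wt (fun k (b : Bool) => cond b (x k).1.2.1 (x k).1.2.2)
    3 fun k b => by
      rw [hx, ← neg_sub]
      cases b
      · exact neg_mem (hnext k (x k)).2.2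
      · exact neg_mem (hnext k (x k)).2.1
  have hG := fun k => hGφ k true
  have hφ := fun k => hGφ k false
  simp only [cond_true, cond_false] at hG hφ
  generalize Gφ true = G at hG
  generalize Gφ false = φ at hφ
  have heq : ∀ {y : PS n A}, (∀ k, y ∈ fil wt (k + 2)) → y = 0 := fun h =>
    eq_zero_of_forall_fil (w := wt) fun k => fil_mono (by omega) (h k)
  have hadm : μ.Adm F G φ := by
    have h1 := (x 0).2.1.adm
    refine Adm.of (fun j => ?_) ?_ ?_
    · have := add_mem (hF 0 j) (fil_mono (by omega) (h1.F j))
      rwa [sub_add_cancel] at this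
    · have := add_mem (hG 0) (fil_mono (by omega) h1.G)
      rwa [sub_add_sub_cancel] at this
    · have := add_mem (hφ 0) (fil_mono (by omega) h1.φ)
      rwa [sub_add_sub_cancel] at this
  have hN : μ.Normal F (G - μ.q2 - C s * X Coord.u ^ 2) (φ - μ.quad) := by
    have hF2 : ∀ k j, ∃ ε ∈ fil wt (k + 3), F j = (x (k + 1)).1.1 j + ε := fun k j =>
      ⟨_, hF (k + 1) j, by ring⟩
    have hG2 : ∀ k, ∃ ε ∈ fil wt (k + 3), G - μ.q2 - C s * X Coord.u ^ 2 =
        (x k).1.2.1 - μ.q2 - C s * X Coord.u ^ 2 + ε := fun k => ⟨_, hG k, by ring⟩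
    -- The precision is higher than for the other unknowns because three traces lower the weight by
    -- 6.
    have hφ2 : ∀ k, ∃ ε ∈ fil wt (k + 8), φ - μ.quad = (x (k + 5)).1.2.2 - μ.quad + ε := fun k =>
      ⟨_, hφ (k + 5), by ring⟩
    have hn : ∀ k, μ.Normal (x k).1.1 _ _ := fun k => (x k).2.1.normal
    refine ⟨?_, ?_, ⟨fun a => ?_, ?_, fun a => ?_, ?_, ?_, ?_⟩, fun j => ?_, ?_⟩
    · rw [← sub_eq_zero]
      refine heq fun k => ?_
      obtain ⟨ε, hε, e⟩ := hG2 k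
      rw [e, map_add, (hn k).cj_G, add_sub_add_left_eq_sub]
      exact fil_mono (by omega) (sub_mem (cj_mem_fil hε) hε)
    · rw [← sub_eq_zero]
      refine heq fun k => ?_
      obtain ⟨ε, hε, e⟩ := hφ2 k
      rw [e, map_add, (hn (k + 5)).cj_φ, add_sub_add_left_eq_sub]
      exact fil_mono (by omega) (sub_mem (cj_mem_fil hε) hε)
    · refine heq fun k => ?_
      obtain ⟨ε, hε, e⟩ := hφ2 k
      rw [e, map_add, (hn (k + 5)).norm.pure, zero_add]
      exact fil_mono (by omega) (proj_mem_fil hε _ _)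
    · refine heq fun k => ?_
      obtain ⟨ε, hε, e⟩ := hφ2 k
      rw [e, map_add, (hn (k + 5)).norm.one_one, zero_add]
      exact fil_mono (by omega) (proj_mem_fil hε _ _)
    · refine heq fun k => ?_
      obtain ⟨ε, hε, e⟩ := hφ2 k
      rw [e, map_add, (hn (k + 5)).norm.deg_one, zero_add]
      exact fil_mono (by omega) (proj_mem_fil hε _ _)
    · refine heq fun k => ?_
      obtain ⟨ε, hε, e⟩ := hφ2 k
      rw [e, map_add, Model.tr_add, (hn (k + 5)).norm.tr_two_two, zero_add]
      exact fil_mono (by omega) (μ.tr_mem_fil (k := k + 6) (proj_mem_fil hε _ _))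
    · refine heq fun k => ?_
      obtain ⟨ε, hε, e⟩ := hφ2 k
      rw [e, map_add, Model.tr_add, Model.tr_add, (hn (k + 5)).norm.tr_three_two, zero_add]
      exact fil_mono (by omega) (μ.tr_mem_fil (k := k + 4)
        (μ.tr_mem_fil (k := k + 6) (proj_mem_fil hε _ _)))
    · refine heq fun k => ?_
      obtain ⟨ε, hε, e⟩ := hφ2 k
      rw [e, map_add, Model.tr_add, Model.tr_add, Model.tr_add, (hn (k + 5)).norm.tr_three_three,
        zero_add]
      exact fil_mono (by omega) (μ.tr_mem_fil (k := k + 2) (μ.tr_mem_fil (k := k + 4)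
        (μ.tr_mem_fil (k := k + 6) (proj_mem_fil hε _ _))))
    · obtain ⟨ε, hε, e⟩ := hF2 0 j
      rw [e, map_add, (hn (0 + 1)).F_u, zero_add]
      exact hε _ (by rw [Finsupp.weight_single]; simp [wt])
    · obtain ⟨ε, hε, e⟩ := hG2 2
      rw [e, map_add, (hn 2).G_u, zero_add]
      exact hε _ (by rw [Finsupp.weight_single]; simp [wt])
  refine ⟨F, G, φ, ⟨hN, hadm⟩, fun j => heq fun k => ?_, heq fun k => ?_⟩
  · have h1 := hadm.errB_sub (x k).2.1.adm (hF k) (hG k) (hφ k) hzb j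
    have h2 := add_mem (add_mem (fil_mono (by omega) h1) (μ.eulH_mem_fil (cj_mem_fil (hF k j))))
      ((x k).2.2.1 j)
    rwa [sub_add_cancel, sub_add_cancel] at h2
  · have h1 := hadm.errW_sub (x k).2.1.adm (hF k) (hG k) (hφ k) hw
    have h3 : μ.lam (fun j => F j - (x k).1.1 j) (G - (x k).1.2.1) (φ - (x k).1.2.2) ∈
        fil wt (k + 2) := by
      refine sub_mem (sub_mem (add_mem (μ.eulH_mem_fil (fil_mono (by omega) (hG k)))
        (Ideal.mul_mem_left _ _ (μ.eulH_mem_fil (fil_mono (by omega) (hφ k))))) ?_) ?_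
      · exact Ideal.sum_mem _ fun j _ => Ideal.mul_mem_left _ _ (μ.lin_mem_fil (hF k) j)
      · exact Ideal.sum_mem _ fun j _ => Ideal.mul_mem_left _ _ (μ.eulH_mem_fil (hF k j))
    have h2 := add_mem (add_mem (fil_mono (by omega) h1) h3) (fil_mono (by omega) (x k).2.2.2)
    rwa [sub_add_cancel, sub_add_cancel] at h2

include hzb hw in
-- If two solutions agree up to some weight, the Newton estimates make their difference an
-- approximate solution of the homogeneous linear system to one weight more, and `linear_small`
-- transfers this gain to the difference itself.
theorem sol_unique (hn : 0 < n) {s : A} {F F' : Fin n → PS n A} {G G' φ φ' : PS n A}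
    (h : μ.Sol zb w s F G φ) (h' : μ.Sol zb w s F' G' φ') : F = F' ∧ G = G' ∧ φ = φ' := by
  have key : ∀ k, (∀ j, F j - F' j ∈ fil wt (k + 2)) ∧ G - G' ∈ fil wt (k + 3) ∧
      φ - φ' ∈ fil wt (k + 3) := by
    intro k
    induction k with
    | zero =>
      refine ⟨fun j => sub_mem (h.adm.F j) (h'.adm.F j), ?_, ?_⟩
      · have := sub_mem h.adm.G h'.adm.G
        rwa [sub_sub_sub_cancel_right] at this
      · have := sub_mem h.adm.φ h'.adm.φ
        rwa [sub_sub_sub_cancel_right] at this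
    | succ k ih =>
      obtain ⟨hF, hG, hφ⟩ := ih
      refine μ.linear_small hn (k := k + 2) (by omega) (h.sub_normal h'.toStart)
        (fun j => fil_mono (by omega) (hF j)) (fil_mono (by omega) hG) (fil_mono (by omega) hφ)
        (fun j => ?_) ?_
      · have h1 := h.adm.errB_sub h'.adm hF hG hφ hzb j
        rw [h.errB, h'.errB, sub_self, zero_sub] at h1
        exact neg_mem_iff.mp h1
      · have h1 := h.adm.errW_sub h'.adm hF hG hφ hw
        rw [h.errW, h'.errW, sub_self, zero_sub] at h1
        exact neg_mem_iff.mp h1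
  have heq : ∀ {y z : PS n A}, (∀ k, y - z ∈ fil wt (k + 2)) → y = z := fun h =>
    sub_eq_zero.mp (eq_zero_of_forall_fil (w := wt) fun k => fil_mono (by omega) (h k))
  exact ⟨funext fun j => heq fun k => (key k).1 j, heq fun k => fil_mono (by omega) (key k).2.1,
    heq fun k => fil_mono (by omega) (key k).2.2⟩

end LinModel

end FormalCR

/-! ### Inverses of real formal maps -/

namespace FormalCR

open MvPowerSeries

section ConjSubst

variable {n : ℕ} {A : Type*} [CommRing A] [StarRing A]

theorem cj_mem_fil_one {k : ℕ} {p : PS n A} (hp : p ∈ fil (fun _ => 1) k) :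
    cj p ∈ fil (fun _ => 1) k := fun m hm => by
  rw [coeff_cj, hp _ (by rwa [weight_bar]), star_zero]

/-- Conjugation is compatible with substitution. -/
theorem cj_subst {a : Coord n → PS n A} (ha : ∀ i, a i ∈ fil (fun _ => 1) 1) (p : PS n A) :
    cj (subst a p) = subst (fun i => cj (a (Coord.bar i))) (cj p) := by
  classical
  have hb : ∀ i, cj (a (Coord.bar i)) ∈ fil (fun _ : Coord n => 1) 1 := fun i =>
    cj_mem_fil_one (ha _)
  have hsa := hasSubst_of_mem_fil ha
  have hsb := hasSubst_of_mem_fil hb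
  have hpoly : ∀ q : MvPolynomial (Coord n) A, cj (subst a (q : PS n A)) =
      subst (fun i => cj (a (Coord.bar i))) (cj (q : PS n A)) := by
    intro q
    rw [← coe_substAlgHom hsa, ← coe_substAlgHom hsb]
    induction q using MvPolynomial.induction_on with
    | C r =>
      rw [MvPolynomial.coe_C, cj_C]
      exact (congrArg cj ((substAlgHom hsa).commutes r)).trans
        ((cj_C r).trans ((substAlgHom hsb).commutes (star r)).symm)
    | add p q hp hq => rw [MvPolynomial.coe_add, map_add, map_add, map_add, map_add, hp, hq]
    | mul_X p i hp =>
      rw [MvPolynomial.coe_mul, map_mul, map_mul, map_mul, map_mul, hp, MvPolynomial.coe_X,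
        cj_X, substAlgHom_X, substAlgHom_X]
      congr 3
      rcases i with j | j | j <;> rfl
  rw [← sub_eq_zero]
  refine eq_zero_of_forall_fil (w := fun _ => 1) fun k => ?_
  obtain ⟨q, hq⟩ := exists_polynomial_sub_mem_fil p k
  have e : cj (subst a p) - subst (fun i => cj (a (Coord.bar i))) (cj p) =
      cj (subst a (p - (q : PS n A))) -
        subst (fun i => cj (a (Coord.bar i))) (cj (p - (q : PS n A))) := by
    rw [subst_sub hsa, map_sub, map_sub, subst_sub hsb, hpoly]
    ring
  rw [e]
  exact sub_mem (cj_mem_fil_one (subst_mem_fil hsa ha hq))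
    (subst_mem_fil hsb hb (cj_mem_fil_one hq))

omit [StarRing A] in
theorem mem_fil_one_of_sub_X {i : Coord n} {p : PS n A} (h : p - X i ∈ fil (fun _ => 1) 2) :
    p ∈ fil (fun _ => 1) 1 := by
  have := add_mem (fil_mono (by norm_num) h) (X_mem_fil (w := fun _ : Coord n => 1) i)
  rwa [sub_add_cancel] at this

theorem comps_sub_X_mem_fil {F : Fin n → PS n A} {G : PS n A} {k : ℕ}
    (hF : ∀ j, F j ∈ fil (fun _ => 1) k) (hG : G ∈ fil (fun _ => 1) k) (i : Coord n) :
    comps F G i - X i ∈ fil (fun _ => 1) k := by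
  rcases i with j | j | j
  · rw [comps, add_sub_cancel_left]
    exact hF j
  · rw [comps, add_sub_cancel_left]
    exact cj_mem_fil_one (hF j)
  · rw [comps, add_sub_cancel_left]
    exact hG

theorem cj_comps {F : Fin n → PS n A} {G : PS n A} (hG : cj G = G) (i : Coord n) :
    cj (comps F G (Coord.bar i)) = comps F G i := by
  rcases i with j | j | j
  · change cj (X (Coord.zb j) + cj (F j)) = _
    rw [map_add, cj_X_zb, cj_cj]
    rfl
  · change cj (X (Coord.z j) + F j) = _
    rw [map_add, cj_X_z]
    rfl
  · change cj (X Coord.u + G) = _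
    rw [map_add, cj_X_u, hG]
    rfl

/-- The map `comps F G` is inverse to `comps f g`. -/
structure IsInv (f : Fin n → PS n A) (g : PS n A) (F : Fin n → PS n A) (G : PS n A) : Prop where
  f_mem : ∀ j, f j ∈ fil (fun _ => 1) 2
  g_mem : g ∈ fil (fun _ => 1) 2
  F_mem : ∀ j, F j ∈ fil (fun _ => 1) 2
  G_mem : G ∈ fil (fun _ => 1) 2
  cj_g : cj g = g
  cj_G : cj G = G
  right : ∀ i, subst (comps F G) (comps f g i) = X i
  left : ∀ i, subst (comps f g) (comps F G i) = X i

theorem IsInv.symm {f F : Fin n → PS n A} {g G : PS n A} (h : IsInv f g F G) : IsInv F G f g :=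
  ⟨h.F_mem, h.G_mem, h.f_mem, h.g_mem, h.cj_G, h.cj_g, h.left, h.right⟩

/-- The conjugate of an inverse of a real map is again an inverse. Uniqueness of the inverse then
forces it to be real, so it is given by functions `F` and `G` with $G$ real. -/
theorem exists_isInv {f : Fin n → PS n A} {g : PS n A} (hf : ∀ j, f j ∈ fil (fun _ => 1) 2)
    (hg : g ∈ fil (fun _ => 1) 2) (hr : cj g = g) : ∃ F G, IsInv f g F G := by
  classical
  have ha := comps_sub_X_mem_fil hf hg
  obtain ⟨b, hb, hab⟩ := exists_right_inverse (comps f g) ha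
  have hb1 : ∀ i, b i ∈ fil (fun _ => 1) 1 := fun i => mem_fil_one_of_sub_X (hb i)
  have hba := subst_inverse hb hab
  set b' : Coord n → PS n A := fun i => cj (b (Coord.bar i)) with hb'
  have hb'1 : ∀ i, b' i ∈ fil (fun _ => 1) 1 := fun i => cj_mem_fil_one (hb1 _)
  have hab' : ∀ i, subst b' (comps f g i) = X i := fun i => by
    have h := congrArg cj (hab (Coord.bar i))
    rw [cj_subst hb1, cj_comps hr, cj_X] at h
    rw [h]
    rcases i with j | j | j <;> rfl
  have hbb : ∀ i, b' i = b i := fun i => by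
    have ha1 : HasSubst (comps f g) :=
      hasSubst_of_mem_fil fun i => mem_fil_one_of_sub_X (ha i)
    have h := congrArg (subst b') (hba i)
    rw [subst_comp_subst_apply ha1 (hasSubst_of_mem_fil hb'1),
      subst_X (hasSubst_of_mem_fil hb'1)] at h
    rw [← h, show (fun s => subst b' (comps f g s)) = X from funext hab', subst_self]
    rfl
  have hcomp : b = comps (fun j => b (Coord.z j) - X (Coord.z j)) (b Coord.u - X Coord.u) := by
    funext i
    rcases i with j | j | j
    · rw [comps]
      ring
    · rw [comps, map_sub, cj_X_z, ← hbb]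
      change cj (b (Coord.z j)) = _
      ring
    · rw [comps]
      ring
  refine ⟨fun j => b (Coord.z j) - X (Coord.z j), b Coord.u - X Coord.u,
    ⟨hf, hg, fun j => hb _, hb _, hr, ?_, ?_, ?_⟩⟩
  · rw [map_sub, cj_X_u]
    exact congrArg (· - X Coord.u) (hbb Coord.u)
  · rw [← hcomp]
    exact hab
  · rw [← hcomp]
    exact hba

namespace IsInv

variable {f F : Fin n → PS n A} {g G : PS n A} (h : IsInv f g F G)

include h

theorem mem (i : Coord n) : comps f g i ∈ fil (fun _ => 1) 1 :=
  mem_fil_one_of_sub_X (comps_sub_X_mem_fil h.f_mem h.g_mem i)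

theorem hasSubst : HasSubst (comps f g) := hasSubst_of_mem_fil h.mem

theorem subst_subst (p : PS n A) : subst (comps F G) (subst (comps f g) p) = p := by
  rw [subst_comp_subst_apply h.hasSubst h.symm.hasSubst,
    show (fun s => subst (comps F G) (comps f g s)) = X from funext h.right, subst_self]
  rfl

/-- The inverse map has the opposite terms of degree two. -/
theorem add_mem_fil : g + G ∈ fil (fun _ => 1) 3 := by
  have h1 := h.right Coord.u
  rw [comps, subst_add h.symm.hasSubst, subst_X h.symm.hasSubst, comps] at h1
  have h2 : subst (comps F G) g - subst X g ∈ fil (fun _ => 1) (2 + 1) :=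
    subst_sub_subst_mem_fil h.symm.hasSubst HasSubst.X h.symm.mem
      (fun i => X_mem_fil (w := fun _ : Coord n => 1) i)
      (comps_sub_X_mem_fil h.F_mem h.G_mem) h.g_mem
  rw [subst_self, id] at h2
  have e : g + G = -(subst (comps F G) g - g) := by linear_combination h1
  rw [e]
  exact neg_mem h2

end IsInv

end ConjSubst

end FormalCR

/-! ### Change of the coefficient algebra -/

namespace FormalCR

open MvPowerSeries

section Naturality

variable {n : ℕ} {A B : Type*} [CommRing A] [StarRing A] [Algebra ℂ A] [CommRing B] [StarRing B]
  [Algebra ℂ B] (e : A →⋆ₐ[ℂ] B)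

/-- Application of a homomorphism to the coefficients of a power series. -/
noncomputable def pmap : PS n A →+* PS n B := MvPowerSeries.map (RingHomClass.toRingHom e)

theorem coeff_pmap (m : MIdx n) (p : PS n A) : coeff m (pmap e p) = e (coeff m p) := rfl

theorem pmap_X (i : Coord n) : pmap e (X i) = X i := MvPowerSeries.map_X _ i

theorem pmap_C (a : A) : pmap e (C a : PS n A) = C (e a) := MvPowerSeries.map_C _ a

theorem pmap_im : pmap e (im : PS n A) = im := by
  rw [im, pmap_C, AlgHomClass.commutes, im]

theorem pmap_invN (k : ℕ) : pmap e (invN k : PS n A) = invN k := by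
  rw [invN, pmap_C, AlgHomClass.commutes, invN]

theorem pmap_cj (p : PS n A) : pmap e (cj p) = cj (pmap e p) := by
  ext m
  rw [coeff_pmap, coeff_cj, coeff_cj, coeff_pmap, map_star]

theorem pmap_pderiv (i : Coord n) (p : PS n A) : pmap e (pderiv A i p) = pderiv B i (pmap e p) := by
  ext m
  rw [coeff_pmap, coeff_pderiv, coeff_pderiv, coeff_pmap, map_mul, map_add, map_natCast, map_one]

theorem pmap_eul (p : PS n A) : pmap e (eul p) = eul (pmap e p) := by
  simp only [eul_apply, map_sum, map_mul, pmap_X, pmap_pderiv]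

theorem pmap_proj (a b : ℕ) (p : PS n A) : pmap e (proj a b p) = proj a b (pmap e p) := by
  ext m
  rw [coeff_pmap, coeff_proj, coeff_proj, coeff_pmap]
  split_ifs
  · rfl
  · exact map_zero _

theorem pmap_mem_fil {w : Coord n → ℕ} {k : ℕ} {p : PS n A} (h : p ∈ fil w k) :
    pmap e p ∈ fil w k := fun m hm => by
  rw [coeff_pmap, h m hm, map_zero]

theorem pmap_subst {a : Coord n → PS n A} (ha : HasSubst a) (p : PS n A) :
    pmap e (subst a p) = subst (fun i => pmap e (a i)) (pmap e p) := map_subst ha p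

theorem pmap_comps (F : Fin n → PS n A) (G : PS n A) (i : Coord n) :
    pmap e (comps F G i) = comps (fun j => pmap e (F j)) (pmap e G) i := by
  rcases i with j | j | j
  · rw [comps, map_add, pmap_X, comps]
  · rw [comps, map_add, pmap_X, pmap_cj, comps]
  · rw [comps, map_add, pmap_X, comps]

theorem pmap_subst_comps {F : Fin n → PS n A} {G : PS n A} (h : HasSubst (comps F G))
    (p : PS n A) : pmap e (subst (comps F G) p) =
      subst (comps (fun j => pmap e (F j)) (pmap e G)) (pmap e p) := by
  rw [pmap_subst e h]
  congr 1
  exact funext (pmap_comps e F G)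

theorem pmap_radial (φ x : PS n A) : pmap e (radial φ x) = radial (pmap e φ) (pmap e x) := by
  simp only [radial, map_add, map_sub, map_mul, map_one, pmap_im, pmap_eul, pmap_pderiv]

theorem pmap_errB {zb : Fin n → Fin n → PS n A} {F : Fin n → PS n A} {G : PS n A}
    (h : HasSubst (comps F G)) (φ : PS n A) (k : Fin n) : pmap e (errB zb F G φ k) =
      errB (fun k j => pmap e (zb k j)) (fun j => pmap e (F j)) (pmap e G) (pmap e φ) k := by
  simp only [errB, map_sub, map_sum, map_mul, pmap_radial, pmap_subst_comps e h, map_add, pmap_X,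
    pmap_cj]

theorem pmap_errW {w : Fin n → PS n A} {F : Fin n → PS n A} {G : PS n A}
    (h : HasSubst (comps F G)) (φ : PS n A) : pmap e (errW w F G φ) =
      errW (fun j => pmap e (w j)) (fun j => pmap e (F j)) (pmap e G) (pmap e φ) := by
  simp only [errW, map_sub, map_sum, map_mul, pmap_radial, pmap_subst_comps e h, map_add, pmap_X]

theorem IsInv.map {f F : Fin n → PS n A} {g G : PS n A} (h : IsInv f g F G) :
    IsInv (fun j => pmap e (f j)) (pmap e g) (fun j => pmap e (F j)) (pmap e G) where
  f_mem j := pmap_mem_fil e (h.f_mem j)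
  g_mem := pmap_mem_fil e h.g_mem
  F_mem j := pmap_mem_fil e (h.F_mem j)
  G_mem := pmap_mem_fil e h.G_mem
  cj_g := by rw [← pmap_cj, h.cj_g]
  cj_G := by rw [← pmap_cj, h.cj_G]
  right i := by rw [← pmap_comps, ← pmap_subst_comps e h.symm.hasSubst, h.right, pmap_X]
  left i := by rw [← pmap_comps, ← pmap_subst_comps e h.hasSubst, h.left, pmap_X]

/-- The homomorphism `e` maps the data of `μ` to the data of `ν`. -/
structure LinModel.Maps (μ : LinModel n A) (ν : LinModel n B) : Prop where
  c : ∀ j k, e (μ.c j k) = ν.c j k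
  H : ∀ j k, e (μ.H j k) = ν.H j k
  B : ∀ j k, e (μ.B j k) = ν.B j k

namespace LinModel

variable {e} {μ : LinModel n A} {ν : LinModel n B} (h : μ.Maps e ν)

include h

/-- Inverse matrices are unique, so compatibility with `c` suffices. The data `N` and `S` do not
occur in the equations and normalizations that define a solution. -/
theorem Maps.d (j k : Fin n) : e (μ.d j k) = ν.d j k := by
  have hc : μ.c.map e = ν.c := by
    ext j k
    exact h.c j k
  have h1 : ν.c * μ.d.map e = 1 := by
    have h2 := congrArg (fun M => (RingHomClass.toRingHom e).mapMatrix M) μ.c_mul_d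
    simp only [map_mul, map_one] at h2
    rw [← hc]
    exact h2
  have h3 : μ.d.map e = ν.d := by
    calc μ.d.map e = (ν.d * ν.c) * μ.d.map e := by rw [ν.d_mul_c, one_mul]
      _ = ν.d := by rw [mul_assoc, h1, mul_one]
  exact congrFun (congrFun h3 j) k

theorem Maps.tr (p : PS n A) : pmap e (μ.tr p) = ν.tr (pmap e p) := by
  simp only [Model.tr, map_sum, map_mul, pmap_C, h.d, pmap_pderiv]

theorem Maps.quad : pmap e μ.quad = ν.quad := by
  simp only [Model.quad, Model.beta, map_sum, map_mul, pmap_C, pmap_X, h.c]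

theorem Maps.q2 : pmap e μ.q2 = ν.q2 := by
  simp only [LinModel.q2, map_sum, map_mul, map_add, pmap_C, pmap_X, pmap_invN, h.H, h.B, map_star]

theorem Maps.norm {φ : PS n A} (hφ : μ.Norm φ) : ν.Norm (pmap e φ) where
  pure a := by rw [← pmap_proj, hφ.pure, map_zero]
  one_one := by rw [← pmap_proj, hφ.one_one, map_zero]
  deg_one a := by rw [← pmap_proj, hφ.deg_one, map_zero]
  tr_two_two := by rw [← pmap_proj, ← h.tr, hφ.tr_two_two, map_zero]
  tr_three_two := by rw [← pmap_proj, ← h.tr, ← h.tr, hφ.tr_three_two, map_zero]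
  tr_three_three := by rw [← pmap_proj, ← h.tr, ← h.tr, ← h.tr, hφ.tr_three_three, map_zero]

theorem Maps.normal {F : Fin n → PS n A} {G φ : PS n A} (hN : μ.Normal F G φ) :
    ν.Normal (fun j => pmap e (F j)) (pmap e G) (pmap e φ) where
  cj_G := by rw [← pmap_cj, hN.cj_G]
  cj_φ := by rw [← pmap_cj, hN.cj_φ]
  norm := h.norm hN.norm
  F_u j := by rw [coeff_pmap, hN.F_u, map_zero]
  G_u := by rw [coeff_pmap, hN.G_u, map_zero]

theorem Maps.adm {F : Fin n → PS n A} {G φ : PS n A} (hA : μ.Adm F G φ) :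
    ν.Adm (fun j => pmap e (F j)) (pmap e G) (pmap e φ) where
  F j := pmap_mem_fil e (hA.toPreAdm.F j)
  G_mem := pmap_mem_fil e hA.G_mem
  φ_mem := pmap_mem_fil e hA.φ_mem
  du_G := by
    rw [← pmap_pderiv]
    exact pmap_mem_fil e hA.du_G
  du_φ := by
    rw [← pmap_pderiv]
    exact pmap_mem_fil e hA.du_φ
  G := by
    rw [← h.q2, ← map_sub]
    exact pmap_mem_fil e hA.G
  φ := by
    rw [← h.quad, ← map_sub]
    exact pmap_mem_fil e hA.φ

/-- The equations and normalizations only involve operations that commute with homomorphisms of star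
algebras. In this way a solution with universal coefficients specializes to each individual
structure. -/
theorem Maps.sol {zb : Fin n → Fin n → PS n A} {w : Fin n → PS n A} {s : A} {F : Fin n → PS n A}
    {G φ : PS n A} (hS : μ.Sol zb w s F G φ) : ν.Sol (fun k j => pmap e (zb k j))
      (fun j => pmap e (w j)) (e s) (fun j => pmap e (F j)) (pmap e G) (pmap e φ) where
  normal := by
    have := h.normal hS.normal
    simpa only [map_sub, map_mul, map_pow, h.q2, h.quad, pmap_C, pmap_X] using this
  adm := h.adm hS.adm
  errB k := by
    rw [← pmap_errB e (hasSubst_of_mem_fil_wt hS.adm.comps_mem), hS.errB, map_zero]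
  errW := by
    rw [← pmap_errW e (hasSubst_of_mem_fil_wt hS.adm.comps_mem), hS.errW, map_zero]

end LinModel

end Naturality

/-! ### Linear data from the coefficients of the transversal component -/

section OfCoeff

variable {n : ℕ} {A : Type*} [CommRing A] [StarRing A] [Algebra ℂ A]

/-- The matrix of the Levi form, in terms of the coefficients `a` of `z̄` in the transversal
component of the structure. -/
noncomputable def leviOf (a : Matrix (Fin n) (Fin n) A) : Matrix (Fin n) (Fin n) A := fun j k =>
  algebraMap ℂ A (1 / (2 * Complex.I)) * (a k j - star (a j k))

/-- The matrix of the nonintegrability form, in terms of the coefficients `b` of `z` in the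
transversal component of the structure. -/
def nonintOf (b : Matrix (Fin n) (Fin n) A) : Matrix (Fin n) (Fin n) A := fun j k => b k j - b j k

/-- The matrix of `6i𝓛 + 𝓝ʷ`. -/
noncomputable def strongOf (a b : Matrix (Fin n) (Fin n) A) :
    Matrix (Fin n ⊕ Fin n) (Fin n ⊕ Fin n) A :=
  Matrix.fromBlocks (nonintOf b) (algebraMap ℂ A (-6 * Complex.I) • (leviOf a).map star)
    (algebraMap ℂ A (6 * Complex.I) • leviOf a) ((nonintOf b).map star)

variable [StarModule ℂ A]

/-- The model with given coefficients of the transversal component and given inverses of the two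
determinants. -/
noncomputable def LinModel.ofCoeff (a b : Matrix (Fin n) (Fin n) A) (δ ε : A)
    (hδ : (leviOf a).det * δ = 1) (hε : (strongOf a b).det * ε = 1) : LinModel n A where
  c := leviOf a
  d := δ • (leviOf a).adjugate
  N := nonintOf b
  S := ε • (strongOf a b).adjugate
  star_c j k := by
    have h : star (algebraMap ℂ A (1 / (2 * Complex.I))) = - algebraMap ℂ A (1 / (2 * Complex.I)) := by
      rw [← algebraMap_star_comm, ← map_neg]
      congr 1
      simp
    simp only [leviOf, star_mul', star_sub, star_star, h]
    ring
  c_mul_d := by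
    rw [Matrix.mul_smul, Matrix.mul_adjugate, smul_smul, mul_comm, hδ, one_smul]
  N_antisymm j k := by
    simp only [nonintOf]
    ring
  mul_S := by
    change strongOf a b * _ = 1
    rw [Matrix.mul_smul, Matrix.mul_adjugate, smul_smul, mul_comm, hε, one_smul]
  H := fun j k => algebraMap ℂ A ((2 : ℕ) : ℂ)⁻¹ * (a j k + star (a k j))
  B := fun j k => algebraMap ℂ A ((2 : ℕ) : ℂ)⁻¹ * (b j k + b k j)
  star_H j k := by
    rw [star_mul', star_add, star_star, ← algebraMap_star_comm, star_inv₀, star_natCast, add_comm]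
  B_symm j k := by rw [add_comm]

variable {a b : Matrix (Fin n) (Fin n) A} {δ ε : A} (hδ : (leviOf a).det * δ = 1)
  (hε : (strongOf a b).det * ε = 1)

omit [StarRing A] [StarModule ℂ A] in
theorem algebraMap_half : algebraMap ℂ A ((2 : ℕ) : ℂ)⁻¹ * 2 = 1 := by
  rw [← map_ofNat (algebraMap ℂ A) 2, ← map_mul, ← map_one (algebraMap ℂ A)]
  congr 1
  norm_num

omit [StarRing A] [StarModule ℂ A] in
theorem algebraMap_I_mul : algebraMap ℂ A Complex.I * algebraMap ℂ A (1 / (2 * Complex.I)) =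
    algebraMap ℂ A ((2 : ℕ) : ℂ)⁻¹ := by
  rw [← map_mul]
  congr 1
  field_simp [Complex.I_ne_zero]
  norm_num

theorem LinModel.coefA_ofCoeff (j k : Fin n) :
    (LinModel.ofCoeff a b δ ε hδ hε).coefA j k = a j k := by
  simp only [LinModel.coefA, LinModel.ofCoeff, leviOf]
  linear_combination (a j k) * algebraMap_half (A := A) + (a j k - star (a k j)) *
    algebraMap_I_mul (A := A)

theorem LinModel.coefB_ofCoeff (j k : Fin n) :
    (LinModel.ofCoeff a b δ ε hδ hε).coefB j k = b j k := by
  simp only [LinModel.coefB, LinModel.ofCoeff, nonintOf]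
  linear_combination (b j k) * algebraMap_half (A := A)

/-- A series without constant term differs from its linear part in `z`, `z̄` by terms of weight
at least two. -/
theorem sub_linX_mem_fil {w : PS n A} {j : Fin n} (hw : constantCoeff w = 0)
    (ha : ∀ k, coeff (Finsupp.single (Coord.zb k) 1) w = a j k)
    (hb : ∀ k, coeff (Finsupp.single (Coord.z k) 1) w = b j k) :
    w - (LinModel.ofCoeff a b δ ε hδ hε).linX j ∈ fil wt 2 := by
  classical
  intro m hm
  rw [LinModel.linX, LinModel.lin]
  simp only [LinModel.coefA_ofCoeff, LinModel.coefB_ofCoeff, cj_X_z, map_sub, map_sum, map_add,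
    coeff_C_mul, coeff_X]
  by_cases h0 : m = 0
  · subst h0
    have e0 : ∀ i : Coord n, (0 : MIdx n) ≠ Finsupp.single i 1 := fun i h => by
      have := DFunLike.congr_fun h i
      simp at this
    simp [e0, hw]
  obtain ⟨i, hi⟩ : ∃ i, m = Finsupp.single i 1 := by
    obtain ⟨i, hi⟩ := Finsupp.ne_iff.mp h0
    have hle : Finsupp.single i 1 ≤ m := by
      rw [Finsupp.single_le_iff]
      exact Nat.one_le_iff_ne_zero.mpr hi
    refine ⟨i, ?_⟩
    have hsplit := congrArg (Finsupp.weight wt) (tsub_add_cancel_of_le hle)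
    rw [map_add, Finsupp.weight_single, one_smul] at hsplit
    have hwi : ∀ i : Coord n, 1 ≤ wt i := fun i => by rcases i with j | j | j <;> simp [wt]
    have h1 : Finsupp.weight wt (m - Finsupp.single i 1) = 0 := by
      have := hwi i
      omega
    have h2 : m - Finsupp.single i 1 = 0 := by
      by_contra hne
      obtain ⟨i', hi'⟩ := Finsupp.ne_iff.mp hne
      have := Finsupp.le_weight wt (s := i') (by have := hwi i'; omega) (m - Finsupp.single i 1)
      rw [h1] at this
      exact hi' (Nat.le_zero.mp this)
    rw [← tsub_add_cancel_of_le hle, h2, zero_add]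
  subst hi
  have hsi : ∀ i i' : Coord n, Finsupp.single i 1 = Finsupp.single i' 1 ↔ i = i' := fun i i' =>
    ⟨fun h => Finsupp.single_left_injective one_ne_zero h, fun h => by rw [h]⟩
  simp only [hsi]
  rcases i with k | k | k
  · simp [hb]
  · simp [ha]
  · rw [Finsupp.weight_single] at hm
    simp [wt] at hm

end OfCoeff

end FormalCR

/-! ### The data of an almost CR structure at the origin -/

namespace FormalCR

open MvPowerSeries

theorem conj_eq_cj {n : ℕ} (p : Ser n) : conj p = cj p := rfl

theorem constantCoeff_cj {n : ℕ} {A : Type*} [CommRing A] [StarRing A] (p : PS n A) :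
    constantCoeff (cj p) = star (constantCoeff p) := by
  rw [← coeff_zero_eq_constantCoeff_apply, ← coeff_zero_eq_constantCoeff_apply, coeff_cj]
  congr 2

theorem constantCoeff_pderiv {σ R : Type*} [CommRing R] (i : σ) (p : MvPowerSeries σ R) :
    constantCoeff (pderiv R i p) = coeff (Finsupp.single i 1) p := by
  rw [← coeff_zero_eq_constantCoeff_apply, coeff_pderiv]
  simp

theorem VField.constantCoeff_apply {n : ℕ} (Y : VField n) (p : Ser n) :
    constantCoeff (Y.apply p) = ∑ i, constantCoeff (Y i) * coeff (Finsupp.single i 1) p := by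
  simp only [VField.apply, map_sum, map_mul, constantCoeff_pderiv]

namespace AlmostCR

variable {n : ℕ} (L : AlmostCR n)

theorem mapComponents_eq (f : Fin n → Ser n) (g : Ser n) : mapComponents f g = comps f g := by
  funext i
  rcases i with j | j | j <;> rfl

/-- The coefficients of `z̄` in the transversal component. -/
noncomputable def coA : Matrix (Fin n) (Fin n) ℂ := fun j k =>
  coeff (Finsupp.single (Coord.zb k) 1) (L.w j)

/-- The coefficients of `z` in the transversal component. -/
noncomputable def coB : Matrix (Fin n) (Fin n) ℂ := fun j k =>
  coeff (Finsupp.single (Coord.z k) 1) (L.w j)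

variable {L} (h0 : L.NoConstantTerms)

include h0

theorem constantCoeff_frame (j : Fin n) (i : Coord n) :
    constantCoeff (L.frame j i) = if i = Coord.z j then 1 else 0 := by
  rcases i with k | k | k
  · rw [frame]
    by_cases h : k = j
    · simp [h]
    · simp [h]
  · rw [frame, h0.1]
    simp
  · rw [frame, h0.2]
    simp

theorem constantCoeff_frame_apply (j : Fin n) (p : Ser n) :
    constantCoeff ((L.frame j).apply p) = coeff (Finsupp.single (Coord.z j) 1) p := by
  rw [VField.constantCoeff_apply]
  simp [constantCoeff_frame h0]

theorem constantCoeff_frame_conj_apply (j : Fin n) (p : Ser n) :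
    constantCoeff ((L.frame j).conj.apply p) = coeff (Finsupp.single (Coord.zb j) 1) p := by
  have hb : ∀ i : Coord n, Coord.bar i = Coord.z j ↔ i = Coord.zb j := fun i => by
    rcases i with k | k | k <;> simp [Coord.bar]
  rw [VField.constantCoeff_apply]
  simp [VField.conj, conj_eq_cj, constantCoeff_cj, constantCoeff_frame h0, hb]

theorem leviMatrix_eq : L.leviMatrix = leviOf L.coA := by
  ext j k
  rw [leviMatrix, leviOf, VField.bracket, map_sub, constantCoeff_frame_conj_apply h0,
    constantCoeff_frame_apply h0]
  change _ * (coeff _ (L.w k) - coeff _ (cj (L.w j))) = _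
  rw [coeff_cj, bar_single]
  rfl

theorem nonintMatrix_eq : L.nonintMatrix = nonintOf L.coB := by
  ext j k
  rw [nonintMatrix, nonintOf, VField.bracket, map_sub, constantCoeff_frame_apply h0,
    constantCoeff_frame_apply h0]
  rfl

theorem strongMatrix_eq : L.strongMatrix = strongOf L.coA L.coB := by
  rw [strongMatrix, strongOf, leviMatrix_eq h0, nonintMatrix_eq h0]
  rfl

omit h0

theorem StronglyNondegenerate.det_levi (h : L.StronglyNondegenerate) : L.leviMatrix.det ≠ 0 := by
  intro hdet
  obtain ⟨v, hv, hv0⟩ := Matrix.exists_vecMul_eq_zero_iff.mpr hdet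
  refine hv ?_
  have h1 := h.1 (fun j => star (v j)) fun η => by
    rw [levi, Finset.sum_comm]
    refine Finset.sum_eq_zero fun k _ => ?_
    have h2 := congrFun hv0 k
    simp only [Matrix.vecMul, dotProduct, Pi.zero_apply] at h2
    rw [← Finset.sum_mul]
    simp only [star_star]
    rw [Finset.sum_congr rfl fun j _ => mul_comm _ _, h2, zero_mul]
  funext j
  have := congrFun h1 j
  simpa using this

/-- The complex matrix is the complexification of the real-linear map. If $(x,y)$ lies in its
kernel, then $x+\bar y$ and $i(x-\bar y)$ lie in the kernel of the real-linear map, hence vanish,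
and so do $x$ and $y$. -/
theorem StronglyNondegenerate.det_strong (h : L.StronglyNondegenerate) :
    L.strongMatrix.det ≠ 0 := by
  intro hdet
  obtain ⟨v, hv, hv0⟩ := Matrix.exists_vecMul_eq_zero_iff.mpr hdet
  have hz : ∀ ξ : Fin n → ℂ, (∀ k, ∑ j, (L.nonintMatrix j k * ξ j +
      6 * Complex.I * (L.leviMatrix j k * star (ξ j))) = 0) → ξ = 0 := fun ξ hξ =>
    h.2 ξ fun η => by
      have e1 : 6 * Complex.I * L.levi ξ η + L.nonint ξ η = ∑ k, (∑ j, (L.nonintMatrix j k * ξ j +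
          6 * Complex.I * (L.leviMatrix j k * star (ξ j)))) * η k := by
        rw [levi, nonint, Finset.mul_sum, ← Finset.sum_add_distrib]
        simp only [Finset.mul_sum, Finset.sum_mul, ← Finset.sum_add_distrib]
        rw [Finset.sum_comm]
        exact Finset.sum_congr rfl fun k _ => Finset.sum_congr rfl fun j _ => by ring
      rw [e1]
      exact Finset.sum_eq_zero fun k _ => by rw [hξ, zero_mul]
  set x : Fin n → ℂ := fun j => v (Sum.inl j) with hx
  set y : Fin n → ℂ := fun j => v (Sum.inr j) with hy
  have h1 : ∀ k, ∑ j, (L.nonintMatrix j k * x j + 6 * Complex.I * (L.leviMatrix j k * y j)) = 0 :=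
    fun k => by
      have := congrFun hv0 (Sum.inl k)
      simp only [Matrix.vecMul, dotProduct, Fintype.sum_sum_type, strongMatrix,
        Matrix.fromBlocks_apply₁₁, Matrix.fromBlocks_apply₂₁, Matrix.smul_apply, smul_eq_mul,
        Pi.zero_apply, ← Finset.sum_add_distrib] at this
      rw [← this]
      exact Finset.sum_congr rfl fun j _ => by ring
  have h2 : ∀ k, ∑ j, (L.nonintMatrix j k * star (y j) +
      6 * Complex.I * (L.leviMatrix j k * star (x j))) = 0 := fun k => by
    have := congrFun hv0 (Sum.inr k)
    simp only [Matrix.vecMul, dotProduct, Fintype.sum_sum_type, strongMatrix,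
      Matrix.fromBlocks_apply₁₂, Matrix.fromBlocks_apply₂₂, Matrix.smul_apply, smul_eq_mul,
      Pi.zero_apply, ← Finset.sum_add_distrib, Matrix.map_apply] at this
    have h3 := congrArg star this
    rw [star_sum, star_zero] at h3
    rw [← h3]
    refine Finset.sum_congr rfl fun j _ => ?_
    simp only [star_add, star_mul', star_star, star_neg, star_ofNat]
    rw [show star Complex.I = -Complex.I from Complex.conj_I]
    ring
  have e1 : (fun j => x j + star (y j)) = 0 := hz _ fun k => by
    refine Eq.trans ?_ ((congrArg₂ HAdd.hAdd (h1 k) (h2 k)).trans (add_zero 0))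
    rw [← Finset.sum_add_distrib]
    refine Finset.sum_congr rfl fun j _ => ?_
    rw [star_add, star_star]
    ring
  have e2 : (fun j => Complex.I * (x j - star (y j))) = 0 := hz _ fun k => by
    have e3 : ∑ j, (L.nonintMatrix j k * (Complex.I * (x j - star (y j))) + 6 * Complex.I *
        (L.leviMatrix j k * star (Complex.I * (x j - star (y j))))) =
        Complex.I * ∑ j, (L.nonintMatrix j k * x j + 6 * Complex.I * (L.leviMatrix j k * y j)) -
        Complex.I * ∑ j, (L.nonintMatrix j k * star (y j) +
          6 * Complex.I * (L.leviMatrix j k * star (x j))) := by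
      rw [Finset.mul_sum, Finset.mul_sum, ← Finset.sum_sub_distrib]
      refine Finset.sum_congr rfl fun j _ => ?_
      rw [star_mul', star_sub, star_star, show star Complex.I = -Complex.I from Complex.conj_I]
      ring
    rw [e3, h1, h2, mul_zero, sub_zero]
  have e4 : ∀ j, x j = 0 ∧ y j = 0 := fun j => by
    have a1 : x j + star (y j) = 0 := congrFun e1 j
    have a2 : Complex.I * (x j - star (y j)) = 0 := congrFun e2 j
    have a3 : x j - star (y j) = 0 := (mul_eq_zero.mp a2).resolve_left Complex.I_ne_zero
    have a4 : x j = 0 := by linear_combination (a1 + a3) / 2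
    refine ⟨a4, ?_⟩
    rw [a4, zero_add] at a1
    exact star_eq_zero.mp a1
  refine hv (funext fun i => ?_)
  rcases i with j | j
  · exact (e4 j).1
  · exact (e4 j).2

end AlmostCR

end FormalCR

/-! ### Elimination of the transformed structure -/

namespace FormalCR

open MvPowerSeries

section ChainRule

variable {n : ℕ} {A : Type*} [CommRing A]

/-- The coefficients of the vector field `radial φ`. -/
noncomputable def radialCoeff [Algebra ℂ A] (φ : PS n A) : Coord n → PS n A
  | Sum.inl j => (1 - im * du φ) * X (Coord.z j)
  | Sum.inr (Sum.inl _) => 0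
  | Sum.inr (Sum.inr _) => im * eul φ

theorem radial_eq_sum [Algebra ℂ A] (φ x : PS n A) :
    radial φ x = ∑ i, radialCoeff φ i * pderiv A i x := by
  rw [Fintype.sum_sum_type, Fintype.sum_sum_type, radial, eul_apply, Finset.mul_sum]
  simp [radialCoeff, mul_assoc]

theorem sum_mul_pderiv_subst {a : Coord n → PS n A} (ha : ∀ i, a i ∈ fil (fun _ => 1) 1)
    (v : Coord n → PS n A) (p : PS n A) : ∑ i, v i * pderiv A i (subst a p) =
      ∑ m, subst a (pderiv A m p) * ∑ i, v i * pderiv A i (a m) := by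
  simp only [pderiv_subst ha, Finset.mul_sum]
  rw [Finset.sum_comm]
  exact Finset.sum_congr rfl fun m _ => Finset.sum_congr rfl fun i _ => by ring

theorem constantCoeff_subst_of_mem_fil {a : Coord n → PS n A}
    (ha : ∀ i, a i ∈ fil (fun _ => 1) 1) (p : PS n A) :
    constantCoeff (subst a p) = constantCoeff p := by
  have hs := hasSubst_of_mem_fil ha
  have h1 : p - C (constantCoeff p) ∈ fil (fun _ : Coord n => 1) 1 := fun m hm => by
    have : m = 0 := by
      by_contra hne
      obtain ⟨i, hi⟩ := Finsupp.ne_iff.mp hne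
      have := Finsupp.le_weight (fun _ : Coord n => 1) (s := i) one_ne_zero m
      rw [Nat.lt_one_iff.mp hm] at this
      exact hi (Nat.le_zero.mp this)
    rw [this, map_sub, coeff_zero_eq_constantCoeff_apply, coeff_zero_eq_constantCoeff_apply,
      constantCoeff_C, sub_self]
  have h2 := subst_mem_fil hs ha h1 0 (by simp)
  have h3 : subst a (C (constantCoeff p) : PS n A) = C (constantCoeff p) := by
    rw [← coe_substAlgHom hs]
    exact (substAlgHom hs).commutes _
  rw [subst_sub hs, h3, map_sub, coeff_zero_eq_constantCoeff_apply,
    coeff_zero_eq_constantCoeff_apply, constantCoeff_C, sub_eq_zero] at h2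
  exact h2

end ChainRule

theorem isUnit_one_sub {n : ℕ} {φ : Ser n} (hφ : φ ∈ fil (fun _ => 1) 2) :
    IsUnit (1 - im * du φ : Ser n) := by
  rw [MvPowerSeries.isUnit_iff_constantCoeff, map_sub, map_mul, constantCoeff_pderiv,
    hφ _ (by rw [Finsupp.weight_single]; norm_num), mul_zero, map_one, sub_zero]
  exact isUnit_one

/-- The matrix of the `z`-components of the images of the frame fields. -/
noncomputable def AlmostCR.frameMatrix {n : ℕ} (L : AlmostCR n) (f F : Fin n → Ser n)
    (g G : Ser n) : Matrix (Fin n) (Fin n) (Ser n) := fun l j =>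
  subst (comps F G) ((L.frame j).apply (comps f g (Coord.z l)))

namespace IsInv

variable {n : ℕ} {f F : Fin n → Ser n} {g G : Ser n} (h : IsInv f g F G) (L : AlmostCR n)

include h

/-- The frame of `L`, expressed through its action on the components of the map. -/
theorem sum_apply_mul_pderiv (j : Fin n) (i : Coord n) :
    ∑ m, subst (comps F G) ((L.frame j).apply (comps f g m)) * pderiv ℂ m (comps F G i) =
      subst (comps F G) (L.frame j i) := by
  classical
  have h1 := sum_mul_pderiv_subst h.mem (L.frame j) (comps F G i)
  rw [h.left] at h1
  have h2 : ∑ s, L.frame j s * pderiv ℂ s (X i : Ser n) = L.frame j i := by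
    simp [pderiv_X, Pi.single_apply]
  rw [h2] at h1
  rw [h1, ← coe_substAlgHom h.symm.hasSubst, map_sum]
  refine Finset.sum_congr rfl fun m _ => ?_
  rw [map_mul, coe_substAlgHom, h.subst_subst, mul_comm]
  rfl

theorem radial_X (φ : Ser n) (i : Coord n) : radial φ (X i) =
    ∑ s, subst (comps F G) (pderiv ℂ s (comps f g i)) * radial φ (comps F G s) := by
  rw [← h.right i, radial_eq_sum, sum_mul_pderiv_subst h.symm.mem]
  simp only [radial_eq_sum]

/-- The radial field of `φ` is a combination of the images of the frame fields in the target
coordinates if and only if it is in the source coordinates. -/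
theorem radial_X_iff (φ : Ser n) (a : Fin n → Ser n) :
    (∀ i, radial φ (X i) = ∑ j, a j * subst (comps F G) ((L.frame j).apply (comps f g i))) ↔
      ∀ i, radial φ (comps F G i) = ∑ j, a j * subst (comps F G) (L.frame j i) := by
  classical
  constructor
  · intro ha i
    simp only [← h.sum_apply_mul_pderiv, Finset.mul_sum]
    rw [Finset.sum_comm, radial_eq_sum]
    refine Finset.sum_congr rfl fun m _ => ?_
    have h1 : radialCoeff φ m = radial φ (X m) := by
      rw [radial_eq_sum]
      simp [pderiv_X, Pi.single_apply]
    rw [h1, ha, Finset.sum_mul]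
    exact Finset.sum_congr rfl fun j _ => by ring
  · intro ha i
    rw [h.radial_X]
    simp only [ha, VField.apply, Finset.mul_sum]
    rw [Finset.sum_comm]
    refine Finset.sum_congr rfl fun j _ => ?_
    rw [← coe_substAlgHom h.symm.hasSubst, map_sum, Finset.mul_sum]
    refine Finset.sum_congr rfl fun s _ => ?_
    rw [map_mul]
    ring

variable {L}

theorem isUnit_det_frameMatrix (h0 : L.NoConstantTerms) :
    IsUnit (L.frameMatrix f F g G).det := by
  classical
  rw [MvPowerSeries.isUnit_iff_constantCoeff, RingHom.map_det]
  have h1 : (constantCoeff (σ := Coord n) (R := ℂ)).mapMatrix (L.frameMatrix f F g G) = 1 := by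
    ext l j
    rw [RingHom.mapMatrix_apply, Matrix.map_apply, AlmostCR.frameMatrix,
      constantCoeff_subst_of_mem_fil h.symm.mem, AlmostCR.constantCoeff_frame_apply h0, comps,
      map_add, h.f_mem l _ (by rw [Finsupp.weight_single]; norm_num), add_zero, coeff_X,
      Matrix.one_apply]
    by_cases hlj : l = j
    · rw [if_pos hlj, hlj, if_pos rfl]
    · rw [if_neg hlj, if_neg]
      intro he
      exact hlj (Sum.inl_injective (Finsupp.single_left_injective one_ne_zero he)).symm
  rw [h1, Matrix.det_one]
  exact isUnit_one

end IsInv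

end FormalCR

namespace FormalCR

open MvPowerSeries

/-- The frame of the graph has the unit vectors as $z$-components, so the only possible coefficients
are the $z$-components of the radial field. The remaining components are the two error terms. -/
theorem err_eq_zero_iff {n : ℕ} (L : AlmostCR n) {F : Fin n → Ser n} {G φ : Ser n}
    (hs : HasSubst (comps F G)) :
    ((∀ k, errB L.zb F G φ k = 0) ∧ errW L.w F G φ = 0) ↔ ∀ i, radial φ (comps F G i) =
      ∑ j, radial φ (comps F G (Coord.z j)) * subst (comps F G) (L.frame j i) := by
  classical
  have hX : ∀ k : Fin n, radial φ (X (Coord.zb k)) = 0 := fun k => by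
    rw [radial, (isBi_X_zb k).eul, pderiv_X_of_ne (by simp), Nat.cast_zero]
    ring
  have hB : ∀ k, errB L.zb F G φ k = radial φ (comps F G (Coord.zb k)) -
      ∑ j, radial φ (comps F G (Coord.z j)) * subst (comps F G) (L.frame j (Coord.zb k)) :=
    fun k => by
      rw [errB, show comps F G (Coord.zb k) = X (Coord.zb k) + cj (F k) from rfl, radial_add, hX,
        zero_add]
      exact congrArg _ (Finset.sum_congr rfl fun j _ => mul_comm _ _)
  have hW : errW L.w F G φ = radial φ (comps F G Coord.u) -
      ∑ j, radial φ (comps F G (Coord.z j)) * subst (comps F G) (L.frame j Coord.u) := by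
    rw [errW]
    exact congrArg _ (Finset.sum_congr rfl fun j _ => mul_comm _ _)
  have hZ : ∀ l : Fin n, ∑ j, radial φ (comps F G (Coord.z j)) *
      subst (comps F G) (L.frame j (Coord.z l)) = radial φ (comps F G (Coord.z l)) := fun l => by
    have h1 : ∀ j, subst (comps F G) (L.frame j (Coord.z l)) = if l = j then 1 else 0 := fun j => by
      rw [AlmostCR.frame, ← coe_substAlgHom hs]
      split_ifs
      · exact map_one _
      · exact map_zero _
    simp [h1]
  simp only [hB, hW, sub_eq_zero]
  constructor
  · rintro ⟨h1, h2⟩ (j | j | j)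
    · exact (hZ j).symm
    · exact h1 j
    · exact h2
  · exact fun h => ⟨fun k => h _, h _⟩

theorem radialZb_graphStructure {n : ℕ} (φ : Ser n) (k : Fin n) :
    (graphStructure φ).radialZb k = 0 := by
  simp [AlmostCR.radialZb, graphStructure]

theorem one_sub_mul_radialW_graphStructure {n : ℕ} {φ : Ser n} (hφ : φ ∈ fil (fun _ => 1) 2) :
    (1 - im * du φ) * (graphStructure φ).radialW = im * eul φ := by
  have h1 : constantCoeff (1 - im * du φ : Ser n) ≠ 0 :=
    ((MvPowerSeries.isUnit_iff_constantCoeff).mp (isUnit_one_sub hφ)).ne_zero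
  have h2 := MvPowerSeries.mul_inv_cancel _ h1
  have h3 : (graphStructure φ).radialW = (1 - im * du φ)⁻¹ * (im * eul φ) := by
    rw [AlmostCR.radialW, eul_apply, Finset.mul_sum, Finset.mul_sum]
    refine Finset.sum_congr rfl fun j _ => ?_
    change X (Coord.z j) * (im * (1 - im * du φ)⁻¹ * _) = _
    ring
  rw [h3, ← mul_assoc, h2, one_mul]

namespace IsInv

variable {n : ℕ} {f F : Fin n → Ser n} {g G : Ser n} (h : IsInv f g F G) {L : AlmostCR n}

include h

theorem subst_injective {p q : Ser n} (hpq : subst (comps F G) p = subst (comps F G) q) :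
    p = q := by
  rw [← h.symm.subst_subst p, hpq, h.symm.subst_subst]

theorem transformsInto_iff (L' : AlmostCR n) : L.TransformsInto f g L' ↔
    (∀ j k, subst (comps F G) ((L.frame j).apply (comps f g (Coord.zb k))) =
      ∑ l, L'.zb k l * L.frameMatrix f F g G l j) ∧
    ∀ j, subst (comps F G) ((L.frame j).apply (comps f g Coord.u)) =
      ∑ l, L'.w l * L.frameMatrix f F g G l j := by
  have key : ∀ (j : Fin n) (p : Ser n) (q : Fin n → Ser n),
      (p = ∑ l, subst (comps f g) (q l) * (L.frame j).apply (comps f g (Coord.z l))) ↔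
      subst (comps F G) p = ∑ l, q l * L.frameMatrix f F g G l j := fun j p q => by
    have e : subst (comps F G)
        (∑ l, subst (comps f g) (q l) * (L.frame j).apply (comps f g (Coord.z l))) =
        ∑ l, q l * L.frameMatrix f F g G l j := by
      rw [← coe_substAlgHom h.symm.hasSubst, map_sum]
      refine Finset.sum_congr rfl fun l _ => ?_
      rw [map_mul, coe_substAlgHom, h.subst_subst]
      rfl
    rw [← e]
    exact ⟨fun hp => congrArg _ hp, fun hp => h.subst_injective hp⟩
  rw [AlmostCR.TransformsInto, AlmostCR.mapComponents_eq]
  simp only [key]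

/-- The structure `L` is transformed into a structure that coincides with that of a graph along the
Euler field if and only if the radial equations hold. -/
theorem exists_transformsInto_iff (h0 : L.NoConstantTerms) {φ : Ser n}
    (hφ : φ ∈ fil (fun _ => 1) 2) :
    (∃ L' : AlmostCR n, L.TransformsInto f g L' ∧ L'.CoincideAlongEuler (graphStructure φ)) ↔
      (∀ k, errB L.zb F G φ k = 0) ∧ errW L.w F G φ = 0 := by
  classical
  set M := L.frameMatrix f F g G with hM
  have hdet : IsUnit M.det := h.isUnit_det_frameMatrix h0
  have hMP : ∀ l l', ∑ j, M l j * M⁻¹ j l' = if l = l' then 1 else 0 := fun l l' => by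
    rw [← Matrix.mul_apply, Matrix.mul_nonsing_inv _ hdet, Matrix.one_apply]
  have hPM : ∀ j j', ∑ l, M⁻¹ j l * M l j' = if j = j' then 1 else 0 := fun j j' => by
    rw [← Matrix.mul_apply, Matrix.nonsing_inv_mul _ hdet, Matrix.one_apply]
  have hXzb : ∀ k : Fin n, radial φ (X (Coord.zb k)) = 0 := fun k => by
    rw [radial, (isBi_X_zb k).eul, pderiv_X_of_ne (by simp), Nat.cast_zero]
    ring
  -- If the coefficients `a` reproduce the $z$-components of the radial field, combining the graph
  -- equations with `a` evaluates the structure along the Euler field, times the unit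
  -- $1-i\varphi_u$.
  have hrow : ∀ (p : Fin n → Ser n) (a : Fin n → Ser n)
      (ha : ∀ l, radial φ (X (Coord.z l)) = ∑ j, a j * M l j),
      ∑ j, a j * ∑ l, p l * M l j = (1 - im * du φ) * ∑ l, X (Coord.z l) * p l := fun p a ha => by
    simp only [Finset.mul_sum]
    rw [Finset.sum_comm]
    refine Finset.sum_congr rfl fun l _ => ?_
    have h1 := ha l
    rw [radial_X_z] at h1
    rw [← mul_assoc, h1, Finset.sum_mul]
    exact Finset.sum_congr rfl fun j _ => by ring
  rw [err_eq_zero_iff L h.symm.hasSubst]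
  constructor
  · rintro ⟨L', hT, hZb, hW⟩
    rw [h.transformsInto_iff] at hT
    -- The coefficients that reproduce the $z$-components of the radial field in the image frame;
    -- agreement along the Euler field then supplies the other components.
    set a : Fin n → Ser n := fun j => ∑ l, M⁻¹ j l * radial φ (X (Coord.z l)) with ha
    have haz : ∀ l, radial φ (X (Coord.z l)) = ∑ j, a j * M l j := fun l => by
      simp only [ha, Finset.sum_mul]
      rw [Finset.sum_comm]
      have : ∀ l', ∑ j, M⁻¹ j l' * radial φ (X (Coord.z l')) * M l j =
          (if l = l' then 1 else 0) * radial φ (X (Coord.z l')) := fun l' => by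
        rw [← hMP, Finset.sum_mul]
        exact Finset.sum_congr rfl fun j _ => by ring
      simp [this]
    have h1 : ∀ i, radial φ (X i) =
        ∑ j, a j * subst (comps F G) ((L.frame j).apply (comps f g i)) := by
      rintro (l | k | k)
      · exact haz l
      · rw [hXzb]
        simp only [hT.1]
        rw [hrow _ a haz]
        have := hZb k
        rw [radialZb_graphStructure, AlmostCR.radialZb] at this
        rw [this, mul_zero]
      · rw [radial_X_u]
        simp only [hT.2]
        rw [hrow _ a haz, ← one_sub_mul_radialW_graphStructure hφ, ← hW, AlmostCR.radialW]
    have h2 := (h.radial_X_iff L φ a).mp h1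
    have h3 : ∀ l, radial φ (comps F G (Coord.z l)) = a l := fun l => by
      rw [h2]
      have h4 : ∀ j, subst (comps F G) (L.frame j (Coord.z l)) = if l = j then 1 else 0 :=
        fun j => by
          rw [AlmostCR.frame, ← coe_substAlgHom h.symm.hasSubst]
          split_ifs
          · exact map_one _
          · exact map_zero _
      simp [h4]
    intro i
    rw [h2 i]
    simp only [h3]
  · intro hE
    have h1 := (h.radial_X_iff L φ _).mpr hE
    set a : Fin n → Ser n := fun j => radial φ (comps F G (Coord.z j)) with ha
    -- The image of the bundle is a graph because the $z$-components of the image frame form an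
    -- invertible matrix; this is the map whose graph it is.
    set L' : AlmostCR n :=
      { zb := fun k l => ∑ j, subst (comps F G) ((L.frame j).apply (comps f g (Coord.zb k))) *
          M⁻¹ j l
        w := fun l => ∑ j, subst (comps F G) ((L.frame j).apply (comps f g Coord.u)) *
          M⁻¹ j l } with hL'
    have hinv : ∀ (p : Fin n → Ser n) (j : Fin n), p j = ∑ l, (∑ j, p j * M⁻¹ j l) * M l j :=
      fun p j => by
        simp only [Finset.sum_mul]
        rw [Finset.sum_comm]
        have : ∀ j', ∑ l, p j' * M⁻¹ j' l * M l j = p j' * if j' = j then 1 else 0 := fun j' => by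
          rw [← hPM, Finset.mul_sum]
          exact Finset.sum_congr rfl fun l _ => by ring
        simp [this]
    have hT1 : ∀ j k, subst (comps F G) ((L.frame j).apply (comps f g (Coord.zb k))) =
        ∑ l, L'.zb k l * M l j := fun j k =>
      hinv (fun j => subst (comps F G) ((L.frame j).apply (comps f g (Coord.zb k)))) j
    have hT2 : ∀ j, subst (comps F G) ((L.frame j).apply (comps f g Coord.u)) =
        ∑ l, L'.w l * M l j := fun j =>
      hinv (fun j => subst (comps F G) ((L.frame j).apply (comps f g Coord.u))) j
    have hz : ∀ l, radial φ (X (Coord.z l)) = ∑ j, a j * M l j := fun l => h1 _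
    have hu := isUnit_one_sub hφ
    refine ⟨L', (h.transformsInto_iff L').mpr ⟨hT1, hT2⟩, fun k => hu.mul_left_cancel ?_,
      hu.mul_left_cancel ?_⟩
    · rw [radialZb_graphStructure, mul_zero, AlmostCR.radialZb, ← hrow _ a hz, ← hXzb k, h1]
      exact Finset.sum_congr rfl fun j _ => by rw [hT1]
    · rw [one_sub_mul_radialW_graphStructure hφ, AlmostCR.radialW, ← hrow _ a hz, ← radial_X_u, h1]
      exact Finset.sum_congr rfl fun j _ => by rw [hT2]

end IsInv

end FormalCR

/-! ### Translation of the Chern–Moser normalization -/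

namespace FormalCR

open MvPowerSeries

section UComponent

variable {n : ℕ} {A : Type*} [CommRing A]

/-- The component of degree `c` in `u`. -/
noncomputable def uproj (c : ℕ) : PS n A →ₗ[A] PS n A where
  toFun p := mkPS fun m => if m Coord.u = c then coeff m p else 0
  map_add' p q := by
    ext m
    simp only [map_add, coeff_mkPS]
    split_ifs <;> simp
  map_smul' c p := by
    ext m
    simp only [map_smul, coeff_mkPS, RingHom.id_apply]
    split_ifs <;> simp

theorem coeff_uproj (c : ℕ) (p : PS n A) (m : MIdx n) :
    coeff m (uproj c p) = if m Coord.u = c then coeff m p else 0 := rfl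

theorem forall_uproj_eq_zero_iff {p : PS n A} : (∀ c, uproj c p = 0) ↔ p = 0 := by
  refine ⟨fun h => ?_, fun h c => by rw [h, map_zero]⟩
  ext m
  have := congrArg (coeff m) (h (m Coord.u))
  rwa [coeff_uproj, if_pos rfl] at this

theorem uproj_C_mul (c : ℕ) (a : A) (p : PS n A) : uproj c (C a * p) = C a * uproj c p := by
  rw [← smul_eq_C_mul, map_smul, smul_eq_C_mul]

theorem pderiv_uproj {i : Coord n} (hi : i ≠ Coord.u) (c : ℕ) (p : PS n A) :
    pderiv A i (uproj c p) = uproj c (pderiv A i p) := by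
  ext m
  have h : (m + Finsupp.single i 1 : MIdx n) Coord.u = m Coord.u := by
    rw [Finsupp.add_apply, Finsupp.single_eq_of_ne hi.symm, add_zero]
  rw [coeff_pderiv, coeff_uproj, coeff_uproj, coeff_pderiv, h]
  split_ifs
  · rfl
  · rw [zero_mul]

variable [StarRing A] [Algebra ℂ A] (μ : Model n A)

theorem Model.tr_uproj (c : ℕ) (p : PS n A) : μ.tr (uproj c p) = uproj c (μ.tr p) := by
  simp only [Model.tr, map_sum, uproj_C_mul]
  refine Finset.sum_congr rfl fun j _ => Finset.sum_congr rfl fun k _ => ?_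
  rw [pderiv_uproj (by simp), pderiv_uproj (by simp)]

end UComponent

variable {n : ℕ}

theorem multiDeriv_eq (a b c : ℕ) (p : Ser n) : multiDeriv a b c p =
    C (a.factorial * b.factorial * c.factorial : ℂ) * uproj c (proj a b p) := by
  ext m
  rw [coeff_C_mul, coeff_uproj, coeff_proj, weight_zw, weight_bw]
  change (if _ then _ else _) = _
  by_cases h1 : m Coord.u = c
  · by_cases h2 : (∑ j, m (Coord.z j)) = a ∧ (∑ j, m (Coord.zb j)) = b
    · rw [if_pos ⟨h2.1, h2.2, h1⟩, if_pos h1, if_pos h2]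
    · rw [if_neg fun h => h2 ⟨h.1, h.2.1⟩, if_pos h1, if_neg h2, mul_zero]
  · rw [if_neg fun h => h1 h.2.2, if_neg h1, mul_zero]

theorem C_factorial_mul_eq_zero_iff (a b c : ℕ) (p : Ser n) :
    C (a.factorial * b.factorial * c.factorial : ℂ) * p = 0 ↔ p = 0 := by
  refine ⟨fun h => (mul_eq_zero.mp h).resolve_left fun h0 => ?_, fun h => by rw [h, mul_zero]⟩
  have h1 := congrArg constantCoeff h0
  rw [constantCoeff_C, map_zero] at h1
  exact (by positivity : (0 : ℝ) < a.factorial * b.factorial * c.factorial).ne'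
    (by exact_mod_cast h1)

namespace AlmostCR

variable (L : AlmostCR n) (h0 : L.NoConstantTerms) (hs : L.StronglyNondegenerate)

/-- The algebraic data of `L` at the origin. -/
noncomputable def linModel : LinModel n ℂ :=
  LinModel.ofCoeff L.coA L.coB (leviOf L.coA).det⁻¹ (strongOf L.coA L.coB).det⁻¹
    (mul_inv_cancel₀ (leviMatrix_eq h0 ▸ StronglyNondegenerate.det_levi hs))
    (mul_inv_cancel₀ (strongMatrix_eq h0 ▸ StronglyNondegenerate.det_strong hs))

theorem tr_eq (p : Ser n) : L.tr p = (L.linModel h0 hs).tr p := by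
  have h : (L.linModel h0 hs).d = L.leviMatrix⁻¹ := by
    rw [Matrix.inv_def, leviMatrix_eq h0, Ring.inverse_eq_inv']
    rfl
  rw [tr, Model.tr, h]

theorem chernMoserNormalized_iff (φ : Ser n) : ChernMoserNormalized L φ ↔
    (∀ a, proj a 0 φ = 0) ∧ (∀ c, uproj (c + 1) (proj 1 1 φ) = 0) ∧ (∀ a, proj (a + 2) 1 φ = 0) ∧
    (L.linModel h0 hs).tr (proj 2 2 φ) = 0 ∧
    (L.linModel h0 hs).tr ((L.linModel h0 hs).tr (proj 3 2 φ)) = 0 ∧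
    (L.linModel h0 hs).tr ((L.linModel h0 hs).tr ((L.linModel h0 hs).tr (proj 3 3 φ))) = 0 := by
  have e : ChernMoserNormalized L φ ↔ (∀ a c, multiDeriv a 0 c φ = 0) ∧
      (∀ c, multiDeriv 1 1 (c + 1) φ = 0) ∧ (∀ a c, multiDeriv (a + 2) 1 c φ = 0) ∧
      (∀ c, L.tr (multiDeriv 2 2 c φ) = 0) ∧ (∀ c, L.tr (L.tr (multiDeriv 3 2 c φ)) = 0) ∧
      ∀ c, L.tr (L.tr (L.tr (multiDeriv 3 3 c φ))) = 0 :=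
    ⟨fun h => ⟨h.pure, h.deg11, h.degk1, h.deg22, h.deg32, h.deg33⟩,
      fun h => ⟨h.1, h.2.1, h.2.2.1, h.2.2.2.1, h.2.2.2.2.1, h.2.2.2.2.2⟩⟩
  rw [e]
  simp only [multiDeriv_eq, tr_eq L h0 hs, Model.tr_C_mul, Model.tr_uproj,
    C_factorial_mul_eq_zero_iff, forall_uproj_eq_zero_iff]

/-- The normalization of the theorem leaves the (1,1) component at $u=0$ free, whereas `Norm` makes
it vanish after subtraction of $Q$. The additional condition is therefore that this component equals
$Q$; the radial equation will imply it. -/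
theorem norm_sub_quad_iff (φ : Ser n) :
    (L.linModel h0 hs).Norm (φ - (L.linModel h0 hs).quad) ↔
      ChernMoserNormalized L φ ∧ proj 1 1 φ = (L.linModel h0 hs).quad := by
  set μ := L.linModel h0 hs with hμ
  have h1 : ∀ a b, ¬ (a = 1 ∧ b = 1) → proj a b (φ - μ.quad) = proj a b φ := fun a b hab => by
    rw [map_sub, μ.isBi_quad.proj_ne hab, sub_zero]
  have h2 : proj 1 1 (φ - μ.quad) = proj 1 1 φ - μ.quad := by
    rw [map_sub, μ.isBi_quad.proj_eq]
  have h3 : ∀ c, uproj (c + 1) μ.quad = 0 := fun c => by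
    ext m
    rw [coeff_uproj, map_zero]
    split_ifs with hm
    · have hle : Finsupp.single Coord.u 1 ≤ m := by
        rw [Finsupp.single_le_iff]
        omega
      have h4 := congrArg (coeff (m - Finsupp.single Coord.u 1)) μ.du_quad
      rw [coeff_pderiv, tsub_add_cancel_of_le hle, map_zero] at h4
      refine (mul_eq_zero.mp h4).resolve_right ?_
      exact Nat.cast_add_one_ne_zero _
    · rfl
  rw [chernMoserNormalized_iff L h0 hs]
  constructor
  · intro h
    have h11 : proj 1 1 φ = μ.quad := by
      have := h.one_one
      rwa [h2, sub_eq_zero] at this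
    refine ⟨⟨fun a => ?_, fun c => ?_, fun a => ?_, ?_, ?_, ?_⟩, h11⟩
    · rw [← h1 _ _ (by omega), h.pure]
    · rw [h11, h3]
    · rw [← h1 _ _ (by omega), h.deg_one]
    · rw [← h1 _ _ (by omega), h.tr_two_two]
    · rw [← h1 _ _ (by omega), h.tr_three_two]
    · rw [← h1 _ _ (by omega), h.tr_three_three]
  · rintro ⟨⟨a1, a2, a3, a4, a5, a6⟩, h11⟩
    refine ⟨fun a => ?_, ?_, fun a => ?_, ?_, ?_, ?_⟩
    · rw [h1 _ _ (by omega), a1]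
    · rw [h2, h11, sub_self]
    · rw [h1 _ _ (by omega), a3]
    · rw [h1 _ _ (by omega), a4]
    · rw [h1 _ _ (by omega), a5]
    · rw [h1 _ _ (by omega), a6]

theorem sub_linX_linModel_mem_fil (j : Fin n) :
    L.w j - (L.linModel h0 hs).linX j ∈ fil wt 2 :=
  sub_linX_mem_fil _ _ (h0.2 j) (fun _ => rfl) fun _ => rfl

end AlmostCR

theorem fil_wt_of_fil_one {A : Type*} [CommRing A] {k : ℕ} {p : PS n A}
    (h : p ∈ fil (fun _ => 1) k) : p ∈ fil wt k := fun m hm => h m <| by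
  refine lt_of_le_of_lt ?_ hm
  rw [weight_coord, weight_coord]
  simp only [wt]
  omega

theorem vanishesToSecondOrder_iff (p : Ser n) :
    VanishesToSecondOrder p ↔ p ∈ fil (fun _ => 1) 2 := by
  have h : ∀ m : MIdx n, Finsupp.weight (fun _ => 1) m = m.degree := fun m => by
    rw [Finsupp.degree_eq_weight_one]
  constructor
  · intro hp m hm
    rw [h] at hm
    exact hp m (by omega)
  · intro hp m hm
    exact hp m (by rw [h]; omega)

/-- Membership in the second order part is determined by the weight, up to the linear term in
`u`. -/
theorem fil_one_two_of_fil_wt {A : Type*} [CommRing A] {p : PS n A} (h : p ∈ fil wt 2)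
    (hu : coeff (Finsupp.single Coord.u 1) p = 0) : p ∈ fil (fun _ => 1) 2 := fun m hm => by
  by_cases h1 : Finsupp.weight wt m < 2
  · exact h m h1
  · rw [weight_coord] at hm
    simp only [mul_one, ← weight_zw, ← weight_bw] at hm
    rw [weight_wt] at h1
    rw [eq_single_u (m := m) (by omega) (by omega), show m Coord.u = 1 by omega, hu]

end FormalCR

/-! ### Normal forms correspond to normalized solutions of the radial equations -/

namespace FormalCR

open MvPowerSeries

variable {n : ℕ}

theorem coeff_single_succ_of_du_eq_zero {A : Type*} [CommRing A] [Algebra ℂ A] {p : PS n A}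
    (h : du p = 0) (k : ℕ) : coeff (Finsupp.single Coord.u (k + 1)) p = 0 := by
  have h1 := congrArg (coeff (Finsupp.single Coord.u k)) h
  rw [coeff_pderiv, map_zero, ← Finsupp.single_add, Finsupp.single_eq_same] at h1
  refine natCast_mul_cancel (k := k + 1) (Nat.succ_ne_zero k) ?_
  rw [mul_zero, mul_comm]
  exact_mod_cast h1

/-- The terms of weight two in the transversal equation determine those of the unknowns. -/
theorem mem_fil_three_of_eul_add {a b : Ser n} (ha : a ∈ fil wt 2) (hb : b ∈ fil wt 2)
    (ca : cj a = a) (cb : cj b = b) (hau : coeff (Finsupp.single Coord.u 1) a = 0)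
    (hbu : coeff (Finsupp.single Coord.u 1) b = 0) (hp : proj 2 0 b = 0)
    (hE : eul a + im * eul b ∈ fil wt 3) : a ∈ fil wt 3 ∧ b ∈ fil wt 3 := by
  have hbar : ∀ {p : Ser n}, cj p = p → ∀ m,
      coeff m p = star (coeff (Finsupp.equivMapDomain Coord.bar m) p) := fun {p} hp m => by
    conv_lhs => rw [← hp, coeff_cj]
  have key : ∀ m : MIdx n, Finsupp.weight wt m = 2 → Finsupp.weight zw m ≠ 0 →
      coeff m a + Complex.I * coeff m b = 0 := fun m hm hz => by
    have h1 := hE m (by omega)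
    rw [map_add, im, coeff_C_mul, coeff_eul, coeff_eul, Algebra.algebraMap_self,
      RingHom.id_apply] at h1
    refine (mul_eq_zero.mp (?_ : ((Finsupp.weight zw m : ℕ) : ℂ) * _ = 0)).resolve_left
      (Nat.cast_ne_zero.mpr hz)
    rw [← h1]
    ring
  have main : ∀ m : MIdx n, Finsupp.weight wt m = 2 → Finsupp.weight zw m ≠ 0 →
      coeff m a = 0 ∧ coeff m b = 0 := fun m hm hz => by
    have h1 := key m hm hz
    -- For monomials in $z$ alone the normalization gives $b=0$. Otherwise the bidegree is (1,1),
    -- and reality turns the equation at the conjugate index into $a-ib=0$, next to $a+ib=0$.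
    by_cases hbw : Finsupp.weight bw m = 0
    · have h2 : coeff m b = 0 := by
        have h3 := congrArg (coeff m) hp
        rw [weight_wt] at hm
        have hu : Finsupp.weight zw m = 2 := by
          rcases Nat.eq_zero_or_pos (m Coord.u) with h | h
          · omega
          · omega
        rwa [coeff_proj, if_pos ⟨hu, hbw⟩, map_zero] at h3
      rw [h2, mul_zero, add_zero] at h1
      exact ⟨h1, h2⟩
    · have h3 := key (Finsupp.equivMapDomain Coord.bar m) (by rw [weight_wt_bar, hm])
        (by rwa [weight_zw_bar])
      have h4 := congrArg star h3
      rw [star_add, star_mul', star_zero, ← hbar ca, ← hbar cb,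
        show star Complex.I = -Complex.I from Complex.conj_I] at h4
      have h5 : coeff m a = 0 := by linear_combination (h1 + h4) / 2
      rw [h5, zero_add] at h1
      exact ⟨h5, (mul_eq_zero.mp h1).resolve_left Complex.I_ne_zero⟩
  have all : ∀ m : MIdx n, Finsupp.weight wt m < 3 → coeff m a = 0 ∧ coeff m b = 0 := by
    intro m hm
    by_cases h2 : Finsupp.weight wt m < 2
    · exact ⟨ha m h2, hb m h2⟩
    have hm2 : Finsupp.weight wt m = 2 := by omega
    by_cases hz : Finsupp.weight zw m = 0
    · by_cases hbw : Finsupp.weight bw m = 0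
      · rw [weight_wt] at hm2
        rw [eq_single_u hz hbw, show m Coord.u = 1 by omega]
        exact ⟨hau, hbu⟩
      · have := main (Finsupp.equivMapDomain Coord.bar m) (by rw [weight_wt_bar, hm2])
          (by rwa [weight_zw_bar])
        rw [hbar ca, hbar cb, this.1, this.2, star_zero]
        exact ⟨rfl, rfl⟩
    · exact main m hm2 hz
  exact ⟨fun m hm => (all m hm).1, fun m hm => (all m hm).2⟩

namespace IsInv

variable {f F : Fin n → Ser n} {g G φ : Ser n} (h : IsInv f g F G) {L : AlmostCR n}

include h

theorem preAdm (hφ : φ ∈ fil (fun _ => 1) 2) : LinModel.PreAdm F G φ where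
  F j := fil_wt_of_fil_one (h.F_mem j)
  G_mem := fil_wt_of_fil_one h.G_mem
  φ_mem := fil_wt_of_fil_one hφ
  du_G := fil_wt_of_fil_one (pderiv_mem_fil h.G_mem _ le_rfl)
  du_φ := fil_wt_of_fil_one (pderiv_mem_fil hφ _ le_rfl)

theorem coeff_u_sq_add : coeff (Finsupp.single Coord.u 2) g + coeff (Finsupp.single Coord.u 2) G =
    0 := by
  rw [← map_add]
  exact h.add_mem_fil _ (by rw [Finsupp.weight_single]; norm_num)

/-- The parameter is $-r/2$ because $g_{u^2}=r$ means the coefficient $r/2$ of $u^2$, and the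
inverse map has the opposite terms of degree two. The initial terms of $G$ and φ need not be
assumed: reality and the weight-two part of the equation force them. -/
theorem sol_of_isExtrinsicNormalForm (h0 : L.NoConstantTerms) (hs : L.StronglyNondegenerate)
    {r : ℝ} (hN : IsExtrinsicNormalForm L r f g φ) :
    (L.linModel h0 hs).Sol L.zb L.w (-((r / 2 : ℝ) : ℂ)) F G φ := by
  set μ := L.linModel h0 hs with hμ
  have hφ := (vanishesToSecondOrder_iff φ).mp hN.quasi.order_φ
  obtain ⟨hB, hW⟩ := (h.exists_transformsInto_iff h0 hφ).mp hN.quasi.radial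
  have hP := h.preAdm hφ
  have hE : eul (G - μ.q2) + im * eul (φ - μ.quad) ∈ fil wt 3 := by
    have h1 := hP.errW_sub_mem (μ := μ) (L.sub_linX_linModel_mem_fil h0 hs)
    rw [hW, zero_sub] at h1
    exact neg_mem_iff.mp h1
  have hCM := (L.chernMoserNormalized_iff h0 hs φ).mp hN.normalized
  have hu1 : Finsupp.weight (fun _ : Coord n => 1) (Finsupp.single Coord.u 1) < 2 := by
    rw [Finsupp.weight_single]
    norm_num
  have cG : cj (G - μ.q2) = G - μ.q2 := by rw [map_sub, h.cj_G, μ.cj_q2]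
  have cφ : cj (φ - μ.quad) = φ - μ.quad := by
    rw [map_sub, Model.cj_quad, show cj φ = φ from hN.quasi.real_φ]
  obtain ⟨h3G, h3φ⟩ := mem_fil_three_of_eul_add (sub_mem hP.G_mem μ.q2_mem_fil)
    (sub_mem hP.φ_mem μ.quad_mem_fil) cG cφ
    (by rw [map_sub, h.G_mem _ hu1, coeff_single_succ_of_du_eq_zero μ.du_q2, sub_zero])
    (by rw [map_sub, hφ _ hu1, coeff_single_succ_of_du_eq_zero μ.du_quad, sub_zero])
    (by rw [map_sub, hCM.1, μ.isBi_quad.proj_ne (by omega), sub_zero]) hE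
  -- At $u=0$ this is the weight-two statement just obtained; the positive powers of `u` vanish by
  -- the normalization.
  have h11 : proj 1 1 φ = μ.quad := by
    rw [← sub_eq_zero, ← μ.isBi_quad.proj_eq, ← map_sub]
    ext m
    rw [map_zero, coeff_proj]
    split_ifs with hm
    · by_cases hmu : m Coord.u = 0
      · exact h3φ m (by rw [weight_wt]; omega)
      · have h4 := congrArg (coeff m) (hCM.2.1 (m Coord.u - 1))
        rw [coeff_uproj, if_pos (by omega), coeff_proj, if_pos hm, map_zero] at h4
        have h5 : coeff m μ.quad = 0 := by
          have hle : Finsupp.single Coord.u 1 ≤ m := by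
            rw [Finsupp.single_le_iff]
            omega
          have h6 := congrArg (coeff (m - Finsupp.single Coord.u 1)) μ.du_quad
          rw [coeff_pderiv, tsub_add_cancel_of_le hle, map_zero] at h6
          exact (mul_eq_zero.mp h6).resolve_right (Nat.cast_add_one_ne_zero _)
        rw [map_sub, h4, h5, sub_zero]
    · rfl
  have cs : star (-((r / 2 : ℝ) : ℂ)) = -((r / 2 : ℝ) : ℂ) := by
    rw [star_neg, show star ((r / 2 : ℝ) : ℂ) = _ from Complex.conj_ofReal _]
  refine ⟨⟨⟨?_, cφ, (L.norm_sub_quad_iff h0 hs φ).mpr ⟨hN.normalized, h11⟩, ?_, ?_⟩,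
    ⟨hP, h3G, h3φ⟩⟩, hB, hW⟩
  · rw [map_sub, cG, map_mul, map_pow, cj_C, cs, cj_X_u]
  · exact fun j => h.F_mem j _ hu1
  · have hg := hN.g_uu
    have h7 := h.coeff_u_sq_add
    rw [derivAtZero, Finsupp.prod_single_index (by simp)] at hg
    rw [map_sub, map_sub, coeff_single_succ_of_du_eq_zero μ.du_q2, coeff_C_mul, X_pow_eq,
      coeff_monomial_same]
    push_cast
    norm_num at hg
    linear_combination h7 - hg / 2

theorem isExtrinsicNormalForm_of_sol (h0 : L.NoConstantTerms) (hs : L.StronglyNondegenerate)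
    {r : ℝ} (hS : (L.linModel h0 hs).Sol L.zb L.w (-((r / 2 : ℝ) : ℂ)) F G φ)
    (hφ : φ ∈ fil (fun _ => 1) 2) : IsExtrinsicNormalForm L r f g φ := by
  set μ := L.linModel h0 hs with hμ
  obtain ⟨hCM, h11⟩ := (L.norm_sub_quad_iff h0 hs φ).mp hS.normal.norm
  refine ⟨⟨h.cj_g, ?_, fun k => (vanishesToSecondOrder_iff _).mpr (h.f_mem k),
    (vanishesToSecondOrder_iff _).mpr h.g_mem, (vanishesToSecondOrder_iff _).mpr hφ,
    (h.exists_transformsInto_iff h0 hφ).mpr ⟨hS.errB, hS.errW⟩⟩, hCM, ?_⟩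
  · have := hS.normal.cj_φ
    rw [map_sub, Model.cj_quad] at this
    exact sub_left_injective this
  · have h7 := h.coeff_u_sq_add
    have h8 := hS.normal.G_u
    rw [map_sub, map_sub, coeff_single_succ_of_du_eq_zero μ.du_q2, coeff_C_mul, X_pow_eq,
      coeff_monomial_same] at h8
    rw [derivAtZero, Finsupp.prod_single_index (by simp)]
    push_cast at h8
    norm_num
    linear_combination 2 * h7 - 2 * h8

end IsInv

namespace LinModel

variable {A : Type*} [CommRing A] [StarRing A] [Algebra ℂ A] [StarModule ℂ A] {μ : LinModel n A}
  {zb : Fin n → Fin n → PS n A} {w : Fin n → PS n A} {s : A} {F : Fin n → PS n A} {G φ : PS n A}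
  (h : μ.Sol zb w s F G φ)

include h

omit [StarModule ℂ A] in
theorem Sol.F_mem (j : Fin n) : F j ∈ fil (fun _ => 1) 2 :=
  fil_one_two_of_fil_wt (h.adm.toPreAdm.F j) (h.normal.F_u j)

omit [StarModule ℂ A] in
theorem Sol.G_mem : G ∈ fil (fun _ => 1) 2 := by
  refine fil_one_two_of_fil_wt h.adm.G_mem ?_
  rw [← constantCoeff_pderiv, ← coeff_zero_eq_constantCoeff_apply]
  exact h.adm.du_G 0 (by simp)

omit [StarModule ℂ A] in
theorem Sol.φ_mem : φ ∈ fil (fun _ => 1) 2 := by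
  refine fil_one_two_of_fil_wt h.adm.φ_mem ?_
  rw [← constantCoeff_pderiv, ← coeff_zero_eq_constantCoeff_apply]
  exact h.adm.du_φ 0 (by simp)

theorem Sol.cj_G (hs : star s = s) : cj G = G := by
  have := h.normal.cj_G
  rw [map_sub, map_sub, μ.cj_q2, map_mul, map_pow, cj_C, hs, cj_X_u, sub_left_inj,
    sub_left_inj] at this
  exact this

theorem Sol.exists_isInv (hs : star s = s) : ∃ f g, IsInv f g F G := by
  obtain ⟨f, g, hfg⟩ := FormalCR.exists_isInv h.F_mem h.G_mem (h.cj_G hs)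
  exact ⟨f, g, hfg.symm⟩

end LinModel

end FormalCR

/-! ### Uniqueness of normal forms and the algebra of universal functions -/

namespace FormalCR

open MvPowerSeries

theorem IsInv.unique {n : ℕ} {A : Type*} [CommRing A] [StarRing A] {f f' F : Fin n → PS n A}
    {g g' G : PS n A} (h : IsInv f g F G) (h' : IsInv f' g' F G) : f = f' ∧ g = g' := by
  have key : ∀ i, comps f g i = comps f' g' i := fun i => by
    have h1 := congrArg (subst (comps f g)) (h'.right i)
    rw [h.symm.subst_subst, subst_X h.hasSubst] at h1
    exact h1.symm
  exact ⟨funext fun j => add_left_cancel (key (Coord.z j)), add_left_cancel (key Coord.u)⟩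

theorem mem_fil_wt_one {n : ℕ} {A : Type*} [CommRing A] {p : PS n A}
    (h : constantCoeff p = 0) : p ∈ fil wt 1 := fun m hm => by
  have h0 : m = 0 := by
    by_contra hne
    obtain ⟨i, hi⟩ := Finsupp.ne_iff.mp hne
    have := Finsupp.le_weight wt (s := i) (by rcases i with j | j | j <;> simp [wt]) m
    rw [Nat.lt_one_iff.mp hm] at this
    exact hi (Nat.le_zero.mp this)
  rw [h0, coeff_zero_eq_constantCoeff_apply, h]

theorem IsExtrinsicNormalForm.exists_isInv {n : ℕ} {L : AlmostCR n} {r : ℝ} {f : Fin n → Ser n}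
    {g φ : Ser n} (h : IsExtrinsicNormalForm L r f g φ) : ∃ F G, IsInv f g F G :=
  FormalCR.exists_isInv (fun j => (vanishesToSecondOrder_iff _).mp (h.quasi.order_f j))
    ((vanishesToSecondOrder_iff _).mp h.quasi.order_g) h.quasi.real_g

theorem IsExtrinsicNormalForm.unique {n : ℕ} (hn : 0 < n) {L : AlmostCR n}
    (h0 : L.NoConstantTerms) (hs : L.StronglyNondegenerate) {r : ℝ} {f f' : Fin n → Ser n}
    {g g' φ φ' : Ser n} (h : IsExtrinsicNormalForm L r f g φ)
    (h' : IsExtrinsicNormalForm L r f' g' φ') : f = f' ∧ g = g' ∧ φ = φ' := by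
  obtain ⟨F, G, hi⟩ := h.exists_isInv
  obtain ⟨F', G', hi'⟩ := h'.exists_isInv
  obtain ⟨e1, e2, e3⟩ := LinModel.sol_unique (fun k j => mem_fil_wt_one (h0.1 k j))
    (L.sub_linX_linModel_mem_fil h0 hs) hn (hi.sol_of_isExtrinsicNormalForm h0 hs h)
    (hi'.sol_of_isExtrinsicNormalForm h0 hs h')
  subst e1 e2
  obtain ⟨e4, e5⟩ := hi.unique hi'
  exact ⟨e4, e5, e3⟩

/-- Conjugation of the variables of the universal polynomials. -/
def JetVar.bar {n : ℕ} : JetVar n → JetVar n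
  | .r => .r
  | .zb k j m => .zbConj k j m
  | .w j m => .wConj j m
  | .zbConj k j m => .zb k j m
  | .wConj j m => .w j m
  | .invLevi => .invLevi
  | .invStrong => .invStrong

namespace AlmostCR

variable {n : ℕ} {L : AlmostCR n}

theorem star_leviMatrix (h0 : L.NoConstantTerms) (hs : L.StronglyNondegenerate) (j k : Fin n) :
    star (L.leviMatrix j k) = L.leviMatrix k j := by
  rw [leviMatrix_eq h0]
  exact (L.linModel h0 hs).star_c j k

theorem star_det_leviMatrix (h0 : L.NoConstantTerms) (hs : L.StronglyNondegenerate) :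
    star L.leviMatrix.det = L.leviMatrix.det := by
  rw [← Matrix.det_conjTranspose]
  congr 1
  ext j k
  exact star_leviMatrix h0 hs k j

/-- Conjugating the entries has the same effect as exchanging the two blocks of rows and of columns,
which does not change the determinant. -/
theorem star_det_strongMatrix : star L.strongMatrix.det = L.strongMatrix.det := by
  have h : L.strongMatrix.map star = L.strongMatrix.submatrix (Equiv.sumComm _ _)
      (Equiv.sumComm _ _) := by
    ext i j
    rcases i with i | i <;> rcases j with j | j <;> simp [strongMatrix, Complex.conj_ofNat]
  have h1 : star L.strongMatrix.det = (L.strongMatrix.map star).det :=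
    RingHom.map_det (starRingEnd ℂ) L.strongMatrix
  rw [h1, h, Matrix.det_submatrix_equiv_self]

theorem jet_bar (h0 : L.NoConstantTerms) (hs : L.StronglyNondegenerate) (r : ℝ) (v : JetVar n) :
    L.jet r v.bar = star (L.jet r v) := by
  cases v with
  | r => exact (Complex.conj_ofReal r).symm
  | zb k j m => rfl
  | w j m => rfl
  | zbConj k j m => exact (star_star _).symm
  | wConj j m => exact (star_star _).symm
  | invLevi => rw [JetVar.bar, jet, star_inv₀, star_det_leviMatrix h0 hs]
  | invStrong => rw [JetVar.bar, jet, star_inv₀, star_det_strongMatrix]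

end AlmostCR

/-- The admissible structures, together with the real parameter. -/
abbrev Param (n : ℕ) : Type :=
  {p : AlmostCR n × ℝ // p.1.NoConstantTerms ∧ p.1.StronglyNondegenerate}

/-- The functions of the structure and of the parameter that are given by universal polynomials. -/
noncomputable def universal (n : ℕ) : StarSubalgebra ℂ (Param n → ℂ) where
  carrier := {x | ∃ P : MvPolynomial (JetVar n) ℂ, ∀ p, x p = MvPolynomial.eval (p.1.1.jet p.1.2) P}
  mul_mem' := by
    rintro x y ⟨P, hP⟩ ⟨Q, hQ⟩
    exact ⟨P * Q, fun p => by rw [Pi.mul_apply, hP, hQ, map_mul]⟩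
  add_mem' := by
    rintro x y ⟨P, hP⟩ ⟨Q, hQ⟩
    exact ⟨P + Q, fun p => by rw [Pi.add_apply, hP, hQ, map_add]⟩
  algebraMap_mem' c := ⟨MvPolynomial.C c, fun p => by rw [MvPolynomial.eval_C]; rfl⟩
  star_mem' := by
    rintro x ⟨P, hP⟩
    -- Conjugate the coefficients of the polynomial and exchange each jet variable with its
    -- conjugate. The variables $r$ and the two inverse determinants are fixed because their values
    -- are real.
    refine ⟨MvPolynomial.rename JetVar.bar (MvPolynomial.map (starRingEnd ℂ) P), fun p => ?_⟩
    rw [MvPolynomial.eval_rename, Pi.star_apply, hP]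
    have h := MvPolynomial.map_eval (starRingEnd ℂ) (p.1.1.jet p.1.2) P
    have e : p.1.1.jet p.1.2 ∘ JetVar.bar = starRingEnd ℂ ∘ p.1.1.jet p.1.2 :=
      funext fun v => AlmostCR.jet_bar p.2.1 p.2.2 _ v
    rw [e]
    exact h

namespace universal

variable {n : ℕ}

/-- The evaluation of a universal function. -/
noncomputable def ev (p : Param n) : universal n →⋆ₐ[ℂ] ℂ where
  toFun x := x.1 p
  map_one' := rfl
  map_mul' _ _ := rfl
  map_zero' := rfl
  map_add' _ _ := rfl
  commutes' _ := rfl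
  map_star' _ := rfl

/-- Elements are functions on the admissible structures rather than formal polynomials. Relations
such as determinant times inverse equals one therefore hold as soon as they hold pointwise. -/
theorem ext_ev {x y : universal n} (h : ∀ p, ev p x = ev p y) : x = y :=
  Subtype.ext (funext h)

theorem exists_eval_eq (x : universal n) : ∃ P : MvPolynomial (JetVar n) ℂ, ∀ p,
    ev p x = MvPolynomial.eval (p.1.1.jet p.1.2) P := x.2

theorem factorial_ne_zero (m : MIdx n) : (m.prod fun _ k => (k.factorial : ℂ)) ≠ 0 :=
  Finset.prod_ne_zero_iff.mpr fun _ _ => Nat.cast_ne_zero.mpr (Nat.factorial_ne_zero _)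

/-- The universal `z̄`-components. -/
noncomputable def zb (k j : Fin n) : PS n (universal n) := mkPS fun m =>
  ⟨fun p => coeff m (p.1.1.zb k j), MvPolynomial.C (m.prod fun _ k => (k.factorial : ℂ))⁻¹ *
    MvPolynomial.X (.zb k j m), fun p => by
      rw [map_mul, MvPolynomial.eval_C, MvPolynomial.eval_X, AlmostCR.jet, derivAtZero,
        inv_mul_cancel_left₀ (factorial_ne_zero m)]⟩

/-- The universal transversal component. -/
noncomputable def w (j : Fin n) : PS n (universal n) := mkPS fun m =>
  ⟨fun p => coeff m (p.1.1.w j), MvPolynomial.C (m.prod fun _ k => (k.factorial : ℂ))⁻¹ *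
    MvPolynomial.X (.w j m), fun p => by
      rw [map_mul, MvPolynomial.eval_C, MvPolynomial.eval_X, AlmostCR.jet, derivAtZero,
        inv_mul_cancel_left₀ (factorial_ne_zero m)]⟩

/-- The inverse of the determinant of the Levi form. -/
noncomputable def invLevi : universal n :=
  ⟨fun p => p.1.1.leviMatrix.det⁻¹, MvPolynomial.X .invLevi, fun p => by
    rw [MvPolynomial.eval_X]; rfl⟩

/-- The inverse of the determinant of `6i𝓛 + 𝓝ʷ`. -/
noncomputable def invStrong : universal n :=
  ⟨fun p => p.1.1.strongMatrix.det⁻¹, MvPolynomial.X .invStrong, fun p => by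
    rw [MvPolynomial.eval_X]; rfl⟩

/-- The coefficient of `u²` in the transversal component of the inverse map. -/
noncomputable def param : universal n :=
  ⟨fun p => -((p.1.2 / 2 : ℝ) : ℂ), MvPolynomial.C (-(1 / 2)) * MvPolynomial.X .r, fun p => by
    rw [map_mul, MvPolynomial.eval_C, MvPolynomial.eval_X, AlmostCR.jet]
    push_cast
    ring⟩

theorem star_param : star (param : universal n) = param := ext_ev fun p => by
  rw [map_star]
  change star (-((p.1.2 / 2 : ℝ) : ℂ)) = -((p.1.2 / 2 : ℝ) : ℂ)
  rw [star_neg, show star ((p.1.2 / 2 : ℝ) : ℂ) = _ from Complex.conj_ofReal _]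

/-- The universal coefficients of `z̄` in the transversal component. -/
noncomputable def coA : Matrix (Fin n) (Fin n) (universal n) := fun j k =>
  coeff (Finsupp.single (Coord.zb k) 1) (w j)

/-- The universal coefficients of `z` in the transversal component. -/
noncomputable def coB : Matrix (Fin n) (Fin n) (universal n) := fun j k =>
  coeff (Finsupp.single (Coord.z k) 1) (w j)

theorem ev_coA (p : Param n) (j k : Fin n) : ev p (coA j k) = p.1.1.coA j k := rfl

theorem ev_coB (p : Param n) (j k : Fin n) : ev p (coB j k) = p.1.1.coB j k := rfl

theorem ev_leviOf (p : Param n) (j k : Fin n) :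
    ev p (leviOf coA j k) = leviOf p.1.1.coA j k := by
  rw [leviOf, leviOf, map_mul, map_sub, map_star, ev_coA, ev_coA, AlgHomClass.commutes]

theorem ev_nonintOf (p : Param n) (j k : Fin n) :
    ev p (nonintOf coB j k) = nonintOf p.1.1.coB j k := by
  rw [nonintOf, nonintOf, map_sub, ev_coB, ev_coB]

theorem ev_strongOf (p : Param n) (i j : Fin n ⊕ Fin n) :
    ev p (strongOf coA coB i j) = strongOf p.1.1.coA p.1.1.coB i j := by
  rcases i with i | i <;> rcases j with j | j
  · exact ev_nonintOf p i j
  · change ev p (_ * star _) = _ * star _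
    rw [map_mul, map_star, ev_leviOf, AlgHomClass.commutes]
  · change ev p (_ * _) = _ * _
    rw [map_mul, ev_leviOf, AlgHomClass.commutes]
  · change ev p (star _) = star _
    rw [map_star, ev_nonintOf]

theorem ev_det {ι : Type*} [Fintype ι] [DecidableEq ι] (p : Param n) (M : Matrix ι ι (universal n))
    (M' : Matrix ι ι ℂ) (h : ∀ i j, ev p (M i j) = M' i j) : ev p M.det = M'.det := by
  have h1 := RingHom.map_det (RingHomClass.toRingHom (ev p)) M
  refine h1.trans (congrArg Matrix.det ?_)
  ext i j
  exact h i j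

theorem det_levi_mul : (leviOf (coA (n := n))).det * invLevi = 1 := ext_ev fun p => by
  rw [map_mul, ev_det p _ _ (ev_leviOf p), map_one, ← AlmostCR.leviMatrix_eq p.2.1]
  exact mul_inv_cancel₀ (AlmostCR.StronglyNondegenerate.det_levi p.2.2)

theorem det_strong_mul : (strongOf (coA (n := n)) coB).det * invStrong = 1 := ext_ev fun p => by
  rw [map_mul, ev_det p _ _ (ev_strongOf p), map_one, ← AlmostCR.strongMatrix_eq p.2.1]
  exact mul_inv_cancel₀ (AlmostCR.StronglyNondegenerate.det_strong p.2.2)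

/-- The universal algebraic data at the origin. -/
noncomputable def linModel : LinModel n (universal n) :=
  LinModel.ofCoeff coA coB invLevi invStrong det_levi_mul det_strong_mul

theorem maps_linModel (p : Param n) :
    (linModel (n := n)).Maps (ev p) (p.1.1.linModel p.2.1 p.2.2) where
  c j k := ev_leviOf p j k
  H j k := by
    change ev p (_ * (_ + star _)) = _ * (_ + star _)
    rw [map_mul, map_add, map_star, ev_coA, ev_coA, AlgHomClass.commutes]
  B j k := by
    change ev p (_ * (_ + _)) = _ * (_ + _)
    rw [map_mul, map_add, ev_coB, ev_coB, AlgHomClass.commutes]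

/-- The radial equations are solved once over the algebra of universal functions. Inversion of the
map and evaluation at a structure preserve everything, so one triple of series gives the normal
forms of all structures. -/
theorem exists_isExtrinsicNormalForm (hn : 0 < n) :
    ∃ (f : Fin n → PS n (universal n)) (g φ : PS n (universal n)), ∀ p : Param n,
      IsExtrinsicNormalForm p.1.1 p.1.2 (fun j => pmap (ev p) (f j)) (pmap (ev p) g)
        (pmap (ev p) φ) := by
  obtain ⟨F, G, φ, hS⟩ := LinModel.exists_sol (μ := linModel (n := n)) (zb := zb) (w := w)
    (fun k j => mem_fil_wt_one (ext_ev fun p => p.2.1.1 k j))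
    (fun j => sub_linX_mem_fil _ _ (ext_ev fun p => p.2.1.2 j) (fun _ => rfl) fun _ => rfl)
    hn param
  obtain ⟨f, g, hI⟩ := hS.exists_isInv star_param
  exact ⟨f, g, φ, fun p => (hI.map (ev p)).isExtrinsicNormalForm_of_sol p.2.1 p.2.2
    ((maps_linModel p).sol hS) (pmap_mem_fil _ hS.φ_mem)⟩

end universal

end FormalCR

theorem theorem8p1 (n : ℕ) (hn : 0 < n) :
    (∀ L : FormalCR.AlmostCR n, L.NoConstantTerms → L.StronglyNondegenerate → ∀ r : ℝ,
      ∃! p : (Fin n → FormalCR.Ser n) × FormalCR.Ser n × FormalCR.Ser n,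
        FormalCR.IsExtrinsicNormalForm L r p.1 p.2.1 p.2.2) ∧
    (∃ (Pf : Fin n → FormalCR.MIdx n → MvPolynomial (FormalCR.JetVar n) ℂ)
       (Pg Pφ : FormalCR.MIdx n → MvPolynomial (FormalCR.JetVar n) ℂ),
      ∀ L : FormalCR.AlmostCR n, L.NoConstantTerms → L.StronglyNondegenerate → ∀ r : ℝ,
        ∀ (f : Fin n → FormalCR.Ser n) (g φ : FormalCR.Ser n),
          FormalCR.IsExtrinsicNormalForm L r f g φ →
          ∀ m : FormalCR.MIdx n,
            (∀ k, FormalCR.derivAtZero m (f k) = MvPolynomial.eval (L.jet r) (Pf k m)) ∧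
            FormalCR.derivAtZero m g = MvPolynomial.eval (L.jet r) (Pg m) ∧
            FormalCR.derivAtZero m φ = MvPolynomial.eval (L.jet r) (Pφ m)) := by
  obtain ⟨f, g, φ, hN⟩ := FormalCR.universal.exists_isExtrinsicNormalForm hn
  constructor
  · intro L h0 hs r
    refine ⟨(_, _, _), hN ⟨(L, r), h0, hs⟩, ?_⟩
    rintro ⟨f', g', φ'⟩ h'
    obtain ⟨e1, e2, e3⟩ := FormalCR.IsExtrinsicNormalForm.unique hn h0 hs h'
      (hN ⟨(L, r), h0, hs⟩)
    exact Prod.ext e1 (Prod.ext e2 e3)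
  -- Each coefficient of the universal solution is represented by a polynomial in the jet variables;
  -- by uniqueness, any given normal form is the specialization of that solution.
  · choose Q hQ using FormalCR.universal.exists_eval_eq (n := n)
    have key : ∀ (p : FormalCR.Param n) (m : FormalCR.MIdx n)
        (x : FormalCR.PS n (FormalCR.universal n)),
        FormalCR.derivAtZero m (FormalCR.pmap (FormalCR.universal.ev p) x) =
          MvPolynomial.eval (p.1.1.jet p.1.2) (MvPolynomial.C (m.prod fun _ k =>
            (k.factorial : ℂ)) * Q (MvPowerSeries.coeff m x)) := fun p m x => by
      rw [FormalCR.derivAtZero, FormalCR.coeff_pmap, hQ, map_mul, MvPolynomial.eval_C]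
    let P : FormalCR.PS n (FormalCR.universal n) → FormalCR.MIdx n →
        MvPolynomial (FormalCR.JetVar n) ℂ := fun x m =>
      MvPolynomial.C (m.prod fun _ k => (k.factorial : ℂ)) * Q (MvPowerSeries.coeff m x)
    refine ⟨fun k => P (f k), P g, P φ, fun L h0 hs r f' g' φ' h' m => ?_⟩
    obtain ⟨e1, e2, e3⟩ := FormalCR.IsExtrinsicNormalForm.unique hn h0 hs h'
      (hN ⟨(L, r), h0, hs⟩)
    rw [e1, e2, e3]
    exact ⟨fun k => key ⟨(L, r), h0, hs⟩ m (f k), key ⟨(L, r), h0, hs⟩ m g,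
      key ⟨(L, r), h0, hs⟩ m φ⟩
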